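/- **Theorem.** Let $n$ be a positive squarefree integer and write its odd part as a product $p_1p_2\cdots p_r$ of odd primes, in any order ($r=0$ is allowed; the determinant of the empty matrix is $1$). *Class groups.* For a positive squarefree integer $d$ let $g(d)\in\mathbb F_2$ be the order, modulo $2$, of the group $2\,\mathrm{Cl}(\mathbb Q(\sqrt{-d}))$. *The function $\mathscr L$.* Let $\mathscr L$ be the $\mathbb F_2$-valued function with $\mathscr L(1)=1$, with $$\mathscr L(m)=\sum_{\substack{p\mid d\mid m\\ d\equiv 1\,(8)}} g(d)\,\mathscr L(m/d)\qquad(\ast)$$ if $m>1$ is squarefree and $m\equiv 1\pmod 8$, where $p$ is a prime divisor of $m$ (say the smallest one), and with $\mathscr L(m)=0$ for all other $m$. *Linear algebra over $\mathbb F_2$.* For an odd prime $p$ and an integer $d$ prime to $p$ put $\left(\frac dp\right)_+=\frac12\left(1-\left(\frac dp\right)\right)\in\mathbb F_2$. Define $\mathbf y,\mathbf z\in\mathbb F_2^r$ by $y_i=\left(\frac{-1}{p_i}\right)_+$ and $z_i=\left(\frac{2}{p_i}\right)_+$, and let $A$ be the $r\times r$ matrix over $\mathbb F_2$ with $A_{ij}=\left(\frac{p_j}{p_i}\right)_+$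 for $i\neq j$ and $A_{ii}=\sum_{j\ne i}A_{ij}$. For $\mathbf v\in\mathbb F_2^r$ let $D_v$ be the diagonal matrix with diagonal $\mathbf v$. In the sums below $d,d_0,d_1$ are positive integers. Then the value $\mathscr L(n)$ does not depend on the choice of prime divisors in $(\ast)$: if $n\equiv1\pmod 8$, then $(\ast)$ holds for $m=n$ with every prime divisor $p$ of $n$. Moreover, the following equalities hold in $\mathbb F_2$. * (1) If $n\equiv 1\pmod 8$: $\displaystyle \mathscr L(n)=\begin{vmatrix}A+A^\top&A^\top\\A&D_z\end{vmatrix}$. * (2) If $n\equiv 2\pmod 8$: $\displaystyle \sum_{\substack{d\mid n\\ d\equiv n\,(16)}}g(d)\mathscr L(n/d)=\begin{vmatrix}A+A^\top+D_{y+z}&A^\top\\A&D_z\end{vmatrix}$. * (3) If $n\equiv 3\pmod 8$: $\displaystyle \sum_{\substack{d\mid n\\ d\equiv 3\,(8)}}g(d)\mathscr L(n/d)=\begin{vmatrix}A+A^\top&A^\top&\mathbf y\\A&D_z&0\\\mathbf y^\top&0&0\end{vmatrix}$. * (5a) If $n\equiv 5\pmod 8$: $\displaystyle \sum_{\substack{d\mid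 n\\ d\equiv 5\,(8)}}g(d)\mathscr L(n/d)=\begin{vmatrix}A+A^\top&A^\top&\mathbf y+\mathbf z\\A&D_z&0\\\mathbf y^\top+\mathbf z^\top&0&0\end{vmatrix}$. * (5b) If $n\equiv 5\pmod 8$: $\displaystyle \sum_{\substack{d_0d_1\mid n\\ d_0\equiv 7\,(8),\ d_1\equiv 3\,(8)}}g(d_0)g(d_1)\mathscr L(n/d_0d_1)=\begin{vmatrix}A+A^\top&A^\top&0\\A&D_z&\mathbf y\\0&\mathbf y^\top&0\end{vmatrix}$. * (6) If $n\equiv 6\pmod 8$: $\displaystyle \sum_{\substack{d_0d_1\mid n\\ d_0\equiv 7n\,(16),\ d_1\equiv 7\,(8)}}g(d_0)g(d_1)\mathscr L(n/d_0d_1)+\sum_{\substack{d\mid n\\ d\equiv n\,(16)}}g(d)\mathscr L(n/d)=\begin{vmatrix}A+A^\top+D_{y+z}&A^\top&\mathbf y\\A&D_z&\mathbf y\\\mathbf y^\top&\mathbf y^\top&0\end{vmatrix}$. * (7a) If $n\equiv 7\pmod 8$: $\displaystyle \sum_{\substack{d\mid n\\ d\equiv 7\,(8)}}g(d)\mathscr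 L(n/d)=\begin{vmatrix}A+A^\top&A^\top&\mathbf y+\mathbf z&0\\A&D_z&0&\mathbf y\\\mathbf y^\top+\mathbf z^\top&0&0&0\\0&\mathbf y^\top&0&0\end{vmatrix}$. * (7b) If $n\equiv 7\pmod 8$: $\displaystyle \sum_{\substack{d_0d_1\mid n\\ d_0\equiv 5\,(8),\ d_1\equiv 3\,(8)}}g(d_0)g(d_1)\mathscr L(n/d_0d_1)=\begin{vmatrix}A+A^\top&A^\top&\mathbf y+\mathbf z&\mathbf y\\A&D_z&0&0\\\mathbf y^\top+\mathbf z^\top&0&0&0\\\mathbf y^\top&0&0&0\end{vmatrix}$. -/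

import Mathlib

open scoped NumberField IntermediateField

noncomputable section

namespace TYZ

/-- The additive Legendre symbol `(d / p)₊ = (1 - (d / p)) / 2`, as an element of `𝔽₂`. -/
def addLegendre (p : ℕ) [Fact p.Prime] (d : ℤ) : ZMod 2 :=
  (((1 - legendreSym p d) / 2 : ℤ) : ZMod 2)

section Vectors

variable {r : ℕ} (p : Fin r → ℕ) [∀ i, Fact (p i).Prime]

/-- The vector with entries `y_i = (-1 / p_i)₊`. -/
def vecY : Fin r → ZMod 2 := fun i => addLegendre (p i) (-1)

/-- The vector with entries `z_i = (2 / p_i)₊`. -/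
def vecZ : Fin r → ZMod 2 := fun i => addLegendre (p i) 2

/-- The `r × r` matrix with `A_ij = (p_j / p_i)₊` for `i ≠ j` and `A_ii = ∑_{j ≠ i} A_ij`. -/
def matA : Matrix (Fin r) (Fin r) (ZMod 2) :=
  Matrix.of fun i j =>
    if i = j then ∑ k ∈ Finset.univ.erase i, addLegendre (p i) (p k : ℤ)
    else addLegendre (p i) (p j : ℤ)

end Vectors

/-- The imaginary quadratic field `ℚ(√-n)`, as a subfield of `ℂ`. -/
abbrev imagQuadField (n : ℕ) : IntermediateField ℚ ℂ := ℚ⟮(Real.sqrt n : ℂ) * Complex.I⟯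

/-- `g(n) ∈ 𝔽₂`: the order of `2 Cl(ℚ(√-n))` modulo 2. The class group is written multiplicatively,
so `2 Cl` is the subgroup of squares. -/
def g (n : ℕ) : ZMod 2 :=
  (Nat.card (powMonoidHom 2 :
    ClassGroup (𝓞 (imagQuadField n)) →* ClassGroup (𝓞 (imagQuadField n))).range : ZMod 2)

/-- The recursive function `ℒ`, with the smallest prime factor of `n` as the prime divisor that is
used in the recursion. The sum is over the divisors `d` of `n` with `n.minFac ∣ d` and
`d ≡ 1 (mod 8)`. -/
def scriptL (n : ℕ) : ZMod 2 :=
  if n = 1 then 1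
  else if _h : n ≡ 1 [MOD 8] ∧ Squarefree n then
    ∑ d ∈ (n.divisors.filter fun d => n.minFac ∣ d ∧ d ≡ 1 [MOD 8]).attach,
      g d.1 * scriptL (n / d.1)
  else 0
termination_by n
decreasing_by
  obtain ⟨d, hd⟩ := d
  simp only [Finset.mem_filter, Nat.mem_divisors] at hd
  obtain ⟨⟨-, h0⟩, h2, -⟩ := hd
  refine Nat.div_lt_self (Nat.pos_of_ne_zero h0) ?_
  have hp : n.minFac.Prime := Nat.minFac_prime (by assumption)
  rcases Nat.lt_or_ge 1 d with h | h
  · exact h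
  · exfalso
    interval_cases d
    · rename_i hd0
      simp_all [Nat.ModEq]
    · exact hp.one_lt.ne' (Nat.dvd_one.mp h2)

/-- The sum over all divisors `d` of `n` with `P d` of `g(d) ℒ(n/d)`. -/
def sumOne (n : ℕ) (P : ℕ → Prop) [DecidablePred P] : ZMod 2 :=
  ∑ d ∈ n.divisors with P d, g d * scriptL (n / d)

/-- The sum over all ordered pairs `(d₀, d₁)` of positive integers with `d₀ d₁ ∣ n`, `P d₀` and
`Q d₁` of `g(d₀) g(d₁) ℒ(n / (d₀ d₁))`. -/
def sumTwo (n : ℕ) (P Q : ℕ → Prop) [DecidablePred P] [DecidablePred Q] : ZMod 2 :=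
  ∑ d ∈ n.divisors ×ˢ n.divisors with d.1 * d.2 ∣ n ∧ P d.1 ∧ Q d.2,
    g d.1 * g d.2 * scriptL (n / (d.1 * d.2))

def L1 (n : ℕ) : ZMod 2 := scriptL n

def L2 (n : ℕ) : ZMod 2 := sumOne n (fun d => d ≡ n [MOD 16])

def L3 (n : ℕ) : ZMod 2 := sumOne n (fun d => d ≡ 3 [MOD 8])

def L5a (n : ℕ) : ZMod 2 := sumOne n (fun d => d ≡ 5 [MOD 8])

def L5b (n : ℕ) : ZMod 2 := sumTwo n (fun d₀ => d₀ ≡ 7 [MOD 8]) (fun d₁ => d₁ ≡ 3 [MOD 8])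

def L6 (n : ℕ) : ZMod 2 :=
  sumTwo n (fun d₀ => d₀ ≡ 7 * n [MOD 16]) (fun d₁ => d₁ ≡ 7 [MOD 8])
    + sumOne n (fun d => d ≡ n [MOD 16])

def L7a (n : ℕ) : ZMod 2 := sumOne n (fun d => d ≡ 7 [MOD 8])

def L7b (n : ℕ) : ZMod 2 := sumTwo n (fun d₀ => d₀ ≡ 5 [MOD 8]) (fun d₁ => d₁ ≡ 3 [MOD 8])

/-- The bordered matrix `[[M, v], [vᵀ, 0]]`. -/
def border {ι : Type} (M : Matrix ι ι (ZMod 2)) (v : ι → ZMod 2) :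
    Matrix (ι ⊕ Unit) (ι ⊕ Unit) (ZMod 2) :=
  Matrix.fromBlocks M (Matrix.replicateCol Unit v) (Matrix.replicateRow Unit v) 0

section Matrices

variable {r : ℕ} (A : Matrix (Fin r) (Fin r) (ZMod 2)) (y z : Fin r → ZMod 2)

/-- `[[A + Aᵀ, Aᵀ], [A, D_z]]` -/
def M1 : Matrix (Fin r ⊕ Fin r) (Fin r ⊕ Fin r) (ZMod 2) :=
  Matrix.fromBlocks (A + A.transpose) A.transpose A (Matrix.diagonal z)

/-- `[[A + Aᵀ + D_{y+z}, Aᵀ], [A, D_z]]` -/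
def M2 : Matrix (Fin r ⊕ Fin r) (Fin r ⊕ Fin r) (ZMod 2) :=
  Matrix.fromBlocks (A + A.transpose + Matrix.diagonal (y + z)) A.transpose A (Matrix.diagonal z)

/-- `[[A + Aᵀ, Aᵀ, y], [A, D_z, 0], [yᵀ, 0, 0]]` -/
def M3 : Matrix ((Fin r ⊕ Fin r) ⊕ Unit) ((Fin r ⊕ Fin r) ⊕ Unit) (ZMod 2) :=
  border (M1 A z) (Sum.elim y 0)

/-- `[[A + Aᵀ, Aᵀ, y + z], [A, D_z, 0], [yᵀ + zᵀ, 0, 0]]` -/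
def M5a : Matrix ((Fin r ⊕ Fin r) ⊕ Unit) ((Fin r ⊕ Fin r) ⊕ Unit) (ZMod 2) :=
  border (M1 A z) (Sum.elim (y + z) 0)

/-- `[[A + Aᵀ, Aᵀ, 0], [A, D_z, y], [0, yᵀ, 0]]` -/
def M5b : Matrix ((Fin r ⊕ Fin r) ⊕ Unit) ((Fin r ⊕ Fin r) ⊕ Unit) (ZMod 2) :=
  border (M1 A z) (Sum.elim 0 y)

/-- `[[A + Aᵀ + D_{y+z}, Aᵀ, y], [A, D_z, y], [yᵀ, yᵀ, 0]]` -/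
def M6 : Matrix ((Fin r ⊕ Fin r) ⊕ Unit) ((Fin r ⊕ Fin r) ⊕ Unit) (ZMod 2) :=
  border (M2 A y z) (Sum.elim y y)

/-- `[[A + Aᵀ, Aᵀ, y + z, 0], [A, D_z, 0, y], [yᵀ + zᵀ, 0, 0, 0], [0, yᵀ, 0, 0]]` -/
def M7a :
    Matrix (((Fin r ⊕ Fin r) ⊕ Unit) ⊕ Unit) (((Fin r ⊕ Fin r) ⊕ Unit) ⊕ Unit) (ZMod 2) :=
  border (border (M1 A z) (Sum.elim (y + z) 0)) (Sum.elim (Sum.elim 0 y) 0)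

/-- `[[A + Aᵀ, Aᵀ, y + z, y], [A, D_z, 0, 0], [yᵀ + zᵀ, 0, 0, 0], [yᵀ, 0, 0, 0]]` -/
def M7b :
    Matrix (((Fin r ⊕ Fin r) ⊕ Unit) ⊕ Unit) (((Fin r ⊕ Fin r) ⊕ Unit) ⊕ Unit) (ZMod 2) :=
  border (border (M1 A z) (Sum.elim (y + z) 0)) (Sum.elim (Sum.elim y 0) 0)

end Matrices

end TYZ

end

noncomputable section

namespace TYZ

open Matrix Finset

local notation "F₂" => ZMod 2

/-! ### Determinants over 𝔽₂ -/

section General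

variable {n : Type*} [Fintype n] [DecidableEq n]

/-! All sums in the theorem are subset convolutions. Index the odd primes by a finite set, write p_T
for the product over a subset T, and regard T ↦ g(p_T) as an element of the ring `SetFun`. The
residue of p_T modulo 8 is recorded by the two additive weights Σ y and Σ z. The recursion for ℒ
splits off the block that contains a chosen prime, so ℒ is the exponential of g restricted to the
class 1 mod 8. An exponential satisfies this recursion at every element, which gives the
independence of the chosen prime. Weights act as derivations, and every exponential squares to 1.

Determinants enter through Laplacians. If N is the Laplacian of a weighted digraph on S plus the
diagonal of s, then the determinant of [[D_w, Nᵀ], [N, D_u]] over 𝔽₂ obeys deletion and contraction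
(`theta_del_ctr`). It is therefore an exponential (`theta_rec`, `theta_isExp`); its value on a block
T is τ_T(s) + τ_T(u) Σ_T w, where τ_T is a bordered determinant of the Laplacian on T. Borders of
such matrices expand into convolutions in the same way (`det_border_left`, `det_border_right`).

The arithmetic input is Rédei's. The parity of the order of 2Cl is even exactly if some square of an
ideal class has order two. An argument of the type of Hilbert 90 makes this the solvability of x² +
dy² = mz² for some m such that the ideal with square (m) is not principal (`g_eq_zero_iff`). By
Legendre's theorem the conic is solvable iff the indicator vector of the primes of m satisfies
linear equations given by A and z (`conic_partProd_iff`). Hence g(p_T) is read off from τ_T, and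
g(2p_T) is the determinant of A_T + D_z (`redeiData`).

Suitable choices of s, u, w now produce the exponentials E1, E3, E5 of g on the classes 1, 3, 5 mod
8, with E1 = ℒ and g(2p_T) = E1·E3·E5. Quadratic reciprocity reads A + Aᵀ = D_y + yyᵀ. The matrix of
case (1) is thus congruent to a matrix with determinant E1, and also a rank one update of a matrix
with determinant E3. Comparison gives E3 = E1·(1 + G), where G is g on the class 3 mod 8 (`E3_eq`).
The remaining determinants follow from formulas for bordered rank one updates; summands supported on
the wrong residue classes vanish. -/

theorem zmod2_mul_self (x : F₂) : x * x = x := by revert x; decide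

theorem zmod2_eq_zero_or_one (x : F₂) : x = 0 ∨ x = 1 := by revert x; decide

theorem zmod2_add_self (x : F₂) : x + x = 0 := CharTwo.add_self_eq_zero x

/-- Over `𝔽₂`, the determinant of a symmetric matrix is additive in the simultaneous change of a
row and the corresponding column. -/
theorem det_symm_add (X X₁ X₂ : Matrix n n F₂) (hX : X.IsSymm) (h₁ : X₁.IsSymm) (h₂ : X₂.IsSymm)
    (p : n) (e₁ : ∀ k l, k ≠ p → l ≠ p → X₁ k l = X k l)
    (e₂ : ∀ k l, k ≠ p → l ≠ p → X₂ k l = X k l)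
    (e : ∀ l, X p l = X₁ p l + X₂ p l) : X.det = X₁.det + X₂.det := by
  have s (M : Matrix n n F₂) (h : M.IsSymm) (k l) : M k l = M l k := by
    conv_lhs => rw [← h]
    rfl
  -- Splitting row `p` and then column `p` leaves two mixed terms, with row `p` from one summand and
  -- column `p` from the other. They are transposes of each other, so they cancel in characteristic
  -- 2.
  let Z (M N : Matrix n n F₂) : Matrix n n F₂ := of fun k l =>
    if k = p then (if l = p then 0 else M p l) else if l = p then N k p else X k l
  have hZ (M N : Matrix n n F₂) (hM : M.IsSymm) (hN : N.IsSymm) : (Z M N)ᵀ = Z N M := by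
    ext k l
    simp only [Z, transpose_apply, of_apply]
    split_ifs <;> simp [s M hM k, s N hN l p, s X hX l k]
  have step (M N : Matrix n n F₂) (hM : M.IsSymm) (hN : N.IsSymm)
      (em : ∀ k l, k ≠ p → l ≠ p → M k l = X k l) (hs : ∀ l, X p l = M p l + N p l) :
      (X.updateRow p (M p)).det = M.det + (Z M N).det := by
    clear e e₁ e₂ h₁ h₂
    have h := det_updateCol_add (X.updateRow p (M p)) p (fun k => M k p)
      (fun k => if k = p then 0 else N k p)
    have a : (X.updateRow p (M p)).updateCol p
        ((fun k => M k p) + fun k => if k = p then 0 else N k p) = X.updateRow p (M p) := by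
      ext k l
      rcases eq_or_ne l p with rfl | hl <;> rcases eq_or_ne k l with rfl | hk <;>
        simp_all [updateRow_apply]
      rw [s M hM, s N hN, ← hs, s X hX]
    have b : (X.updateRow p (M p)).updateCol p (fun k => M k p) = M := by
      ext k l
      by_cases hl : l = p <;> by_cases hk : k = p <;> simp_all [updateRow_apply]
    have c : (X.updateRow p (M p)).updateCol p (fun k => if k = p then 0 else N k p) = Z M N := by
      ext k l
      by_cases hl : l = p <;> by_cases hk : k = p <;>
        simp_all [updateRow_apply, Z]
    rwa [a, b, c] at h
  have h := det_updateRow_add X p (X₁ p) (X₂ p)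
  have a : X.updateRow p (X₁ p + X₂ p) = X := by
    ext k l
    by_cases hk : k = p <;> simp_all [updateRow_apply]
  rw [a, step X₁ X₂ h₁ h₂ e₁ e, step X₂ X₁ h₂ h₁ e₂ (fun l => by rw [e, add_comm]),
    ← det_transpose (Z X₂ X₁), hZ _ _ h₂ h₁] at h
  rw [h]
  linear_combination zmod2_add_self (Z X₁ X₂).det

/-- If row `p` is a unit vector at `α`, then column `α` can be cleared. -/
theorem det_clear_col (X : Matrix n n F₂) (p α : n) (h : ∀ l, X p l = if l = α then 1 else 0) :
    X.det = (of fun k l => if l = α then (if k = p then 1 else 0) else X k l).det := by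
  refine det_eq_of_forall_row_eq_smul_add_const (fun k => if k = p then 0 else X k α) p (by simp) ?_
  intro i j
  by_cases hj : j = α <;> by_cases hi : i = p <;> simp_all

theorem det_clear_row (X : Matrix n n F₂) (p α : n) (h : ∀ l, X l p = if l = α then 1 else 0) :
    X.det = (of fun k l => if k = α then (if l = p then 1 else 0) else X k l).det := by
  rw [← det_transpose, det_clear_col Xᵀ p α h, ← det_transpose]
  rfl

theorem det_add_col (X : Matrix n n F₂) (a b : n) (h : b ≠ a) :
    X.det = (of fun k l => X k l + if l = b then X k a else 0).det := by
  rw [← det_updateCol_add_self X h]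
  congr 1
  ext k l
  by_cases hl : l = b <;> simp_all

theorem det_add_row (X : Matrix n n F₂) (a b : n) (h : b ≠ a) :
    X.det = (of fun k l => X k l + if k = b then X a l else 0).det := by
  rw [← det_updateRow_add_self X h]
  congr 1
  ext k l
  by_cases hl : k = b <;> simp_all [updateRow_apply]

/-- If row `i` is `e_i + e_j`, then `i` can be contracted to `j`. -/
theorem det_contract (X : Matrix n n F₂) (i j : n) (hij : i ≠ j)
    (h : ∀ l, X i l = if l = i ∨ l = j then 1 else 0) :
    X.det = (of fun k l => if k = i ∨ l = i then (if k = l then 1 else 0)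
      else X k l + if l = j then X k i else 0).det := by
  rw [det_add_col X i j hij.symm, det_clear_col _ i i]
  · congr 1
    ext k l
    by_cases hk : k = i <;> by_cases hl : l = i <;> simp_all
    split_ifs <;> simp_all [CharTwo.add_self_eq_zero, eq_comm]
  · intro l
    by_cases hl : l = j <;> simp_all [CharTwo.add_self_eq_zero, eq_comm]

/-- If row and column `p` are `e_α + e_β`, then `α` can be contracted to `β`. -/
theorem det_symm_contract (X : Matrix n n F₂) (p α β : n) (h₁ : p ≠ α) (h₂ : p ≠ β) (h₃ : α ≠ β)
    (hr : ∀ l, X p l = if l = α ∨ l = β then 1 else 0)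
    (hc : ∀ l, X l p = if l = α ∨ l = β then 1 else 0) :
    X.det = (of fun k l => if k = p ∨ k = α ∨ l = p ∨ l = α then
        (if (k = p ∧ l = α) ∨ (k = α ∧ l = p) then 1 else 0)
      else (X k l + if l = β then X k α else 0) +
        if k = β then (X α l + if l = β then X α α else 0) else 0).det := by
  -- Adding `α` to `β` in rows and columns turns row and column `p` into unit vectors at `α`;
  -- clearing then splits off `p`, `α` as an antidiagonal 2×2 block.
  rw [det_add_col X α β h₃.symm, det_add_row _ α β h₃.symm, det_clear_col _ p α,
    det_clear_row _ p α]
  · congr 1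
    ext k l
    by_cases hk : k = p <;> by_cases hk : k = α <;> by_cases hl : l = p <;> by_cases hl : l = α <;>
      simp_all [zmod2_add_self]
  · intro l
    by_cases hl : l = β <;> by_cases hl : l = α <;>
      simp_all [CharTwo.add_self_eq_zero]
  · intro l
    by_cases hl : l = β <;> by_cases hl : l = α <;>
      simp_all [CharTwo.add_self_eq_zero]

end General

/-! ### Laplacians and deletion-contraction -/

section Networks

variable {V : Type} [Fintype V] [DecidableEq V]

/-- Restriction of a vector to `S`. -/
def res (S : Finset V) (f : V → F₂) : V → F₂ := fun i => if i ∈ S then f i else 0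

/-- The Laplacian of the weights `a` on `S`, plus the diagonal matrix of `s`, extended by the
identity outside `S`. -/
def net (S : Finset V) (a : V → V → F₂) (s : V → F₂) : Matrix V V F₂ := of fun i j =>
  if i ∈ S then
    if j ∈ S then (if i = j then s i + ∑ k ∈ S.erase i, a i k else a i j) else 0
  else if i = j then 1 else 0

/-- The matrix `[[D_w, Nᵀ], [N, D_u]]` where `N` is `net S a s`. -/
def thetaMat (S : Finset V) (a : V → V → F₂) (s u w : V → F₂) : Matrix (V ⊕ V) (V ⊕ V) F₂ :=
  fromBlocks (diagonal (res S w)) (net S a s)ᵀ (net S a s) (diagonal (res S u))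

def theta (S : Finset V) (a : V → V → F₂) (s u w : V → F₂) : F₂ := (thetaMat S a s u w).det

/-- The determinant of `[[N, u], [wᵀ, 0]]` where `N` is `net S a 0`. -/
def bd (S : Finset V) (a : V → V → F₂) (u w : V → F₂) : F₂ :=
  (fromBlocks (net S a 0) (replicateCol Unit (res S u)) (replicateRow Unit (res S w)) 0).det

/-- Weights after the deletion of the edge from `i` to `j`. -/
def delW (i j : V) (a : V → V → F₂) : V → V → F₂ := fun k l => if k = i ∧ l = j then 0 else a k l

/-- Weights after the contraction of `i` to `j`. -/
def ctrW (i j : V) (a : V → V → F₂) : V → V → F₂ :=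
  fun k l => if l = j then a k j + a k i else a k l

def ctrV (i j : V) (w : V → F₂) : V → F₂ := fun k => if k = j then w j + w i else w k

theorem net_del {S : Finset V} {a : V → V → F₂} (s : V → F₂) {i j : V} (hi : i ∈ S) (hj : j ∈ S)
    (hij : i ≠ j) (h : a i j = 1) (k l : V) :
    net S a s k l = net S (delW i j a) s k l + if k = i ∧ (l = i ∨ l = j) then 1 else 0 := by
  have hs : ∑ k ∈ S.erase i, a i k = ∑ k ∈ S.erase i, delW i j a i k + 1 := by
    have hj' : j ∈ S.erase i := mem_erase.2 ⟨hij.symm, hj⟩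
    rw [← add_sum_erase _ _ hj', ← add_sum_erase _ _ hj',
      sum_congr rfl (g := fun k => delW i j a i k) (by intro x hx; simp_all [delW])]
    simp [delW, h, add_comm]
  by_cases hk : k = i
  · subst hk
    by_cases hl : l = k
    · subst hl
      simp [net, hi, hs, add_assoc]
    · by_cases hl' : l = j
      · subst hl'
        simp [net, delW, hi, hj, hij, h]
      · simp [net, delW, hi, hl, hl', Ne.symm hl]
  · have hd (x) : delW i j a k x = a k x := by simp [delW, hk]
    simp [net, hk, hd]

/-- Moving the weight of k → i to k → j leaves the diagonal unchanged for k ≠ j. For k = j the edge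
becomes a loop and its weight cancels from the diagonal. -/
theorem net_ctr {S : Finset V} (a : V → V → F₂) (s : V → F₂) {i j : V} (hi : i ∈ S) (hj : j ∈ S)
    (hij : i ≠ j) {k l : V} (hk : k ≠ i) (hl : l ≠ i) :
    net (S.erase i) (ctrW i j a) s k l =
      net S a s k l + if l = j then net S a s k i else 0 := by
  by_cases hkS : k ∈ S
  swap
  · simp [net, hkS, hk]
  by_cases hlS : l ∈ S
  swap
  · have : l ≠ j := by rintro rfl; exact hlS hj
    simp [net, hlS, this, hkS, hk]
  by_cases hkl : k = l
  · subst hkl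
    have hi' : i ∈ S.erase k := mem_erase.2 ⟨hk.symm, hi⟩
    have e : (S.erase i).erase k = (S.erase k).erase i := erase_right_comm
    by_cases hkj : k = j
    · subst hkj
      have hs : ∑ l ∈ (S.erase k).erase i, ctrW i k a k l = ∑ l ∈ (S.erase k).erase i, a k l :=
        sum_congr rfl fun x hx => by simp_all [ctrW]
      simp only [net, of_apply, mem_erase, hk, hkS, hi, e, hs, ← add_sum_erase _ _ hi', if_true,
        ne_eq, not_false_eq_true, and_self, if_false]
      linear_combination -zmod2_add_self (a k i)
    · have hj' : j ∈ (S.erase k).erase i := by simp_all [eq_comm]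
      have hs : ∑ l ∈ ((S.erase k).erase i).erase j, ctrW i j a k l =
          ∑ l ∈ ((S.erase k).erase i).erase j, a k l :=
        sum_congr rfl fun x hx => by simp_all [ctrW]
      simp only [net, of_apply, mem_erase, hk, hkS, e, hs, hkj, ← add_sum_erase _ _ hi',
        ← add_sum_erase _ _ hj', if_true, ne_eq, not_false_eq_true, and_self, if_false]
      simp only [ctrW, if_true]
      ring
  · by_cases hlj : l = j
    · subst hlj
      simp [net, ctrW, hkS, hk, hlS, hkl, hi, hl]
    · simp [net, ctrW, hkS, hk, hlS, hkl, hlj, hl]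

theorem net_erase_left (S : Finset V) (a : V → V → F₂) (s : V → F₂) (i l : V) :
    net (S.erase i) a s i l = if l = i then 1 else 0 := by
  simp [net, eq_comm]

theorem net_erase_right (S : Finset V) (a : V → V → F₂) (s : V → F₂) (i k : V) :
    net (S.erase i) a s k i = if k = i then 1 else 0 := by
  by_cases h : k ∈ S <;> by_cases h' : k = i <;> simp [net, h, h']

theorem thetaMat_isSymm (S : Finset V) (a : V → V → F₂) (s u w : V → F₂) :
    (thetaMat S a s u w).IsSymm := by
  simp [thetaMat, IsSymm, fromBlocks_transpose]

/-- The edge i → j contributes e_i + e_j to one row and to the corresponding column. The determinant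
is additive in such a change by `det_symm_add`, and the summand where only e_i + e_j remains is a
contraction by `det_symm_contract`. -/
theorem theta_del_ctr {S : Finset V} {a : V → V → F₂} (s u w : V → F₂) {i j : V} (hi : i ∈ S)
    (hj : j ∈ S) (hij : i ≠ j) (h : a i j = 1) :
    theta S a s u w = theta S (delW i j a) s u w +
      theta (S.erase i) (ctrW i j a) s u (ctrV i j w) := by
  let p : V ⊕ V := Sum.inr i
  -- Row and column `p` keep only the contribution of the edge; the corner entry at `p` is 0, so `u
  -- i` and `s i` disappear with the contracted vertex.
  let X₂ : Matrix (V ⊕ V) (V ⊕ V) F₂ := of fun k l =>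
    if k = p then (if l = Sum.inl i ∨ l = Sum.inl j then 1 else 0)
    else if l = p then (if k = Sum.inl i ∨ k = Sum.inl j then 1 else 0)
    else thetaMat S a s u w k l
  have hX₂ : X₂.IsSymm := by
    ext k l
    have := congrFun (congrFun (thetaMat_isSymm S a s u w) k) l
    simp only [transpose_apply] at this
    simp only [X₂, transpose_apply, of_apply, this]
    split_ifs <;> simp_all
  unfold theta
  rw [det_symm_add (thetaMat S a s u w) (thetaMat S (delW i j a) s u w) X₂
    (thetaMat_isSymm ..) (thetaMat_isSymm ..) hX₂ p]
  · congr 1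
    rw [det_symm_contract X₂ p (Sum.inl i) (Sum.inl j)]
    · congr 1
      ext (k | k) (l | l)
      · by_cases hkl : k = l
        · subst hkl
          by_cases hk : k = i <;> by_cases hk' : k = j <;>
            simp_all [X₂, p, thetaMat, res, ctrV]
        · by_cases hk : k = i <;> by_cases hl : l = i <;> by_cases hk' : k = j <;>
            by_cases hl' : l = j <;> simp_all [X₂, p, thetaMat, diagonal_apply, Ne.symm hij] <;>
            exact fun e => absurd e.symm hl
      · by_cases hk : k = i <;> by_cases hl : l = i
        · simp_all [X₂, p, thetaMat, net_erase_left]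
        · simp_all [X₂, p, thetaMat, net_erase_right]
        · simp_all [X₂, p, thetaMat, net_erase_left]
        · by_cases hk' : k = j <;> simp_all [X₂, p, thetaMat, net_ctr a s hi hj hij]
      · by_cases hk : k = i <;> by_cases hl : l = i
        · simp_all [X₂, p, thetaMat, net_erase_left]
        · simp_all [X₂, p, thetaMat, net_erase_left]
        · simp_all [X₂, p, thetaMat, net_erase_right]
        · by_cases hk' : l = j <;> simp_all [X₂, p, thetaMat, net_ctr a s hi hj hij]
      · by_cases hkl : k = l
        · subst hkl
          by_cases hk : k = i <;> simp_all [X₂, p, thetaMat, res]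
        · by_cases hk : k = i <;> by_cases hl : l = i <;> simp_all [X₂, p, thetaMat]
    · simp [p]
    · simp [p]
    · simpa using hij
    · intro l
      simp [X₂]
    · intro l
      by_cases hl : l = p <;> simp [X₂, hl, p]
  · rintro (k | k) (l | l) hk hl <;> simp_all [thetaMat, net_del s hi hj hij h, p]
  · rintro (k | k) (l | l) hk hl <;> simp_all [thetaMat, X₂, p]
  · rintro (l | l) <;> simp [thetaMat, net_del s hi hj hij h, p, X₂]

/-- The edge affects a single row here, so ordinary linearity in that row replaces the symmetric
splitting. -/
theorem bd_del_ctr {S : Finset V} {a : V → V → F₂} (u w : V → F₂) {i j : V} (hi : i ∈ S)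
    (hj : j ∈ S) (hij : i ≠ j) (h : a i j = 1) :
    bd S a u w = bd S (delW i j a) u w + bd (S.erase i) (ctrW i j a) u (ctrV i j w) := by
  let p : V ⊕ Unit := Sum.inl i
  let M (b : V → V → F₂) : Matrix (V ⊕ Unit) (V ⊕ Unit) F₂ :=
    fromBlocks (net S b 0) (replicateCol Unit (res S u)) (replicateRow Unit (res S w)) 0
  have e := det_updateRow_add (M a) p (M (delW i j a) p)
    (fun l => if l = Sum.inl i ∨ l = Sum.inl j then 1 else 0)
  have hM (k l) : M a k l = M (delW i j a) k l +
      if k = p ∧ (l = Sum.inl i ∨ l = Sum.inl j) then 1 else 0 := by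
    rcases k with k | k <;> rcases l with l | l <;> simp [M, p, net_del _ hi hj hij h]
  have e₁ : (M a).updateRow p (M (delW i j a) p +
      fun l => if l = Sum.inl i ∨ l = Sum.inl j then 1 else 0) = M a := by
    ext k l
    by_cases hk : k = p <;> simp [updateRow_apply, hk, hM]
  have e₂ : (M a).updateRow p (M (delW i j a) p) = M (delW i j a) := by
    ext k l
    by_cases hk : k = p <;> simp [updateRow_apply, hk, hM]
  rw [e₁, e₂] at e
  unfold bd
  rw [show fromBlocks (net S a 0) (replicateCol Unit (res S u)) (replicateRow Unit (res S w)) 0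
    = M a from rfl, e]
  congr 1
  rw [det_contract _ (Sum.inl i) (Sum.inl j)]
  · congr 1
    ext (k | k) (l | l)
    · by_cases hk : k = i <;> by_cases hl : l = i
      · simp_all [net_erase_left]
      · subst hk
        simp [net_erase_left, hl, Ne.symm hl]
      · simp_all [net_erase_right]
      · by_cases hk' : l = j <;> simp_all [M, p, updateRow_apply, net_ctr a 0 hi hj hij]
    · by_cases hk : k = i <;> simp_all [M, res, p, updateRow_apply]
    · by_cases hl : l = i <;> by_cases hl' : l = j <;>
        simp_all [M, res, p, ctrV, updateRow_apply]
    · simp [M, p, updateRow_apply]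
  · simpa using hij
  · intro l
    simp [p, updateRow_apply]

end Networks

/-! ### The recursion over the component of a vertex -/

section Recursion

variable {V : Type} [DecidableEq V]

theorem net_congr {S : Finset V} {a a' : V → V → F₂} (s : V → F₂)
    (h : ∀ k ∈ S, ∀ l ∈ S, k ≠ l → a k l = a' k l) : net S a s = net S a' s := by
  ext k l
  by_cases hk : k ∈ S
  · by_cases hkl : k = l
    · subst hkl
      have e : ∑ x ∈ S.erase k, a k x = ∑ x ∈ S.erase k, a' k x := sum_congr rfl fun x hx =>
        h k hk x (mem_of_mem_erase hx) (ne_of_mem_erase hx).symm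
      simp only [net, of_apply, hk, if_true, e]
    · by_cases hl : l ∈ S
      · simp [net, hk, hl, hkl, h k hk l hl hkl]
      · simp [net, hl]
  · simp [net, hk]

theorem res_congr {S : Finset V} {w w' : V → F₂} (h : ∀ k ∈ S, w k = w' k) :
    res S w = res S w' := by
  ext k
  by_cases hk : k ∈ S <;> simp [res, hk, h]

variable [Fintype V]

theorem theta_congr {S : Finset V} {a a' : V → V → F₂} (s u : V → F₂) {w w' : V → F₂}
    (h : ∀ k ∈ S, ∀ l ∈ S, k ≠ l → a k l = a' k l) (hw : ∀ k ∈ S, w k = w' k) :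
    theta S a s u w = theta S a' s u w' := by
  simp only [theta, thetaMat, net_congr s h, res_congr hw]

theorem bd_congr {S : Finset V} {a a' : V → V → F₂} (u : V → F₂) {w w' : V → F₂}
    (h : ∀ k ∈ S, ∀ l ∈ S, k ≠ l → a k l = a' k l) (hw : ∀ k ∈ S, w k = w' k) :
    bd S a u w = bd S a' u w' := by
  simp only [bd, net_congr 0 h, res_congr hw]

/-- The contribution of the component `T` of `q` in the recursion for `theta`. -/
def comp (q : V) (T : Finset V) (a : V → V → F₂) (s u w : V → F₂) : F₂ :=
  bd T a s (Pi.single q 1) + bd T a u w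

theorem comp_congr (q : V) {S : Finset V} {a a' : V → V → F₂} (s u : V → F₂) {w w' : V → F₂}
    (h : ∀ k ∈ S, ∀ l ∈ S, k ≠ l → a k l = a' k l) (hw : ∀ k ∈ S, w k = w' k) :
    comp q S a s u w = comp q S a' s u w' := by
  rw [comp, comp, bd_congr s h fun _ _ => rfl, bd_congr u h hw]

/-- The unit vector at the marked vertex is contracted along with the graph, so the mark moves from
`i` to `j` if it was at `i`. -/
theorem comp_del_ctr (q : V) {T : Finset V} {a : V → V → F₂} (s u w : V → F₂) {i j : V}
    (hi : i ∈ T) (hj : j ∈ T) (hij : i ≠ j) (h : a i j = 1) :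
    comp q T a s u w = comp q T (delW i j a) s u w +
      comp (if q = i then j else q) (T.erase i) (ctrW i j a) s u (ctrV i j w) := by
  have e : bd (T.erase i) (ctrW i j a) s (ctrV i j (Pi.single q 1)) =
      bd (T.erase i) (ctrW i j a) s (Pi.single (if q = i then j else q) 1) := by
    refine bd_congr s (fun _ _ _ _ _ => rfl) fun k hk => ?_
    rw [mem_erase] at hk
    by_cases hq : q = i
    · subst hq
      by_cases hkj : k = j
      · subst hkj
        simp [ctrV, hij.symm]
      · simp [ctrV, hkj, hk.1]
    · by_cases hkj : k = j
      · subst hkj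
        simp [ctrV, hq, Ne.symm hq]
      · simp [ctrV, hkj, hq]
  rw [comp, comp, comp, bd_del_ctr s _ hi hj hij h, bd_del_ctr u w hi hj hij h, e]
  ring

/-- The matrix splits into the 2×2 blocks [[w, s], [s, u]], one for each vertex, and s² = s in 𝔽₂.
-/
theorem theta_of_no_edges {S : Finset V} {a : V → V → F₂} (s u w : V → F₂)
    (h : ∀ k ∈ S, ∀ l ∈ S, k ≠ l → a k l = 0) :
    theta S a s u w = ∏ k ∈ S, (s k + u k * w k) := by
  rw [theta_congr s u (a' := 0) (w' := w) h fun _ _ => rfl]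
  let B : V → Matrix Bool Bool F₂ := fun k => of fun b c =>
    bif b then (bif c then res S u k else if k ∈ S then s k else 1)
    else bif c then if k ∈ S then s k else 1 else res S w k
  have e : thetaMat S 0 s u w = (blockDiagonal B).submatrix (Equiv.boolProdEquivSum V).symm
      (Equiv.boolProdEquivSum V).symm := by
    ext (k | k) (l | l) <;> rcases eq_or_ne k l with rfl | hkl
    all_goals by_cases hk : k ∈ S
    all_goals simp [thetaMat, net, B, blockDiagonal_apply, res, hk, Equiv.boolProdEquivSum]
    all_goals simp [*, Ne.symm hkl]
  rw [theta, e, det_submatrix_equiv_self, det_blockDiagonal, ← prod_subset (subset_univ S)]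
  · refine prod_congr rfl fun k hk => ?_
    have : (B k).det = B k true true * B k false false - B k true false * B k false true := by
      rw [← det_submatrix_equiv_self finTwoEquiv, det_fin_two]
      simp [finTwoEquiv]
      ring
    rw [this]
    simp only [B, of_apply, hk, res, if_true, cond_true, cond_false]
    rw [zmod2_mul_self, CharTwo.sub_eq_add, add_comm]
  · intro k _ hk
    have : (B k).det = B k true true * B k false false - B k true false * B k false true := by
      rw [← det_submatrix_equiv_self finTwoEquiv, det_fin_two]
      simp [finTwoEquiv]
      ring
    rw [this]
    simp [B, hk, res]

/-- All rows in `T` are multiples of the last unit vector, so two of them are dependent. -/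
theorem bd_of_no_edges {T : Finset V} {a : V → V → F₂} (u w : V → F₂)
    (h : ∀ k ∈ T, ∀ l ∈ T, k ≠ l → a k l = 0) {q k : V} (hq : q ∈ T) (hk : k ∈ T) (hqk : q ≠ k) :
    bd T a u w = 0 := by
  rw [bd_congr u (a' := 0) (w' := w) h fun _ _ => rfl]
  unfold bd
  set X := fromBlocks (net T 0 0) (replicateCol Unit (res T u)) (replicateRow Unit (res T w)) 0
  have row (x : V) (hx : x ∈ T) (l) : X (Sum.inl x) l = if l = Sum.inr () then u x else 0 := by
    rcases l with l | l
    · simp [X, net, hx]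
    · simp [X, res, hx]
  rcases zmod2_eq_zero_or_one (u q) with h₁ | h₁
  · exact det_eq_zero_of_row_eq_zero (Sum.inl q) fun l => by simp [row q hq, h₁]
  rcases zmod2_eq_zero_or_one (u k) with h₂ | h₂
  · exact det_eq_zero_of_row_eq_zero (Sum.inl k) fun l => by simp [row k hk, h₂]
  exact det_zero_of_row_eq (i := Sum.inl q) (j := Sum.inl k) (by simpa using hqk)
    (by ext l; rw [row q hq, row k hk, h₁, h₂])

theorem bd_singleton (q : V) (a : V → V → F₂) (u w : V → F₂) : bd {q} a u w = u q * w q := by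
  unfold bd
  set X := fromBlocks (net {q} a 0) (replicateCol Unit (res {q} u))
    (replicateRow Unit (res {q} w)) 0 with hX
  have e := det_permute' (Equiv.swap (Sum.inl q) (Sum.inr () : V ⊕ Unit)) X
  have e' : X.submatrix id (Equiv.swap (Sum.inl q) (Sum.inr () : V ⊕ Unit)) =
      diagonal (Sum.elim (fun k => if k = q then u q else 1) fun _ => w q) := by
    ext (k | k) (l | l)
    · by_cases hl : l = q
      · subst hl
        by_cases hk : k = l <;> simp [hX, res, hk]
      · have : Equiv.swap (Sum.inl q) (Sum.inr () : V ⊕ Unit) (Sum.inl l) = Sum.inl l :=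
          Equiv.swap_apply_of_ne_of_ne (by simpa using hl) (by simp)
        by_cases hk : k = q
        · subst hk
          simp [hX, this, net, hl, Ne.symm hl]
        · by_cases hkl : k = l <;> simp [hX, this, net, hk, hkl, hl]
    · by_cases hk : k = q <;> simp [hX, net, hk]
    · by_cases hl : l = q
      · subst hl
        simp [hX]
      · have : Equiv.swap (Sum.inl q) (Sum.inr () : V ⊕ Unit) (Sum.inl l) = Sum.inl l :=
          Equiv.swap_apply_of_ne_of_ne (by simpa using hl) (by simp)
        simp [hX, this, res, hl]
    · simp [hX, res]
  rw [e', det_diagonal] at e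
  simp at e
  rw [e]

theorem comp_singleton (q : V) (a : V → V → F₂) (s u w : V → F₂) :
    comp q {q} a s u w = s q + u q * w q := by
  simp [comp, bd_singleton]

theorem theta_rec_of_no_edges {S : Finset V} {a : V → V → F₂} (s u w : V → F₂)
    (h : ∀ k ∈ S, ∀ l ∈ S, k ≠ l → a k l = 0) {q : V} (hq : q ∈ S) :
    theta S a s u w =
      ∑ T ∈ S.powerset with q ∈ T, comp q T a s u w * theta (S \ T) a s u w := by
  rw [sum_eq_single {q}]
  · rw [comp_singleton, theta_of_no_edges s u w h, theta_of_no_edges s u w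
      (fun k hk l hl => h k (mem_sdiff.1 hk).1 l (mem_sdiff.1 hl).1),
      ← mul_prod_erase S _ hq, sdiff_singleton_eq_erase]
  · intro T hT hTq
    rw [mem_filter, mem_powerset] at hT
    have hT' : ∀ k ∈ T, ∀ l ∈ T, k ≠ l → a k l = 0 :=
      fun k hk l hl => h k (hT.1 hk) l (hT.1 hl)
    obtain ⟨k, hk, hkq⟩ : ∃ k ∈ T, q ≠ k := by
      by_contra! hc
      exact hTq (eq_singleton_iff_unique_mem.2 ⟨hT.2, fun k hk => (hc k hk).symm⟩)
    rw [comp, bd_of_no_edges _ _ hT' hT.2 hk hkq, bd_of_no_edges _ _ hT' hT.2 hk hkq]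
    simp
  · intro hn
    simp [hq] at hn

/-- Subsets of the contracted vertex set correspond to the subsets of `S` that contain both `i` and
`j` or neither. -/
theorem theta_rec_contract {S : Finset V} (b : V → V → F₂) (s u w : V → F₂) {i j : V}
    (hi : i ∈ S) (hj : j ∈ S) (hij : i ≠ j) (q : V) :
    ∑ T ∈ (S.erase i).powerset with (if q = i then j else q) ∈ T,
        comp (if q = i then j else q) T b s u w * theta (S.erase i \ T) b s u w =
      ∑ T ∈ S.powerset with q ∈ T, if (i ∈ T ↔ j ∈ T) then
        comp (if q = i then j else q) (T.erase i) b s u w *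
          theta ((S \ T).erase i) b s u w else 0 := by
  rw [← sum_filter, filter_filter]
  refine sum_bij' (fun T _ => if j ∈ T then insert i T else T) (fun T _ => T.erase i)
    ?_ ?_ ?_ ?_ ?_
  · intro T hT
    simp only [mem_filter, mem_powerset, subset_erase] at hT ⊢
    obtain ⟨⟨hTS, hiT⟩, hq⟩ := hT
    by_cases hjT : j ∈ T
    · simp only [hjT, if_true, mem_insert, true_or, or_true, and_true, insert_subset_iff, hi, hTS,
        true_and]
      by_cases hqi : q = i <;> simp_all
    · by_cases hqi : q = i <;> simp_all
  · intro T hT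
    simp only [mem_filter, mem_powerset, mem_erase] at hT ⊢
    obtain ⟨hTS, hq, hT⟩ := hT
    refine ⟨erase_subset_erase _ hTS, ?_⟩
    by_cases hqi : q = i
    · subst hqi
      simp [hij.symm, hT.1 hq]
    · simp [hqi, hq]
  · intro T hT
    simp only [mem_filter, mem_powerset, subset_erase] at hT
    by_cases hjT : j ∈ T <;> simp [hjT, hT.1.2]
  · intro T hT
    simp only [mem_filter, mem_powerset] at hT
    by_cases hjT : j ∈ T
    · simp [hjT, hij.symm, hT.2.2.2 hjT]
    · have : i ∉ T := fun h => hjT (hT.2.2.1 h)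
      simp [hjT, this]
  · intro T hT
    simp only [mem_filter, mem_powerset, subset_erase] at hT
    by_cases hjT : j ∈ T
    · simp only [hjT, if_true, erase_insert hT.1.2]
      congr 2
      ext x
      simp only [mem_sdiff, mem_erase, mem_insert]
      tauto
    · simp only [hjT, if_false, erase_eq_of_notMem hT.1.2]
      congr 2
      ext x
      simp only [mem_sdiff, mem_erase]
      tauto

/-- Both sides obey the same deletion-contraction rule. Contraction lowers the number of vertices
and deletion the number of edges, so a double induction reduces to the graph without edges. -/
theorem theta_rec (S : Finset V) (a : V → V → F₂) (s u w : V → F₂) (q : V) (hq : q ∈ S) :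
    theta S a s u w =
      ∑ T ∈ S.powerset with q ∈ T, comp q T a s u w * theta (S \ T) a s u w := by
  induction hN : #S using Nat.strong_induction_on generalizing S a s u w q with
  | _ N ih =>
  induction hm : #{x ∈ S ×ˢ S | x.1 ≠ x.2 ∧ a x.1 x.2 ≠ 0} using Nat.strong_induction_on
    generalizing a with
  | _ m ihm =>
  by_cases h : ∀ k ∈ S, ∀ l ∈ S, k ≠ l → a k l = 0
  · exact theta_rec_of_no_edges s u w h hq
  push Not at h
  obtain ⟨i, hi, j, hj, hij, h0⟩ := h
  have h1 : a i j = 1 := (zmod2_eq_zero_or_one _).resolve_left h0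
  have hq' : (if q = i then j else q) ∈ S.erase i := by
    by_cases hqi : q = i <;> simp [hqi, hj, hij.symm, hq]
  rw [theta_del_ctr s u w hi hj hij h1,
    ih _ (by rw [← hN]; exact card_erase_lt_of_mem hi) (S.erase i) (ctrW i j a) s u (ctrV i j w) _
      hq' rfl, theta_rec_contract _ _ _ _ hi hj hij,
    ihm _ _ (delW i j a) rfl, ← sum_add_distrib]
  · refine sum_congr rfl fun T hT => ?_
    rw [mem_filter, mem_powerset] at hT
    obtain ⟨hTS, hqT⟩ := hT
    have off (U : Finset V) (hU : i ∉ U ∨ j ∉ U) : ∀ k ∈ U, ∀ l ∈ U, k ≠ l →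
        delW i j a k l = a k l := by
      intro k hk l hl _
      simp only [delW]
      rw [if_neg]
      rintro ⟨rfl, rfl⟩
      tauto
    have offc (U : Finset V) (hU : j ∉ U) : ∀ k ∈ U, ∀ l ∈ U, k ≠ l →
        ctrW i j a k l = a k l := by
      intro k _ l hl _
      simp only [ctrW]
      rw [if_neg]
      rintro rfl
      exact hU hl
    have offv (U : Finset V) (hU : j ∉ U) : ∀ k ∈ U, ctrV i j w k = w k := by
      intro k hk
      simp only [ctrV]
      rw [if_neg]
      rintro rfl
      exact hU hk
    -- An edge inside `T` is split in the factor `comp`, an edge inside the complement in the factor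
    -- `theta`. A crossing edge is seen by neither factor, and the contracted sum has no term for
    -- it.
    by_cases hiT : i ∈ T <;> by_cases hjT : j ∈ T
    · rw [if_pos (by tauto), comp_del_ctr q s u w hiT hjT hij h1,
        theta_congr (S := S \ T) s u (off _ (by simp [hiT])) fun _ _ => rfl,
        erase_eq_of_notMem (s := S \ T) (by simp [hiT]), theta_congr (S := S \ T) (a := ctrW i j a) s u
          (offc _ (by simp [hjT])) (offv _ (by simp [hjT]))]
      ring
    · rw [if_neg (by tauto), add_zero, comp_congr q s u (off T (by tauto)) fun _ _ => rfl,
        theta_congr (S := S \ T) s u (off _ (by simp [hiT])) fun _ _ => rfl]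
    · rw [if_neg (by tauto), add_zero, comp_congr q s u (off T (by tauto)) fun _ _ => rfl,
        theta_congr (S := S \ T) s u (off _ (by simp [hjT])) fun _ _ => rfl]
    · have hqi : q ≠ i := by rintro rfl; exact hiT hqT
      rw [if_pos (by tauto), if_neg hqi, erase_eq_of_notMem hiT,
        theta_del_ctr (S := S \ T) s u w (by simp [hi, hiT]) (by simp [hj, hjT]) hij h1,
        comp_congr q s u (off T (by tauto)) fun _ _ => rfl,
        comp_congr q s u (offc T hjT) (offv T hjT)]
      ring
  · rw [← hm]
    refine card_lt_card ((ssubset_iff_of_subset fun x hx => ?_).2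
      ⟨(i, j), by simp [hi, hj, hij, h1], by simp [delW]⟩)
    rw [mem_filter] at hx ⊢
    refine ⟨hx.1, hx.2.1, fun h => hx.2.2 ?_⟩
    simp [delW, h]

end Recursion

/-! ### Subset convolution, weights and exponentials -/

/-- The ring of `𝔽₂`-valued functions on the finite subsets of `V`, with the subset convolution. -/
def SetFun (V : Type) : Type := Finset V → F₂

namespace SetFun

variable {V : Type}

instance : AddCommGroup (SetFun V) := inferInstanceAs (AddCommGroup (Finset V → F₂))

@[ext] theorem ext {f h : SetFun V} (e : ∀ S, f S = h S) : f = h := funext e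

@[simp] theorem add_apply (f h : SetFun V) (S : Finset V) : (f + h) S = f S + h S := rfl

@[simp] theorem zero_apply (S : Finset V) : (0 : SetFun V) S = 0 := rfl

theorem add_self (f : SetFun V) : f + f = 0 := ext fun S => zmod2_add_self (f S)

variable [DecidableEq V]

instance : One (SetFun V) := ⟨fun S => if S = ∅ then 1 else 0⟩

instance : Mul (SetFun V) := ⟨fun f h S => ∑ T ∈ S.powerset, f T * h (S \ T)⟩

theorem one_apply (S : Finset V) : (1 : SetFun V) S = if S = ∅ then 1 else 0 := rfl

theorem mul_apply (f h : SetFun V) (S : Finset V) :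
    (f * h) S = ∑ T ∈ S.powerset, f T * h (S \ T) := rfl

protected theorem mul_comm (f h : SetFun V) : f * h = h * f := by
  ext S
  refine sum_bij' (fun T _ => S \ T) (fun T _ => S \ T) ?_ ?_ ?_ ?_ ?_ <;> intro T hT <;>
    rw [mem_powerset] at *
  · exact sdiff_subset
  · exact sdiff_subset
  · exact Finset.sdiff_sdiff_eq_self hT
  · exact Finset.sdiff_sdiff_eq_self hT
  · rw [Finset.sdiff_sdiff_eq_self hT, mul_comm]

protected theorem mul_assoc (f h k : SetFun V) : f * h * k = f * (h * k) := by
  ext S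
  simp only [mul_apply, sum_mul, mul_sum]
  rw [sum_sigma', sum_sigma']
  refine sum_bij' (fun x _ => ⟨x.2, x.1 \ x.2⟩) (fun x _ => ⟨x.1 ∪ x.2, x.1⟩) ?_ ?_ ?_ ?_ ?_ <;>
    rintro ⟨T, U⟩ hx <;> simp only [mem_sigma, mem_powerset] at * <;> obtain ⟨h₁, h₂⟩ := hx
  · exact ⟨h₂.trans h₁, sdiff_subset_sdiff h₁ le_rfl⟩
  · exact ⟨union_subset h₁ (h₂.trans sdiff_subset), subset_union_left⟩
  · simp [h₂]
  · have : (T ∪ U) \ T = U := by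
      rw [union_sdiff_left]
      exact sdiff_eq_self_of_disjoint (disjoint_of_subset_left h₂ sdiff_disjoint)
    simp [this]
  · have : (S \ U) \ (T \ U) = S \ T := by
      ext x
      simp only [mem_sdiff]
      have := @h₂ x
      tauto
    rw [this, mul_assoc]

protected theorem one_mul (f : SetFun V) : 1 * f = f := by
  ext S
  rw [mul_apply, sum_eq_single ∅]
  · simp [one_apply]
  · intro T _ hT
    simp [one_apply, hT]
  · simp

protected theorem add_mul (f h k : SetFun V) : (f + h) * k = f * k + h * k := by
  ext S
  simp only [mul_apply, add_apply, add_mul, sum_add_distrib]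

instance : CommRing (SetFun V) :=
  { (inferInstance : AddCommGroup (SetFun V)) with
    mul_comm := SetFun.mul_comm
    mul_assoc := SetFun.mul_assoc
    one_mul := SetFun.one_mul
    mul_one := fun f => by rw [SetFun.mul_comm, SetFun.one_mul]
    left_distrib := fun f h k => by
      rw [SetFun.mul_comm, SetFun.add_mul, SetFun.mul_comm h, SetFun.mul_comm k]
    right_distrib := SetFun.add_mul
    zero_mul := fun f => by ext S; simp [mul_apply]
    mul_zero := fun f => by ext S; simp [mul_apply] }

/-- Multiplication by an additive weight, a derivation. -/
def wt (φ : V → F₂) (f : SetFun V) : SetFun V := fun S => (∑ i ∈ S, φ i) * f S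

theorem wt_apply (φ : V → F₂) (f : SetFun V) (S : Finset V) :
    wt φ f S = (∑ i ∈ S, φ i) * f S := rfl

theorem wt_add (φ : V → F₂) (f h : SetFun V) : wt φ (f + h) = wt φ f + wt φ h := by
  ext S
  simp [wt_apply, mul_add]

/-- The weight of a disjoint union is the sum of the weights, which is the Leibniz rule. -/
theorem wt_mul (φ : V → F₂) (f h : SetFun V) : wt φ (f * h) = wt φ f * h + f * wt φ h := by
  ext S
  rw [add_apply, wt_apply, mul_apply, mul_apply, mul_apply, mul_sum, ← sum_add_distrib]
  refine sum_congr rfl fun T hT => ?_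
  rw [wt_apply, wt_apply, ← sum_sdiff (mem_powerset.1 hT)]
  ring

/-- `f` is supported on the sets of weight `0`. -/
def Even (φ : V → F₂) (f : SetFun V) : Prop := wt φ f = 0

/-- `f` is supported on the sets of weight `1`. -/
def Odd (φ : V → F₂) (f : SetFun V) : Prop := wt φ f = f

section Parity

variable {φ : V → F₂} {f h : SetFun V}

theorem Even.apply (hf : Even φ f) {S : Finset V} (hS : ∑ i ∈ S, φ i = 1) : f S = 0 := by
  have := congrFun hf S
  rwa [wt_apply, hS, one_mul] at this

theorem Odd.apply (hf : Odd φ f) {S : Finset V} (hS : ∑ i ∈ S, φ i = 0) : f S = 0 := by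
  have := congrFun hf S
  rw [wt_apply, hS, zero_mul] at this
  exact this.symm

theorem even_iff : Even φ f ↔ ∀ S, f S ≠ 0 → ∑ i ∈ S, φ i = 0 := by
  constructor
  · intro hf S hS
    by_contra h
    exact hS (hf.apply ((zmod2_eq_zero_or_one _).resolve_left h))
  · intro hf
    ext S
    rw [wt_apply]
    by_cases hS : f S = 0
    · simp [hS]
    · simp [hf S hS]

theorem odd_iff : Odd φ f ↔ ∀ S, f S ≠ 0 → ∑ i ∈ S, φ i = 1 := by
  constructor
  · intro hf S hS
    by_contra h
    exact hS (hf.apply ((zmod2_eq_zero_or_one _).resolve_right h))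
  · intro hf
    ext S
    rw [wt_apply]
    by_cases hS : f S = 0
    · simp [hS]
    · simp [hf S hS]

theorem Even.mul (hf : Even φ f) (hh : Even φ h) : Even φ (f * h) := by
  rw [Even, wt_mul, hf, hh]
  ring

theorem Odd.mul_even (hf : Odd φ f) (hh : Even φ h) : Odd φ (f * h) := by
  rw [Odd, wt_mul, hf, hh]
  ring

theorem Even.mul_odd (hf : Even φ f) (hh : Odd φ h) : Odd φ (f * h) := by
  rw [Odd, wt_mul, hf, hh]
  ring

theorem Odd.mul (hf : Odd φ f) (hh : Odd φ h) : Even φ (f * h) := by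
  rw [Even, wt_mul, hf, hh]
  exact add_self _

end Parity

/-- `E` is the exponential of `c`: the sum over all set partitions of the product of the values of
`c` on the blocks. -/
structure IsExp (c E : SetFun V) : Prop where
  empty : E ∅ = 1
  wt_single : ∀ q, wt (Pi.single q 1) E = wt (Pi.single q 1) c * E

theorem wt_single_apply (q : V) (f : SetFun V) (S : Finset V) :
    wt (Pi.single q 1) f S = if q ∈ S then f S else 0 := by
  rw [wt_apply, sum_pi_single']
  split_ifs <;> simp

theorem wt_single_mul_apply (q : V) (f h : SetFun V) (S : Finset V) :
    (wt (Pi.single q 1) f * h) S = ∑ T ∈ S.powerset with q ∈ T, f T * h (S \ T) := by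
  rw [mul_apply, sum_filter]
  refine sum_congr rfl fun T _ => ?_
  rw [wt_single_apply]
  split_ifs <;> simp

theorem isExp_iff {c E : SetFun V} : IsExp c E ↔ E ∅ = 1 ∧
    ∀ S, ∀ q ∈ S, E S = ∑ T ∈ S.powerset with q ∈ T, c T * E (S \ T) := by
  constructor
  · rintro ⟨h₁, h₂⟩
    refine ⟨h₁, fun S q hq => ?_⟩
    have := congrFun (h₂ q) S
    rwa [wt_single_mul_apply, wt_single_apply, if_pos hq] at this
  · rintro ⟨h₁, h₂⟩
    refine ⟨h₁, fun q => ?_⟩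
    ext S
    rw [wt_single_mul_apply, wt_single_apply]
    split_ifs with hq
    · exact h₂ S q hq
    · rw [sum_eq_zero]
      intro T hT
      rw [mem_filter, mem_powerset] at hT
      exact absurd (hT.1 hT.2) hq

theorem IsExp.recursion {c E : SetFun V} (h : IsExp c E) {S : Finset V} {q : V} (hq : q ∈ S) :
    E S = ∑ T ∈ S.powerset with q ∈ T, c T * E (S \ T) :=
  (isExp_iff.1 h).2 S q hq

theorem IsExp.unique {c E E' : SetFun V} (h : IsExp c E) (h' : IsExp c E') : E = E' := by
  ext S
  induction hN : #S using Nat.strong_induction_on generalizing S with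
  | _ N ih =>
  rcases S.eq_empty_or_nonempty with rfl | ⟨q, hq⟩
  · rw [h.empty, h'.empty]
  · rw [h.recursion hq, h'.recursion hq]
    refine sum_congr rfl fun T hT => ?_
    rw [mem_filter, mem_powerset] at hT
    rw [ih _ _ _ rfl]
    rw [← hN]
    exact card_lt_card (sdiff_ssubset hT.1 ⟨q, hT.2⟩)

theorem IsExp.mul {c c' E E' : SetFun V} (h : IsExp c E) (h' : IsExp c' E') :
    IsExp (c + c') (E * E') := by
  refine ⟨by rw [mul_apply, powerset_empty, sum_singleton, h.empty, sdiff_empty, h'.empty, one_mul],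
    fun q => ?_⟩
  rw [wt_mul, wt_add, h.wt_single, h'.wt_single]
  ring

/-- A weight is a linear combination of the indicators of single elements, for which this is the
definition: the logarithmic derivative of an exponential. -/
theorem IsExp.wt_eq {c E : SetFun V} (h : IsExp c E) (φ : V → F₂) : wt φ E = wt φ c * E := by
  ext S
  have e (f : SetFun V) (T) : wt φ f T = ∑ q ∈ T, φ q * wt (Pi.single q 1) f T := by
    rw [wt_apply, sum_mul]
    exact sum_congr rfl fun q hq => by rw [wt_single_apply, if_pos hq]
  rw [e, mul_apply]
  simp only [h.wt_single, mul_apply, e, mul_sum, sum_mul]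
  rw [sum_comm]
  refine sum_congr rfl fun T hT => ?_
  rw [← sum_subset (mem_powerset.1 hT)]
  · exact sum_congr rfl fun q _ => by ring
  · intro q _ hq
    simp [wt_single_apply, hq]

theorem IsExp.even {c E : SetFun V} (h : IsExp c E) {φ : V → F₂} (hc : Even φ c) : Even φ E := by
  rw [Even, h.wt_eq, hc, zero_mul]

/-- The derivation at an element `q` kills f² since 2f·f' = 0, and it does not change the values on
sets that contain `q`. -/
theorem mul_self_of_empty {f : SetFun V} (hf : f ∅ = 0) : f * f = 0 := by
  ext S
  rcases S.eq_empty_or_nonempty with rfl | ⟨q, hq⟩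
  · simp [mul_apply, hf]
  · have := congrFun (wt_mul (Pi.single q 1) f f) S
    rw [wt_single_apply, if_pos hq, SetFun.mul_comm f (wt _ f), add_self] at this
    exact this

theorem IsExp.mul_self {c E : SetFun V} (h : IsExp c E) : E * E = 1 := by
  have : (E + 1) * (E + 1) = 0 :=
    mul_self_of_empty (by rw [add_apply, h.empty, one_apply, if_pos rfl]; exact zmod2_add_self 1)
  linear_combination this - add_self E - add_self (1 : SetFun V)

end SetFun

/-! ### Bordered symmetric determinants -/

section Border

variable {ι : Type} [Fintype ι] [DecidableEq ι]

theorem border_isSymm {M : Matrix ι ι F₂} (hM : M.IsSymm) (v : ι → F₂) : (border M v).IsSymm := by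
  rw [border, IsSymm, fromBlocks_transpose, hM]
  simp

theorem det_border_add {M : Matrix ι ι F₂} (hM : M.IsSymm) (v v' : ι → F₂) :
    (border M (v + v')).det = (border M v).det + (border M v').det := by
  refine det_symm_add _ _ _ (border_isSymm hM _) (border_isSymm hM _) (border_isSymm hM _)
    (Sum.inr ()) ?_ ?_ ?_
  · rintro (k | k) (l | l) hk hl <;> simp_all [border]
  · rintro (k | k) (l | l) hk hl <;> simp_all [border]
  · rintro (l | l) <;> simp [border]

theorem det_border_zero (M : Matrix ι ι F₂) : (border M 0).det = 0 :=
  det_eq_zero_of_row_eq_zero (Sum.inr ()) (by rintro (l | l) <;> simp [border])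

/-- With corner entry 1 the bordered matrix has Schur complement M + vvᵀ. Changing the corner from 0
to 1 adds a unit vector to the last row, which contributes det M. -/
theorem det_add_vecMulVec (M : Matrix ι ι F₂) (v : ι → F₂) :
    (M + vecMulVec v v).det = M.det + (border M v).det := by
  have h := det_fromBlocks_one₂₂ M (replicateCol Unit v) (replicateRow Unit v)
  have e : M - replicateCol Unit v * replicateRow Unit v = M + vecMulVec v v := by
    ext i j
    simp [mul_apply, vecMulVec_apply, CharTwo.sub_eq_add]
  let B := border M v
  have a := det_updateRow_add B (Sum.inr ()) (B (Sum.inr ())) (Pi.single (Sum.inr ()) 1)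
  rw [updateRow_eq_self] at a
  have e₁ : B.updateRow (Sum.inr ()) (B (Sum.inr ()) + Pi.single (Sum.inr ()) 1) =
      fromBlocks M (replicateCol Unit v) (replicateRow Unit v) 1 := by
    ext (k | k) (l | l) <;> simp [B, border, updateRow_apply]
  have e₂ : B.updateRow (Sum.inr ()) (Pi.single (Sum.inr ()) 1) =
      fromBlocks M (replicateCol Unit v) 0 (1 : Matrix Unit Unit F₂) := by
    ext (k | k) (l | l) <;> simp [B, border, updateRow_apply]
  rw [e₁, e₂, h, e, det_fromBlocks_zero₂₁, det_one, mul_one] at a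
  exact a.trans (add_comm _ _)

/-- Adding a combination of the columns (and rows) to the border. -/
theorem det_border_add_mulVec {M : Matrix ι ι F₂} (hM : M.IsSymm) (v c : ι → F₂) :
    (border M (v + M *ᵥ c)).det = (border M v).det + (c ⬝ᵥ M *ᵥ c) * M.det := by
  rw [det_border_add hM]
  congr 1
  -- Clearing the last column with the combination `c` of the others leaves cᵀMc in the corner.
  have e : border M (M *ᵥ c) = (fromBlocks M 0 (replicateRow Unit (M *ᵥ c)) (of fun _ _ =>
      c ⬝ᵥ M *ᵥ c)) * fromBlocks 1 (replicateCol Unit c) 0 1 := by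
    rw [fromBlocks_multiply]
    ext (i | i) (j | j) <;> simp [border]
    · simp [mul_apply, mulVec, dotProduct]
    · rw [dotProduct_comm]
      exact (zmod2_add_self _).symm
  rw [e, det_mul, det_fromBlocks_zero₁₂, det_fromBlocks_zero₂₁]
  simp [mul_comm]

end Border

/-! ### Rooted trees and the exponential form of theta -/

section Recursion

variable {V : Type} [Fintype V] [DecidableEq V]

theorem bd_add_right (T : Finset V) (a : V → V → F₂) (u w w' : V → F₂) :
    bd T a u (w + w') = bd T a u w + bd T a u w' := by
  let M (x : V → F₂) : Matrix (V ⊕ Unit) (V ⊕ Unit) F₂ := fromBlocks (net T a 0)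
    (replicateCol Unit (res T u)) (replicateRow Unit (res T x)) 0
  have e := det_updateRow_add (M w) (Sum.inr ()) (M w (Sum.inr ())) (M w' (Sum.inr ()))
  rw [updateRow_eq_self] at e
  have e₁ : (M w).updateRow (Sum.inr ()) (M w (Sum.inr ()) + M w' (Sum.inr ())) = M (w + w') := by
    ext (k | k) (l | l) <;> simp [M, updateRow_apply, res]
    split_ifs <;> simp
  have e₂ : (M w).updateRow (Sum.inr ()) (M w' (Sum.inr ())) = M w' := by
    ext (k | k) (l | l) <;> simp [M, updateRow_apply]
  rwa [e₁, e₂] at e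

theorem bd_add_left (T : Finset V) (a : V → V → F₂) (u u' w : V → F₂) :
    bd T a (u + u') w = bd T a u w + bd T a u' w := by
  let M (x : V → F₂) : Matrix (V ⊕ Unit) (V ⊕ Unit) F₂ := fromBlocks (net T a 0)
    (replicateCol Unit (res T x)) (replicateRow Unit (res T w)) 0
  have e := det_updateCol_add (M u) (Sum.inr ()) (fun k => M u k (Sum.inr ()))
    (fun k => M u' k (Sum.inr ()))
  rw [updateCol_eq_self] at e
  have e₁ : (M u).updateCol (Sum.inr ()) ((fun k => M u k (Sum.inr ())) +
      fun k => M u' k (Sum.inr ())) = M (u + u') := by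
    ext (k | k) (l | l) <;> simp [M, res]
    split_ifs <;> simp
  have e₂ : (M u).updateCol (Sum.inr ()) (fun k => M u' k (Sum.inr ())) = M u' := by
    ext (k | k) (l | l) <;> simp [M]
  rwa [e₁, e₂] at e

theorem net_zero_mulVec (T : Finset V) (a : V → V → F₂) : net T a 0 *ᵥ res T 1 = 0 := by
  ext k
  rw [mulVec, dotProduct, Pi.zero_apply]
  by_cases hk : k ∈ T
  · rw [← sum_subset (subset_univ T) (fun x _ hx => by simp [res, hx]), ← add_sum_erase _ _ hk,
      sum_congr rfl (g := fun x => a k x)]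
    · simp [net, hk, res, zmod2_add_self]
    · intro x hx
      rw [mem_erase] at hx
      simp [net, hk, res, hx.2, Ne.symm hx.1]
  · exact sum_eq_zero fun x _ => by
      by_cases hx : k = x
      · subst hx
        simp [res, hk]
      · simp [net, hk, hx]

/-- The Laplacian kills the indicator of `T`, and so does the last row if the entries of `w` sum to
0. Hence the bordered determinant depends on `w` only through its sum over `T`. -/
theorem bd_eq_zero {T : Finset V} (hT : T.Nonempty) (a : V → V → F₂) (u : V → F₂) {w : V → F₂}
    (hw : ∑ k ∈ T, w k = 0) : bd T a u w = 0 := by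
  obtain ⟨q, hq⟩ := hT
  refine exists_mulVec_eq_zero_iff.1 ⟨Sum.elim (res T 1) 0, ?_, ?_⟩
  · intro h
    have := congrFun h (Sum.inl q)
    simp [res, hq] at this
  · rw [fromBlocks_mulVec]
    ext (i | i)
    · simp [net_zero_mulVec]
    · simp only [Sum.elim_comp_inl, Sum.elim_comp_inr, mulVec_zero, add_zero, Sum.elim_inr,
        mulVec, dotProduct, replicateRow_apply, Pi.zero_apply, ← hw]
      rw [← sum_subset (subset_univ T) (fun x _ hx => by simp [res, hx])]
      exact sum_congr rfl fun x hx => by simp [res, hx]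

theorem bd_eq (T : Finset V) (a : V → V → F₂) (u w : V → F₂) {q : V} (hq : q ∈ T) :
    bd T a u w = bd T a u (Pi.single q 1) * ∑ k ∈ T, w k := by
  rcases zmod2_eq_zero_or_one (∑ k ∈ T, w k) with h | h
  · rw [bd_eq_zero ⟨q, hq⟩ a u h, h, mul_zero]
  · have e := bd_eq_zero ⟨q, hq⟩ a u (w := w + Pi.single q 1) (by
      simp only [Pi.add_apply, sum_add_distrib, h, sum_pi_single', if_pos hq]
      exact zmod2_add_self 1)
    rw [bd_add_right] at e
    rw [h, mul_one]
    exact CharTwo.add_eq_zero.1 e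

/-- The number of spanning trees of `T`, weighted by the value of `u` at the root. -/
def tau (T : Finset V) (a : V → V → F₂) (u : V → F₂) : F₂ :=
  if h : T.Nonempty then bd T a u (Pi.single h.choose 1) else 0

theorem bd_single (T : Finset V) (a : V → V → F₂) (u : V → F₂) {q : V} (hq : q ∈ T) :
    bd T a u (Pi.single q 1) = tau T a u := by
  have h : T.Nonempty := ⟨q, hq⟩
  rw [tau, dif_pos h, bd_eq T a u _ h.choose_spec, sum_pi_single', if_pos hq, mul_one]

theorem tau_empty (a : V → V → F₂) (u : V → F₂) : tau ∅ a u = 0 := by simp [tau]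

theorem tau_add (T : Finset V) (a : V → V → F₂) (u u' : V → F₂) :
    tau T a (u + u') = tau T a u + tau T a u' := by
  rcases T.eq_empty_or_nonempty with rfl | ⟨q, hq⟩
  · simp [tau_empty]
  · simp only [← bd_single T a _ hq, bd_add_left]

theorem comp_eq {q : V} {T : Finset V} (hq : q ∈ T) (a : V → V → F₂) (s u w : V → F₂) :
    comp q T a s u w = tau T a s + tau T a u * ∑ k ∈ T, w k := by
  rw [comp, bd_eq T a u w hq, bd_single T a _ hq, bd_single T a _ hq]

theorem theta_recursion {S : Finset V} (a : V → V → F₂) (s u w : V → F₂) {q : V} (hq : q ∈ S) :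
    theta S a s u w = ∑ T ∈ S.powerset with q ∈ T,
      (tau T a s + tau T a u * ∑ k ∈ T, w k) * theta (S \ T) a s u w := by
  rw [theta_rec S a s u w q hq]
  exact sum_congr rfl fun T hT => by rw [comp_eq (mem_filter.1 hT).2]

theorem theta_empty (a : V → V → F₂) (s u w : V → F₂) : theta ∅ a s u w = 1 := by
  rw [theta_of_no_edges] <;> simp

theorem theta_isExp (a : V → V → F₂) (s u w : V → F₂) (c : SetFun V)
    (hc : ∀ T : Finset V, T.Nonempty → c T = tau T a s + tau T a u * ∑ k ∈ T, w k) :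
    SetFun.IsExp c (fun S => theta S a s u w) := by
  refine SetFun.isExp_iff.2 ⟨theta_empty a s u w, fun S q hq => ?_⟩
  rw [theta_recursion a s u w hq]
  exact sum_congr rfl fun T hT => by rw [hc T ⟨q, (mem_filter.1 hT).2⟩]

/-- `theta` with `w = 0` is the square of the determinant of `net`. -/
theorem theta_zero (S : Finset V) (a : V → V → F₂) (s : V → F₂) :
    theta S a s 0 0 = (net S a s).det := by
  have e : thetaMat S a s 0 0 = fromBlocks (net S a s)ᵀ 0 0 (net S a s) * fromBlocks 0 1 1 0 := by
    rw [fromBlocks_multiply, thetaMat]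
    have : res S (0 : V → F₂) = 0 := by ext; simp [res]
    simp [this]
  have e' : (fromBlocks (0 : Matrix V V F₂) (1 : Matrix V V F₂) (1 : Matrix V V F₂) 0).det = 1 := by
    refine (zmod2_eq_zero_or_one _).resolve_left fun h => ?_
    have := congrArg det (show fromBlocks (0 : Matrix V V F₂) (1 : Matrix V V F₂) (1 : Matrix V V F₂) 0 *
      fromBlocks 0 1 1 0 = 1 by
      simp [fromBlocks_multiply])
    rw [det_mul, h] at this
    simp at this
  rw [theta, e, det_mul, e', mul_one, det_fromBlocks_zero₂₁, det_transpose, zmod2_mul_self]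

theorem theta_congr_diag {S : Finset V} (a : V → V → F₂) (s : V → F₂) {u u' w w' : V → F₂}
    (hu : ∀ k ∈ S, u k = u' k) (hw : ∀ k ∈ S, w k = w' k) :
    theta S a s u w = theta S a s u' w' := by
  simp only [theta, thetaMat, res_congr hu, res_congr hw]

theorem res_add (S : Finset V) (u v : V → F₂) : res S (u + v) = res S u + res S v := by
  ext k
  by_cases hk : k ∈ S <;> simp [res, hk]

theorem res_single (S : Finset V) {i : V} (hi : i ∈ S) (x : F₂) :
    res S (Pi.single i x) = Pi.single i x := by
  ext k
  by_cases hk : k = i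
  · subst hk
    simp [res, hi]
  · simp [res, hk]

/-- Both sides are additive in `ζ`, so a unit vector at `i` suffices. By `det_add_vecMulVec` that
border is the change of `theta` when `w i` grows by 1. In the recursion at `i` only the factor of
the block containing `i` changes. -/
theorem det_border_left (S : Finset V) (a : V → V → F₂) (s u w ζ : V → F₂) :
    (border (thetaMat S a s u w) (Sum.elim (res S ζ) 0)).det =
      ∑ T ∈ S.powerset, (tau T a u * ∑ k ∈ T, ζ k) * theta (S \ T) a s u w := by
  let f : (V → F₂) →+ F₂ := AddMonoidHom.mk'
    (fun ζ => (border (thetaMat S a s u w) (Sum.elim (res S ζ) 0)).det) fun ζ ζ' => by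
      rw [← det_border_add (thetaMat_isSymm ..), res_add]
      congr 2
      ext (k | k) <;> simp
  let f' : (V → F₂) →+ F₂ := AddMonoidHom.mk'
    (fun ζ => ∑ T ∈ S.powerset, (tau T a u * ∑ k ∈ T, ζ k) * theta (S \ T) a s u w)
    fun ζ ζ' => by
      rw [← sum_add_distrib]
      exact sum_congr rfl fun T _ => by simp only [Pi.add_apply, sum_add_distrib]; ring
  suffices f = f' from DFunLike.congr_fun this ζ
  refine AddMonoidHom.functions_ext _ _ _ fun i x => ?_
  rcases zmod2_eq_zero_or_one x with rfl | rfl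
  · simp
  simp only [f, f', AddMonoidHom.mk'_apply, sum_pi_single', mul_ite, mul_one, mul_zero, ite_mul,
    zero_mul]
  rw [← sum_filter]
  by_cases hi : i ∈ S
  · have h := det_add_vecMulVec (thetaMat S a s u w) (Sum.elim (res S (Pi.single i 1)) 0)
    have e : thetaMat S a s u w + vecMulVec (Sum.elim (res S (Pi.single i 1)) 0)
        (Sum.elim (res S (Pi.single i 1)) 0) = thetaMat S a s u (w + Pi.single i 1) := by
      ext (k | k) (l | l) <;> simp [thetaMat, vecMulVec_apply, res_add, res_single S hi]
      by_cases hk : k = l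
      · subst hk
        simp [Pi.single_apply]
      · by_cases hki : k = i <;> by_cases hli : l = i <;> simp_all
    rw [e] at h
    change theta S a s u (w + Pi.single i 1) = theta S a s u w + _ at h
    rw [theta_recursion a s u _ hi, theta_recursion a s u w hi] at h
    rw [← sub_eq_iff_eq_add'] at h
    rw [← h, ← sum_sub_distrib]
    refine sum_congr rfl fun T hT => ?_
    have hiT := (mem_filter.1 hT).2
    rw [theta_congr_diag (S := S \ T) (w := w + Pi.single i 1) (w' := w) a s (fun _ _ => rfl)]
    · simp only [Pi.add_apply, sum_add_distrib, sum_pi_single', if_pos hiT]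
      ring
    · intro k hk
      have : k ≠ i := by
        rintro rfl
        exact (mem_sdiff.1 hk).2 hiT
      simp [this]
  · have e : (Sum.elim (res S (Pi.single i 1)) 0 : V ⊕ V → F₂) = 0 := by
      ext (k | k)
      · by_cases hk : k = i
        · subst hk
          simp [res, hi]
        · simp [res, hk]
      · simp
    rw [e, det_border_zero, sum_eq_zero]
    intro T hT
    rw [mem_filter, mem_powerset] at hT
    exact absurd (hT.1 hT.2) hi

/-- The same argument with `u i` in place of `w i`; blocks that avoid `i` contribute nothing because
τ vanishes there for the unit vector at `i`. -/
theorem det_border_right (S : Finset V) (a : V → V → F₂) (s u w η : V → F₂) :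
    (border (thetaMat S a s u w) (Sum.elim 0 (res S η))).det =
      ∑ T ∈ S.powerset, (tau T a η * ∑ k ∈ T, w k) * theta (S \ T) a s u w := by
  have tau0 (T : Finset V) : tau T a 0 = 0 := by simpa using tau_add T a 0 0
  let f : (V → F₂) →+ F₂ := AddMonoidHom.mk'
    (fun ζ => (border (thetaMat S a s u w) (Sum.elim 0 (res S ζ))).det) fun ζ ζ' => by
      rw [← det_border_add (thetaMat_isSymm ..), res_add]
      congr 2
      ext (k | k) <;> simp
  let f' : (V → F₂) →+ F₂ := AddMonoidHom.mk'
    (fun ζ => ∑ T ∈ S.powerset, (tau T a ζ * ∑ k ∈ T, w k) * theta (S \ T) a s u w)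
    fun ζ ζ' => by
      rw [← sum_add_distrib]
      exact sum_congr rfl fun T _ => by rw [tau_add]; ring
  suffices f = f' from DFunLike.congr_fun this η
  refine AddMonoidHom.functions_ext _ _ _ fun i x => ?_
  rcases zmod2_eq_zero_or_one x with rfl | rfl
  · simp
  simp only [f, f', AddMonoidHom.mk'_apply]
  have out (T : Finset V) (hT : i ∉ T) : tau T a (Pi.single i 1) = 0 := by
    have e : res T (Pi.single i 1 : V → F₂) = res T 0 := by
      refine res_congr fun k hk => ?_
      have : k ≠ i := by rintro rfl; exact hT hk
      simp [this]
    rw [← tau0 T, tau, tau]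
    split_ifs <;> simp only [bd, e]
  by_cases hi : i ∈ S
  · have h := det_add_vecMulVec (thetaMat S a s u w) (Sum.elim 0 (res S (Pi.single i 1)))
    have e : thetaMat S a s u w + vecMulVec (Sum.elim 0 (res S (Pi.single i 1)))
        (Sum.elim 0 (res S (Pi.single i 1))) = thetaMat S a s (u + Pi.single i 1) w := by
      ext (k | k) (l | l) <;> simp [thetaMat, vecMulVec_apply, res_add, res_single S hi]
      by_cases hk : k = l
      · subst hk
        simp [Pi.single_apply]
      · by_cases hki : k = i <;> by_cases hli : l = i <;> simp_all
    rw [e] at h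
    change theta S a s (u + Pi.single i 1) w = theta S a s u w + _ at h
    rw [theta_recursion a s _ w hi, theta_recursion a s u w hi] at h
    rw [← sub_eq_iff_eq_add'] at h
    rw [← h, ← sum_sub_distrib]
    rw [sum_filter]
    refine sum_congr rfl fun T _ => ?_
    split_ifs with hiT
    · rw [theta_congr_diag (S := S \ T) (u := u + Pi.single i 1) (u' := u) (w' := w) a s _
        (fun _ _ => rfl), tau_add]
      · ring
      · intro k hk
        have : k ≠ i := by
          rintro rfl
          exact (mem_sdiff.1 hk).2 hiT
        simp [this]
    · rw [out T hiT]
      ring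
  · have e : (Sum.elim 0 (res S (Pi.single i 1)) : V ⊕ V → F₂) = 0 := by
      ext (k | k)
      · simp
      · by_cases hk : k = i
        · subst hk
          simp [res, hi]
        · simp [res, hk]
    rw [e, det_border_zero, sum_eq_zero]
    intro T hT
    rw [mem_powerset] at hT
    rw [out T fun h => hi (hT h)]
    ring

end Recursion

/-! ### Double borders and rank one updates -/

section Border

variable {ι : Type} [Fintype ι] [DecidableEq ι]

theorem det_border_border_single (M : Matrix ι ι F₂) (w : ι → F₂) :
    (border (border M w) (Sum.elim 0 1)).det = M.det := by
  rw [det_clear_col _ (Sum.inr ()) (Sum.inl (Sum.inr ())),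
    det_clear_row _ (Sum.inr ()) (Sum.inl (Sum.inr ()))]
  · have e := det_permute' (Equiv.swap (Sum.inr ()) (Sum.inl (Sum.inr ())))
      (fromBlocks (fromBlocks M 0 0 (1 : Matrix Unit Unit F₂)) 0 0 (1 : Matrix Unit Unit F₂))
    rw [det_fromBlocks_zero₂₁, det_fromBlocks_zero₂₁] at e
    simp only [det_one, mul_one] at e
    rw [Equiv.Perm.sign_swap (by simp)] at e
    have e₂ : (((-1 : ℤˣ) : ℤ) : F₂) * M.det = M.det := by
      simp [CharTwo.neg_eq]
    rw [e₂] at e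
    rw [← e]
    congr 1
    ext ((i | i) | i) ((j | j) | j) <;>
      simp [border, submatrix_apply, Equiv.swap_apply_def]
  · rintro ((i | i) | i) <;> simp [border]
  · rintro ((i | i) | i) <;> simp [border]

theorem border_add_vecMulVec (M : Matrix ι ι F₂) (v w : ι → F₂) :
    border (M + vecMulVec v v) w =
      border M w + vecMulVec (Sum.elim v 0) (Sum.elim v (0 : Unit → F₂)) := by
  ext (i | i) (j | j) <;> simp [border, vecMulVec_apply]

theorem border_mulVec (M : Matrix ι ι F₂) (w c : ι → F₂) :
    border M w *ᵥ Sum.elim c 0 = Sum.elim (M *ᵥ c) fun _ => w ⬝ᵥ c := by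
  rw [border, fromBlocks_mulVec]
  ext (i | i) <;> simp [mulVec, dotProduct]

theorem det_border_mulVec {M : Matrix ι ι F₂} (hM : M.IsSymm) (c : ι → F₂) :
    (border M (M *ᵥ c)).det = (c ⬝ᵥ M *ᵥ c) * M.det := by
  simpa [det_border_zero] using det_border_add_mulVec hM 0 c

/-- The vector (Mc, 0) differs from the image of (c, 0) under the bordered matrix only in the last
entry, by w · c. A unit vector as second border cancels the first border. -/
theorem det_border_border_mulVec {M : Matrix ι ι F₂} (hM : M.IsSymm) (w c : ι → F₂) :
    (border (border M w) (Sum.elim (M *ᵥ c) 0)).det =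
      (w ⬝ᵥ c) * M.det + (c ⬝ᵥ M *ᵥ c) * (border M w).det := by
  have e : (Sum.elim (M *ᵥ c) 0 : ι ⊕ Unit → F₂) =
      Sum.elim (0 : ι → F₂) (fun _ => w ⬝ᵥ c) + border M w *ᵥ Sum.elim c 0 := by
    rw [border_mulVec]
    ext (i | i) <;> simp [zmod2_add_self]
  rw [e, det_border_add_mulVec (border_isSymm hM w), border_mulVec]
  congr 1
  · rcases zmod2_eq_zero_or_one (w ⬝ᵥ c) with h | h
    · rw [h, zero_mul]
      convert det_border_zero (border M w)
      ext (i | i) <;> simp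
    · rw [h, one_mul]
      exact det_border_border_single M w
  · simp [dotProduct]

/-- The border of a rank one update `M + vvᵀ` with `v = Mc`. -/
theorem det_border_rank_one {M : Matrix ι ι F₂} (hM : M.IsSymm) {v c : ι → F₂} (hv : M *ᵥ c = v)
    (w : ι → F₂) : (border (M + vecMulVec v v) w).det =
      (1 + c ⬝ᵥ v) * (border M w).det + (w ⬝ᵥ c) * M.det := by
  subst hv
  rw [border_add_vecMulVec, det_add_vecMulVec, det_border_border_mulVec hM]
  ring

theorem det_border_rank_one_self (M : Matrix ι ι F₂) (v : ι → F₂) :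
    (border (M + vecMulVec v v) v).det = (border M v).det := by
  have h := det_add_vecMulVec (M + vecMulVec v v) v
  have e : M + vecMulVec v v + vecMulVec v v = M := by
    ext i j
    simp [add_assoc, zmod2_add_self]
  rw [e, det_add_vecMulVec] at h
  linear_combination -h - zmod2_add_self (border M v).det

theorem det_border_swap (M : Matrix ι ι F₂) (v w : ι → F₂) :
    (border (border M v) (Sum.elim w 0)).det = (border (border M w) (Sum.elim v 0)).det := by
  rw [← det_submatrix_equiv_self ((Equiv.sumAssoc ι Unit Unit).trans
    ((Equiv.sumCongr (Equiv.refl ι) (Equiv.sumComm Unit Unit)).trans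
      (Equiv.sumAssoc ι Unit Unit).symm))]
  congr 1
  ext ((i | i) | i) ((j | j) | j) <;> simp [border]

theorem det_border_congruence (U M : Matrix ι ι F₂) (hU : U.det = 1) (v : ι → F₂) :
    (border (U * M * Uᵀ) (U *ᵥ v)).det = (border M v).det := by
  have e : border (U * M * Uᵀ) (U *ᵥ v) = fromBlocks U 0 0 (1 : Matrix Unit Unit F₂) *
      border M v * fromBlocks Uᵀ 0 0 (1 : Matrix Unit Unit F₂) := by
    rw [border, border, fromBlocks_multiply, fromBlocks_multiply]
    ext (i | i) (j | j)
    · simp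
    · simp [mul_apply, mulVec, dotProduct]
    · simp [mul_apply, mulVec, dotProduct, mul_comm]
    · simp
  rw [e, det_mul, det_mul, det_fromBlocks_zero₂₁, det_fromBlocks_zero₂₁, det_transpose, hU]
  simp

end Border

/-! ### A block congruence -/

section Block

variable {V : Type} [Fintype V] [DecidableEq V]

/-- The block operation that adds the second block row to the first. -/
def addRow : Matrix (V ⊕ V) (V ⊕ V) F₂ := fromBlocks 1 1 0 1

theorem det_addRow : (addRow : Matrix (V ⊕ V) (V ⊕ V) F₂).det = 1 := by
  simp [addRow]

theorem addRow_mul (P Q R D : Matrix V V F₂) :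
    addRow * fromBlocks P Q R D * addRowᵀ =
      fromBlocks (P + R + (Q + D)) (Q + D) (R + D) D := by
  simp [addRow, fromBlocks_transpose, fromBlocks_multiply]

end Block

/-! ### Rédei data and their exponentials -/

/-- Weights `a`, `y`, `z` satisfying reciprocity, together with functions `gf` and `ge` that are
given by the Rédei determinants of `a`. -/
structure RedeiData (V : Type) [Fintype V] [DecidableEq V] where
  a : V → V → F₂
  y : V → F₂
  z : V → F₂
  gf : Finset V → F₂
  ge : SetFun V
  recip : ∀ i j, i ≠ j → a i j + a j i = y i * y j
  tau_odd : ∀ T : Finset V, ∑ i ∈ T, y i = 1 → ∀ u, tau T a u = gf T * ∑ i ∈ T, u i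
  tau_even : ∀ T : Finset V, T.Nonempty → ∑ i ∈ T, y i = 0 → tau T a z = gf T
  ge_eq : ∀ T : Finset V, ge T = (net T a z).det

namespace RedeiData

variable {V : Type} [Fintype V] [DecidableEq V] (R : RedeiData V)

/-- The restriction of `gf` to the nonempty sets of given weights. -/
def G (α β : F₂) : SetFun V := fun T =>
  if T.Nonempty ∧ ∑ i ∈ T, R.y i = α ∧ ∑ i ∈ T, R.z i = β then R.gf T else 0

/-- The parameters of these three functions are chosen so that they are the exponentials of `gf` on
the classes 1, 3 and 5 mod 8. The first one becomes ℒ. -/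
def E1 : SetFun V := fun S => theta S R.a R.z R.z R.z

def E3 : SetFun V := fun S => theta S R.a 0 R.z R.y

def E5 : SetFun V := fun S => theta S R.a 0 R.z (R.y + R.z)

theorem tau_zero (T : Finset V) (a : V → V → F₂) : tau T a 0 = 0 := by simpa using tau_add T a 0 0

theorem G_cases {T : Finset V} (hT : T.Nonempty) (α β : F₂) : R.G α β T =
    (1 + α + ∑ i ∈ T, R.y i) * (1 + β + ∑ i ∈ T, R.z i) * R.gf T := by
  simp only [G, hT, true_and]
  generalize ∑ i ∈ T, R.y i = a, ∑ i ∈ T, R.z i = b, R.gf T = c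
  revert a b c α β
  decide

/-- The tree sum with root weights `z` is `gf` on the classes 1, 3, 5 and vanishes on the class 7.
This is why no exponential for the class 7 appears. -/
theorem tau_z {T : Finset V} (hT : T.Nonempty) :
    tau T R.a R.z = (1 + (∑ i ∈ T, R.y i) * (1 + ∑ i ∈ T, R.z i)) * R.gf T := by
  rcases zmod2_eq_zero_or_one (∑ i ∈ T, R.y i) with h | h
  · rw [R.tau_even T hT h, h]
    ring
  · rw [R.tau_odd T h, h]
    linear_combination -R.gf T * zmod2_add_self 1

theorem isExp_E1 : SetFun.IsExp (R.G 0 0) R.E1 := by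
  refine theta_isExp _ _ _ _ _ fun T hT => ?_
  rw [R.G_cases hT, R.tau_z hT]
  generalize ∑ i ∈ T, R.y i = a, ∑ i ∈ T, R.z i = b, R.gf T = c
  revert a b c
  decide

theorem isExp_E3 : SetFun.IsExp (R.G 1 1) R.E3 := by
  refine theta_isExp _ _ _ _ _ fun T hT => ?_
  rw [R.G_cases hT, R.tau_z hT, tau_zero]
  generalize ∑ i ∈ T, R.y i = a, ∑ i ∈ T, R.z i = b, R.gf T = c
  revert a b c
  decide

theorem isExp_E5 : SetFun.IsExp (R.G 0 1) R.E5 := by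
  refine theta_isExp _ _ _ _ _ fun T hT => ?_
  rw [R.G_cases hT, R.tau_z hT, tau_zero]
  simp only [Pi.add_apply, sum_add_distrib]
  generalize ∑ i ∈ T, R.y i = a, ∑ i ∈ T, R.z i = b, R.gf T = c
  revert a b c
  decide

/-- For u = w = 0 the determinant `theta` is that of A + D_z itself, and its exponent τ(z) is the
sum of `gf` over the classes 1, 3 and 5. -/
theorem ge_eq_mul : (R.ge : SetFun V) = R.E1 * R.E3 * R.E5 := by
  have h : SetFun.IsExp (R.G 0 0 + R.G 1 1 + R.G 0 1) (fun S => theta S R.a R.z 0 0) := by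
    refine theta_isExp _ _ _ _ _ fun T hT => ?_
    rw [SetFun.add_apply, SetFun.add_apply, R.G_cases hT, R.G_cases hT, R.G_cases hT, R.tau_z hT,
      tau_zero, zero_mul]
    generalize ∑ i ∈ T, R.y i = a, ∑ i ∈ T, R.z i = b, R.gf T = c
    revert a b c
    decide
  rw [← h.unique ((R.isExp_E1.mul R.isExp_E3).mul R.isExp_E5)]
  ext S
  rw [theta_zero, R.ge_eq]

theorem theta_zzy : (fun S => theta S R.a R.z R.z R.y : SetFun V) = R.E1 * R.E5 := by
  refine SetFun.IsExp.unique (c := R.G 0 0 + R.G 0 1) (theta_isExp _ _ _ _ _ fun T hT => ?_)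
    (R.isExp_E1.mul R.isExp_E5)
  rw [SetFun.add_apply, R.G_cases hT, R.G_cases hT, R.tau_z hT]
  generalize ∑ i ∈ T, R.y i = a, ∑ i ∈ T, R.z i = b, R.gf T = c
  revert a b c
  decide

theorem even_G_y (β : F₂) : SetFun.Even R.y (R.G 0 β) := by
  refine SetFun.even_iff.2 fun S hS => ?_
  rw [G, ne_eq, ite_eq_right_iff, Classical.not_imp] at hS
  exact hS.1.2.1

theorem odd_G_y (β : F₂) : SetFun.Odd R.y (R.G 1 β) := by
  refine SetFun.odd_iff.2 fun S hS => ?_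
  rw [G, ne_eq, ite_eq_right_iff, Classical.not_imp] at hS
  exact hS.1.2.1

theorem even_G_z (α : F₂) : SetFun.Even R.z (R.G α 0) := by
  refine SetFun.even_iff.2 fun S hS => ?_
  rw [G, ne_eq, ite_eq_right_iff, Classical.not_imp] at hS
  exact hS.1.2.2

theorem odd_G_z (α : F₂) : SetFun.Odd R.z (R.G α 1) := by
  refine SetFun.odd_iff.2 fun S hS => ?_
  rw [G, ne_eq, ite_eq_right_iff, Classical.not_imp] at hS
  exact hS.1.2.2

theorem even_E1_y : SetFun.Even R.y R.E1 := R.isExp_E1.even (R.even_G_y 0)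

theorem even_E1_z : SetFun.Even R.z R.E1 := R.isExp_E1.even (R.even_G_z 0)

theorem even_E5_y : SetFun.Even R.y R.E5 := R.isExp_E5.even (R.even_G_y 1)

/-- `[[A + Aᵀ, Aᵀ], [A, D_z]]` for the subset `S`. -/
def mat (S : Finset V) : Matrix (V ⊕ V) (V ⊕ V) F₂ :=
  fromBlocks (net S R.a 0 + (net S R.a 0)ᵀ) (net S R.a 0)ᵀ (net S R.a 0) (diagonal (res S R.z))

theorem net_eq_add (S : Finset V) : net S R.a R.z = net S R.a 0 + diagonal (res S R.z) := by
  ext i j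
  by_cases h : i = j
  · subst h
    by_cases hi : i ∈ S <;> simp [net, res, hi, add_comm]
  · simp [net, h]

theorem addRow_congruence (S : Finset V) (w : V → F₂) :
    addRow * thetaMat S R.a R.z R.z w * addRowᵀ =
      fromBlocks (net S R.a 0 + (net S R.a 0)ᵀ + diagonal (res S (w + R.z))) (net S R.a 0)ᵀ
        (net S R.a 0) (diagonal (res S R.z)) := by
  have d (M : Matrix V V F₂) : M + diagonal (res S R.z) + diagonal (res S R.z) = M := by
    ext i j
    simp [add_assoc, zmod2_add_self]
  rw [thetaMat, addRow_mul, net_eq_add, transpose_add, diagonal_transpose, d, d, res_add,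
    show diagonal (res S w + res S R.z) = diagonal (res S w) + diagonal (res S R.z) from
      (diagonal_add _ _).symm]
  congr 1
  abel

/-- Adding the second block row and column to the first turns A + D_z into A in the off-diagonal
blocks, and the diagonal terms left in the corner cancel. -/
theorem mat_eq_congruence (S : Finset V) :
    R.mat S = addRow * thetaMat S R.a R.z R.z R.z * addRowᵀ := by
  rw [addRow_congruence, mat]
  have : R.z + R.z = 0 := by ext i; exact zmod2_add_self _
  have e : res S (0 : V → F₂) = 0 := by ext; simp [res]
  simp [this, e]

theorem det_mat (S : Finset V) : (R.mat S).det = R.E1 S := by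
  rw [mat_eq_congruence, det_mul, det_mul, det_transpose, det_addRow, one_mul, mul_one]
  rfl

/-- Quadratic reciprocity in matrix form. The left side has zero diagonal, and `res S R.y` cancels
the diagonal of yyᵀ because y² = y. -/
theorem net_add_transpose (S : Finset V) : net S R.a 0 + (net S R.a 0)ᵀ =
    diagonal (res S R.y) + vecMulVec (res S R.y) (res S R.y) := by
  ext i j
  by_cases h : i = j
  · subst h
    simp [vecMulVec_apply, zmod2_add_self, zmod2_mul_self]
  · by_cases hi : i ∈ S <;> by_cases hj : j ∈ S <;>
      simp [vecMulVec_apply, net, h, Ne.symm h, res, hi, hj, R.recip i j h]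

theorem mat_eq_rank_one (S : Finset V) : R.mat S = thetaMat S R.a 0 R.z R.y +
    vecMulVec (Sum.elim (res S R.y) 0) (Sum.elim (res S R.y) 0) := by
  rw [mat, net_add_transpose, thetaMat]
  ext (i | i) (j | j) <;> simp [vecMulVec_apply]

theorem thetaMat_mulVec (S : Finset V) : thetaMat S R.a 0 R.z R.y *ᵥ Sum.elim (res S 1) 0 =
    Sum.elim (res S R.y) 0 := by
  rw [thetaMat, fromBlocks_mulVec]
  ext (i | i)
  · by_cases hi : i ∈ S <;> simp [mulVec_diagonal, res, hi]
  · simp [net_zero_mulVec]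

theorem sum_res_one (S : Finset V) (u : V → F₂) :
    (Sum.elim (res S 1) 0 : V ⊕ V → F₂) ⬝ᵥ Sum.elim (res S u) 0 = ∑ i ∈ S, u i := by
  rw [dotProduct, Fintype.sum_sum_type]
  simp only [Sum.elim_inl, Sum.elim_inr, Pi.zero_apply, mul_zero, sum_const_zero, add_zero]
  rw [← sum_subset (subset_univ S) (fun x _ hx => by simp [res, hx])]
  exact sum_congr rfl fun x hx => by simp [res, hx]

theorem det_border_y (S : Finset V) : (border (thetaMat S R.a 0 R.z R.y)
    (Sum.elim (res S R.y) 0)).det = (∑ i ∈ S, R.y i) * R.E3 S := by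
  rw [← thetaMat_mulVec, det_border_mulVec (thetaMat_isSymm ..), thetaMat_mulVec, sum_res_one]
  rfl

theorem E1_eq (S : Finset V) : R.E1 S = (1 + ∑ i ∈ S, R.y i) * R.E3 S := by
  rw [← det_mat, mat_eq_rank_one, det_add_vecMulVec, det_border_y, add_mul, one_mul]
  rfl

/-- By `E1_eq` the function `E1` is the part of `E3` on sets of even y-weight. On odd sets,
differentiation by the weight `y` gives E3 = G·E3 with G of odd weight. Only the even part of the
second factor matters there, and it is `E1`. -/
theorem E3_eq : R.E3 = R.E1 * (1 + R.G 1 1) := by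
  have odd : SetFun.Odd R.y (R.G 1 1 * R.E1) := (R.odd_G_y 1).mul_even R.even_E1_y
  have diff : SetFun.Odd R.y (R.E1 + R.E3) := by
    refine SetFun.odd_iff.2 fun S hS => ?_
    by_contra h
    have h0 := (zmod2_eq_zero_or_one _).resolve_right h
    rw [SetFun.add_apply, E1_eq, h0] at hS
    apply hS
    linear_combination zmod2_add_self (R.E3 S)
  have key : SetFun.wt R.y R.E3 = R.G 1 1 * R.E3 := by
    rw [R.isExp_E3.wt_eq, R.odd_G_y 1]
  ext S
  rw [mul_add, mul_one, mul_comm, SetFun.add_apply]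
  rcases zmod2_eq_zero_or_one (∑ i ∈ S, R.y i) with h | h
  · rw [odd.apply h, E1_eq, h]
    ring
  · have h₁ := congrFun key S
    rw [SetFun.wt_apply, h, one_mul] at h₁
    have h₂ := ((R.odd_G_y 1).mul diff).apply h
    rw [mul_add, SetFun.add_apply, ← h₁] at h₂
    rw [R.even_E1_y.apply h, zero_add]
    exact (CharTwo.add_eq_zero.1 h₂).symm

end RedeiData

namespace RedeiData

/-! ### The determinants of the theorem as convolutions -/

section Borders

variable {V : Type} [Fintype V] [DecidableEq V] (R : RedeiData V)

theorem det_border_z (S : Finset V) : (border (thetaMat S R.a 0 R.z R.y)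
    (Sum.elim (res S R.z) 0)).det = ((R.G 0 1 + R.G 1 1) * R.E3) S := by
  rw [det_border_left, SetFun.mul_apply]
  refine sum_congr rfl fun T _ => ?_
  congr 1
  rcases T.eq_empty_or_nonempty with rfl | hT
  · simp [tau_empty, G]
  · rw [SetFun.add_apply, R.G_cases hT, R.G_cases hT, R.tau_z hT]
    generalize ∑ i ∈ T, R.y i = a, ∑ i ∈ T, R.z i = b, R.gf T = c
    revert a b c
    decide

theorem tau_y (T : Finset V) :
    tau T R.a R.y * ∑ i ∈ T, R.y i = (R.G 1 0 + R.G 1 1) T := by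
  rcases T.eq_empty_or_nonempty with rfl | hT
  · simp [tau_empty, G]
  · rw [SetFun.add_apply, R.G_cases hT, R.G_cases hT]
    rcases zmod2_eq_zero_or_one (∑ i ∈ T, R.y i) with h | h
    · rw [h]
      generalize ∑ i ∈ T, R.z i = b, R.gf T = c
      revert b c
      simp only [mul_zero]
      decide
    · rw [R.tau_odd T h, h]
      generalize ∑ i ∈ T, R.z i = b, R.gf T = c
      revert b c
      decide

theorem det_border_y_right (S : Finset V) : (border (thetaMat S R.a 0 R.z R.y)
    (Sum.elim 0 (res S R.y))).det = ((R.G 1 0 + R.G 1 1) * R.E3) S := by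
  rw [det_border_right, SetFun.mul_apply]
  exact sum_congr rfl fun T _ => by rw [tau_y]; rfl

theorem det_border_zzy (S : Finset V) : (border (thetaMat S R.a R.z R.z R.y)
    (Sum.elim 0 (res S R.y))).det = ((R.G 1 0 + R.G 1 1) * (R.E1 * R.E5)) S := by
  rw [det_border_right, SetFun.mul_apply, ← theta_zzy]
  exact sum_congr rfl fun T _ => by rw [tau_y]

end Borders

section Determinants

variable {r : ℕ} (R : RedeiData (Fin r))

theorem res_univ (u : Fin r → F₂) : res univ u = u := by ext; simp [res]

def A : Matrix (Fin r) (Fin r) F₂ := net univ R.a 0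

theorem M1_eq : M1 R.A R.z = R.mat univ := by rw [mat, res_univ]; rfl

theorem M2_eq : M2 R.A R.y R.z = addRow * thetaMat univ R.a R.z R.z R.y * addRowᵀ := by
  rw [addRow_congruence, res_univ, res_univ]
  rfl

/-- The vector `(1, 0)`, which `thetaMat` maps to `(y, 0)`. -/
def c : Fin r ⊕ Fin r → F₂ := Sum.elim 1 0

theorem thetaMat_mulVec_c : thetaMat univ R.a 0 R.z R.y *ᵥ c = Sum.elim R.y 0 := by
  have := R.thetaMat_mulVec univ
  rwa [res_univ, res_univ] at this

theorem c_dotProduct (u v : Fin r → F₂) : c ⬝ᵥ Sum.elim u v = ∑ i, u i := by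
  simp [c, dotProduct]

theorem M1_eq_rank_one : M1 R.A R.z = thetaMat univ R.a 0 R.z R.y +
    vecMulVec (Sum.elim R.y 0) (Sum.elim R.y 0) := by
  rw [M1_eq, mat_eq_rank_one, res_univ]

theorem det_M1 : (M1 R.A R.z).det = R.E1 univ := by rw [M1_eq, det_mat]

theorem det_M2 : (M2 R.A R.y R.z).det = (R.E1 * R.E5) univ := by
  rw [M2_eq, det_mul, det_mul, det_transpose, det_addRow, one_mul, mul_one, ← theta_zzy]
  rfl

/-- The matrix is a rank one update by (y, 0), which is the image of the vector `c`, so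
`det_border_rank_one` applies. -/
theorem det_border_M1 (w : Fin r ⊕ Fin r → F₂) : (border (M1 R.A R.z) w).det =
    (1 + ∑ i, R.y i) * (border (thetaMat univ R.a 0 R.z R.y) w).det +
      (c ⬝ᵥ w) * R.E3 univ := by
  rw [M1_eq_rank_one, det_border_rank_one (thetaMat_isSymm ..) R.thetaMat_mulVec_c, c_dotProduct,
    dotProduct_comm w]
  rfl

theorem det_border_y_univ : (border (thetaMat univ R.a 0 R.z R.y) (Sum.elim R.y 0)).det =
    (∑ i, R.y i) * R.E3 univ := by
  have := R.det_border_y univ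
  rwa [res_univ] at this

theorem det_border_z_univ : (border (thetaMat univ R.a 0 R.z R.y) (Sum.elim R.z 0)).det =
    ((R.G 0 1 + R.G 1 1) * R.E3) univ := by
  have := R.det_border_z univ
  rwa [res_univ] at this

theorem det_border_y_right_univ : (border (thetaMat univ R.a 0 R.z R.y) (Sum.elim 0 R.y)).det =
    ((R.G 1 0 + R.G 1 1) * R.E3) univ := by
  have := R.det_border_y_right univ
  rwa [res_univ] at this

theorem det_border_yz_univ : (border (thetaMat univ R.a 0 R.z R.y) (Sum.elim (R.y + R.z) 0)).det =
    (∑ i, R.y i) * R.E3 univ + ((R.G 0 1 + R.G 1 1) * R.E3) univ := by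
  rw [← det_border_y_univ, ← det_border_z_univ, ← det_border_add (thetaMat_isSymm ..)]
  congr 2
  ext (i | i) <;> simp

theorem det_M3 (hy : ∑ i, R.y i = 1) : (M3 R.A R.y R.z).det = (R.G 1 1 * R.E1) univ := by
  rw [M3, det_border_M1, c_dotProduct, hy, E3_eq, mul_add, mul_one, SetFun.add_apply,
    R.even_E1_y.apply hy, mul_comm R.E1]
  linear_combination (border (thetaMat univ R.a 0 R.z R.y) (Sum.elim R.y 0)).det *
    zmod2_add_self 1

theorem det_M5a (hy : ∑ i, R.y i = 0) (hz : ∑ i, R.z i = 1) :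
    (M5a R.A R.y R.z).det = (R.G 0 1 * R.E1) univ := by
  have h₁ := R.even_E1_z.apply hz
  have h₂ := ((R.odd_G_y 1).mul_even R.even_E1_y).apply hy
  have h₃ := (((R.even_G_y 1).mul_odd (R.odd_G_y 1)).mul_even R.even_E1_y).apply hy
  have h₄ : R.G 1 1 * R.G 1 1 = 0 := SetFun.mul_self_of_empty (by simp [G])
  have e : (R.G 0 1 + R.G 1 1) * (R.E1 * (1 + R.G 1 1)) = R.G 0 1 * R.E1 +
      R.G 0 1 * R.G 1 1 * R.E1 + R.G 1 1 * R.E1 := by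
    linear_combination R.E1 * h₄
  have e' : R.E1 * (1 + R.G 1 1) = R.E1 + R.G 1 1 * R.E1 := by ring
  rw [M5a, det_border_M1, c_dotProduct, det_border_yz_univ, E3_eq, e, e']
  simp only [SetFun.add_apply, Pi.add_apply, sum_add_distrib, h₁, h₂, h₃, hy, hz]
  ring

theorem det_M5b (hy : ∑ i, R.y i = 0) :
    (M5b R.A R.y R.z).det = (R.G 1 0 * R.G 1 1 * R.E1) univ := by
  have h₁ := ((R.odd_G_y 0).mul_even R.even_E1_y).apply hy
  have h₂ := ((R.odd_G_y 1).mul_even R.even_E1_y).apply hy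
  have h₄ : R.G 1 1 * R.G 1 1 = 0 := SetFun.mul_self_of_empty (by simp [G])
  have e : (R.G 1 0 + R.G 1 1) * (R.E1 * (1 + R.G 1 1)) = R.G 1 0 * R.E1 +
      R.G 1 0 * R.G 1 1 * R.E1 + R.G 1 1 * R.E1 := by
    linear_combination R.E1 * h₄
  rw [M5b, det_border_M1, c_dotProduct, det_border_y_right_univ, E3_eq, e]
  simp only [SetFun.add_apply, h₁, h₂, hy, Pi.zero_apply, sum_const_zero]
  ring

theorem det_M7b (hy : ∑ i, R.y i = 1) (hz : ∑ i, R.z i = 0) :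
    (M7b R.A R.y R.z).det = (R.G 0 1 * R.G 1 1 * R.E1) univ := by
  have h₁ := ((R.even_G_y 1).mul R.even_E1_y).apply hy
  have h₂ := ((R.odd_G_z 1).mul_even R.even_E1_z).apply hz
  have h₄ : R.G 1 1 * R.G 1 1 = 0 := SetFun.mul_self_of_empty (by simp [G])
  have e : (R.G 0 1 + R.G 1 1) * (R.E1 * (1 + R.G 1 1)) = R.G 0 1 * R.E1 +
      R.G 0 1 * R.G 1 1 * R.E1 + R.G 1 1 * R.E1 := by
    linear_combination R.E1 * h₄
  -- The outer border is the vector of the rank one update itself, so the update can be dropped.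
  rw [M7b, M1_eq_rank_one, border_add_vecMulVec, det_border_rank_one_self,
    ← R.thetaMat_mulVec_c, det_border_border_mulVec (thetaMat_isSymm ..), R.thetaMat_mulVec_c,
    det_border_yz_univ, dotProduct_comm, c_dotProduct, c_dotProduct]
  change _ * R.E3 univ + _ = _
  rw [E3_eq, e]
  simp only [SetFun.add_apply, Pi.add_apply, sum_add_distrib, h₁, h₂, hy, hz]
  linear_combination (R.E1 * (1 + R.G 1 1)) univ * zmod2_add_self 1

theorem det_M7a (hy : ∑ i, R.y i = 1) (hz : ∑ i, R.z i = 0) :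
    (M7a R.A R.y R.z).det = (R.G 1 0 * R.E1) univ := by
  have h₁ := (((R.odd_G_y 0).mul (R.odd_G_y 1)).mul R.even_E1_y).apply hy
  have h₂ := ((R.odd_G_z 1).mul_even R.even_E1_z).apply hz
  have h₄ : R.G 1 1 * R.G 1 1 = 0 := SetFun.mul_self_of_empty (by simp [G])
  have e : (R.G 1 0 + R.G 1 1) * (R.E1 * (1 + R.G 1 1)) = R.G 1 0 * R.E1 +
      R.G 1 0 * R.G 1 1 * R.E1 + R.G 1 1 * R.E1 := by
    linear_combination R.E1 * h₄
  have hc : border (thetaMat univ R.a 0 R.z R.y) (Sum.elim 0 R.y) *ᵥ Sum.elim c 0 =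
      Sum.elim (Sum.elim R.y 0) 0 := by
    rw [border_mulVec, thetaMat_mulVec_c, dotProduct_comm, c_dotProduct]
    ext (i | i) <;> simp
  -- With (0, y) as inner border the update vector is still in the image of the bordered matrix, as
  -- `hc` shows, and the rank one formula applies once more.
  rw [M7a, det_border_swap, M1_eq_rank_one, border_add_vecMulVec,
    det_border_rank_one (border_isSymm (thetaMat_isSymm ..) _) hc, det_border_y_right_univ]
  have e₁ (u v w : Fin r ⊕ Fin r → F₂) (k : Unit → F₂) :
      (Sum.elim u 0 : (Fin r ⊕ Fin r) ⊕ Unit → F₂) ⬝ᵥ Sum.elim v k = u ⬝ᵥ v := by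
    simp [dotProduct]
  rw [e₁ _ _ 0, e₁ _ _ 0, dotProduct_comm _ c, c_dotProduct, c_dotProduct, E3_eq, e]
  simp only [SetFun.add_apply, Pi.add_apply, sum_add_distrib, h₁, h₂, hy, hz]
  linear_combination (border (border (thetaMat univ R.a 0 R.z R.y) (Sum.elim 0 R.y))
    (Sum.elim (Sum.elim (R.y + R.z) 0) 0)).det * zmod2_add_self 1

/-- Substitute `E3_eq` in the product for `ge` and cancel E1² = 1. -/
theorem ge_mul_E1 : (R.ge : SetFun (Fin r)) * R.E1 = R.E1 * R.E5 + R.G 1 1 * (R.E1 * R.E5) := by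
  rw [ge_eq_mul, E3_eq]
  linear_combination R.E1 * (1 + R.G 1 1) * R.E5 * R.isExp_E1.mul_self

theorem det_M2' (hy : ∑ i, R.y i = 0) :
    (M2 R.A R.y R.z).det = ((R.ge : SetFun (Fin r)) * R.E1) univ := by
  rw [det_M2, ge_mul_E1, SetFun.add_apply,
    ((R.odd_G_y 1).mul_even (R.even_E1_y.mul R.even_E5_y)).apply hy, add_zero]

theorem det_M6 (hy : ∑ i, R.y i = 1) : (M6 R.A R.y R.z).det =
    (R.G 1 0 * R.ge * R.E1) univ + ((R.ge : SetFun (Fin r)) * R.E1) univ := by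
  have e : (Sum.elim R.y R.y : Fin r ⊕ Fin r → F₂) = addRow *ᵥ Sum.elim 0 R.y := by
    rw [addRow, fromBlocks_mulVec]
    simp
  have h := R.det_border_zzy univ
  rw [res_univ] at h
  have even := R.even_E1_y.mul R.even_E5_y
  have h₁ := even.apply hy
  have h₂ := ((R.odd_G_y 0).mul ((R.odd_G_y 1).mul_even even)).apply hy
  rw [M6, M2_eq, e, det_border_congruence _ _ det_addRow, h, mul_assoc, ge_mul_E1, add_mul,
    mul_add]
  simp only [SetFun.add_apply, h₁, h₂]
  ring

end Determinants

end RedeiData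

end TYZ

end

/-! ### Ideals and conjugation in imaginary quadratic orders -/

noncomputable section

namespace TYZ

/-- The square root of `-d` in the upper half plane. -/
def rootNeg (d : ℕ) : ℂ := (Real.sqrt d : ℂ) * Complex.I

theorem rootNeg_mul_self (d : ℕ) : rootNeg d * rootNeg d = -(d : ℂ) := by
  have h : (Real.sqrt d : ℂ) * (Real.sqrt d : ℂ) = d := by
    rw [← Complex.ofReal_mul, Real.mul_self_sqrt (Nat.cast_nonneg d), Complex.ofReal_natCast]
  rw [rootNeg]
  linear_combination Complex.I * Complex.I * h + d * Complex.I_mul_I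

theorem conj_rootNeg (d : ℕ) : (starRingEnd ℂ) (rootNeg d) = -rootNeg d := by
  simp [rootNeg]

theorem add_mul_rootNeg_injective {d : ℕ} (hd : d ≠ 0) {a b a' b' : ℤ}
    (h : (a + b * rootNeg d : ℂ) = a' + b' * rootNeg d) : a = a' ∧ b = b' := by
  have h0 : (Real.sqrt d) ≠ 0 := by positivity
  constructor
  · have := congrArg Complex.re h
    simpa [rootNeg] using this
  · have := congrArg Complex.im h
    simpa [rootNeg, h0] using this

/-- `φ` identifies `O` with the ring of integers of `ℚ(√-d)`. -/
structure IsImagQuad (d : ℕ) {O : Type*} [CommRing O] (φ : O →+* ℂ) : Prop where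
  inj : Function.Injective φ
  mem_iff : ∀ x : ℂ, (∃ α, φ α = x) ↔
    ∃ a b : ℤ, 2 * x = a + b * rootNeg d ∧ (4 : ℤ) ∣ a ^ 2 + d * b ^ 2

theorem dvd_of_sq_dvd_squarefree_mul {d : ℕ} (hd : Squarefree d) {n b : ℤ}
    (h : n ^ 2 ∣ d * b ^ 2) : n ∣ b := by
  rw [← Int.natAbs_dvd_natAbs] at h ⊢
  rw [Int.natAbs_pow, Int.natAbs_mul, Int.natAbs_pow, Int.natAbs_natCast] at h
  generalize n.natAbs = n at *
  generalize b.natAbs = b at *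
  rcases Nat.eq_zero_or_pos n with rfl | hn
  · simp [hd.ne_zero] at h
    simp [h]
  obtain ⟨g, n', b', hg, hc, rfl, rfl⟩ := Nat.exists_coprime' (Nat.gcd_pos_of_pos_left b hn)
  have hg' : 0 < g ^ 2 := by positivity
  have h' : n' ^ 2 ∣ d * b' ^ 2 := by
    rw [mul_pow, mul_pow, ← mul_assoc] at h
    exact Nat.dvd_of_mul_dvd_mul_right hg' h
  have h'' : n' * n' ∣ d := by
    rw [← sq]
    exact (Nat.Coprime.pow 2 2 hc).dvd_of_dvd_mul_right h'
  have := Nat.isUnit_iff.1 (hd n' h'')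
  simp [this]

namespace IsImagQuad

variable {d : ℕ} {O : Type*} [CommRing O] {φ : O →+* ℂ} (h : IsImagQuad d φ)

include h

theorem exists_conj (α : O) : ∃ β, φ β = (starRingEnd ℂ) (φ α) := by
  obtain ⟨a, b, h₁, h₂⟩ := (h.mem_iff (φ α)).1 ⟨α, rfl⟩
  refine (h.mem_iff _).2 ⟨a, -b, ?_, by simpa using h₂⟩
  have := congrArg (starRingEnd ℂ) h₁
  simp only [map_mul, map_add, conj_rootNeg, map_intCast, map_ofNat] at this
  rw [this]
  push_cast
  ring

/-- Complex conjugation on `O`. -/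
def conj : O →+* O where
  toFun α := (h.exists_conj α).choose
  map_one' := h.inj (by rw [(h.exists_conj 1).choose_spec]; simp)
  map_zero' := h.inj (by rw [(h.exists_conj 0).choose_spec]; simp)
  map_mul' α β := h.inj (by
    rw [(h.exists_conj _).choose_spec, map_mul φ, map_mul φ, (h.exists_conj α).choose_spec,
      (h.exists_conj β).choose_spec, map_mul])
  map_add' α β := h.inj (by
    rw [(h.exists_conj _).choose_spec, map_add φ, map_add φ, (h.exists_conj α).choose_spec,
      (h.exists_conj β).choose_spec, map_add])

theorem map_conj (α : O) : φ (h.conj α) = (starRingEnd ℂ) (φ α) := (h.exists_conj α).choose_spec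

theorem conj_conj (α : O) : h.conj (h.conj α) = α := h.inj (by simp [map_conj])

theorem exists_coords (α : O) : ∃ a b n : ℤ, 2 * φ α = a + b * rootNeg d ∧
    a ^ 2 + d * b ^ 2 = 4 * n ∧ α * h.conj α = n ∧ α + h.conj α = a := by
  obtain ⟨a, b, h₁, n, hn⟩ := (h.mem_iff (φ α)).1 ⟨α, rfl⟩
  have h₂ := congrArg (starRingEnd ℂ) h₁
  simp only [map_mul, map_add, conj_rootNeg, map_intCast, map_ofNat, ← h.map_conj] at h₂
  refine ⟨a, b, n, h₁, hn, h.inj ?_, h.inj ?_⟩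
  · rw [map_mul, map_intCast]
    have hn' := congrArg (Int.cast : ℤ → ℂ) hn
    push_cast at hn'
    have : 4 * (φ α * φ (h.conj α)) = 4 * n := by
      linear_combination h₁ * 2 * φ (h.conj α) + (a + b * rootNeg d) * h₂ + hn' -
        b ^ 2 * rootNeg_mul_self d
    exact mul_left_cancel₀ (by norm_num : (4 : ℂ) ≠ 0) this
  · rw [map_add, map_intCast]
    linear_combination (h₁ + h₂) / 2

theorem exists_of_coords {a b n : ℤ} (hn : a ^ 2 + d * b ^ 2 = 4 * n) :
    ∃ α : O, 2 * φ α = a + b * rootNeg d ∧ α * h.conj α = n ∧ α + h.conj α = a := by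
  obtain ⟨α, hα⟩ := (h.mem_iff ((a + b * rootNeg d) / 2)).2 ⟨a, b, by ring, n, hn⟩
  have h₁ : 2 * φ α = a + b * rootNeg d := by rw [hα]; ring
  obtain ⟨a', b', n', e₁, e₂, e₃, e₄⟩ := h.exists_coords α
  rw [h₁] at e₁
  rcases eq_or_ne d 0 with rfl | hd
  · have h0 : rootNeg 0 = 0 := by simp [rootNeg]
    simp only [h0, mul_zero, add_zero, Int.cast_inj] at e₁
    subst e₁
    have : n' = n := by simp at hn e₂; omega
    exact ⟨α, h₁, this ▸ e₃, e₄⟩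
  · obtain ⟨rfl, rfl⟩ := add_mul_rootNeg_injective hd e₁
    have : n' = n := by omega
    exact ⟨α, h₁, this ▸ e₃, e₄⟩

theorem charZero : CharZero O := ⟨fun a b hab => by
  have := congrArg φ hab
  simpa using this⟩

theorem conj_intCast (n : ℤ) : h.conj n = n := map_intCast _ _

theorem exists_norm (α : O) : ∃ n : ℕ, α * h.conj α = n ∧ (n = 0 → α = 0) := by
  obtain ⟨a, b, n, h₁, h₂, h₃, h₄⟩ := h.exists_coords α
  have hn : 0 ≤ n := by nlinarith [sq_nonneg a, mul_nonneg (Nat.cast_nonneg (α := ℤ) d) (sq_nonneg b)]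
  lift n to ℕ using hn
  refine ⟨n, by exact_mod_cast h₃, ?_⟩
  rintro rfl
  have := congrArg φ h₃
  simp only [map_mul, map_conj, Complex.mul_conj] at this
  apply h.inj
  simpa using this

theorem intCast_dvd {m n : ℤ} (hmn : (m : O) ∣ n) : m ∣ n := by
  obtain ⟨β, hβ⟩ := hmn
  obtain ⟨k, hk, -⟩ := h.exists_norm β
  have e := congrArg h.conj hβ
  rw [map_mul, conj_intCast, conj_intCast] at e
  have : ((n ^ 2 : ℤ) : O) = (m ^ 2 * k : ℤ) := by
    push_cast
    rw [← hk, sq]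
    nth_rewrite 1 [hβ]
    rw [e]
    ring
  have := h.charZero
  rw [Int.cast_inj] at *
  exact (Int.pow_dvd_pow_iff two_ne_zero).1 ⟨k, by assumption⟩

theorem natCast_dvd {m n : ℕ} (hmn : (m : O) ∣ n) : m ∣ n := by
  have := h.intCast_dvd (m := m) (n := n) (by exact_mod_cast hmn)
  exact_mod_cast this

/-- The quotient α/n has integral trace and norm, and squarefreeness of `d` makes its second
coordinate a half-integer as well. -/
theorem dvd_of_trace_norm (hd : Squarefree d) {α : O} {t m : ℤ} {n : ℕ} (hn : n ≠ 0)
    (ht : α + h.conj α = (n * t : ℤ)) (hm : α * h.conj α = (n ^ 2 * m : ℤ)) : (n : O) ∣ α := by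
  obtain ⟨a, b, k, h₁, h₂, h₃, h₄⟩ := h.exists_coords α
  have := h.charZero
  rw [h₄, Int.cast_inj] at ht
  rw [h₃, Int.cast_inj] at hm
  subst ht hm
  obtain ⟨b', rfl⟩ := dvd_of_sq_dvd_squarefree_mul hd (n := n) (b := b)
    ⟨4 * m - t ^ 2, by linear_combination h₂⟩
  have hn' : (n : ℤ) ^ 2 ≠ 0 := by positivity
  obtain ⟨β, hβ, -⟩ := h.exists_of_coords (a := t) (b := b') (n := m)
    (mul_left_cancel₀ hn' (by linear_combination h₂))
  refine ⟨β, h.inj ?_⟩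
  rw [map_mul, map_natCast]
  push_cast at h₁
  linear_combination h₁ / 2 - n * hβ / 2

/-- The product of an ideal and its conjugate is generated by a positive integer. -/
theorem exists_mul_map_conj (hd : Squarefree d) {I : Ideal O} (hI : I ≠ ⊥) :
    ∃ n : ℕ, n ≠ 0 ∧ I * I.map h.conj = Ideal.span {(n : O)} := by
  -- The positive generator g of this contraction works. A product xȳ has trace in gℤ, and its norm
  -- is the product of the norms of x and y, hence in g²ℤ, so g divides it.
  let J : Ideal ℤ := (I * I.map h.conj).comap (Int.castRingHom O)
  obtain ⟨g, hg⟩ : ∃ g, J = Ideal.span {g} := (IsPrincipalIdealRing.principal J).principal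
  have mem (k : ℤ) : (k : O) ∈ I * I.map h.conj ↔ (g.natAbs : ℤ) ∣ k := by
    rw [Int.natAbs_dvd, ← Ideal.mem_span_singleton, ← hg]
    rfl
  have hmul (x y : O) (hx : x ∈ I) (hy : y ∈ I) : x * h.conj y ∈ I * I.map h.conj :=
    Ideal.mul_mem_mul hx (Ideal.mem_map_of_mem _ hy)
  obtain ⟨x, hx, hx0⟩ := Submodule.exists_mem_ne_zero_of_ne_bot hI
  have hg0 : g.natAbs ≠ 0 := by
    intro h0
    obtain ⟨n, hn, hn'⟩ := h.exists_norm x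
    have := (mem n).1 (by simpa [hn] using hmul x x hx hx)
    rw [h0] at this
    simp at this
    exact hx0 (hn' this)
  refine ⟨g.natAbs, hg0, le_antisymm ?_ ?_⟩
  · rw [Ideal.map, Ideal.mul_le]
    intro x hx y hy
    have : h.conj '' (I : Set O) ⊆ (Ideal.span {((g.natAbs : ℕ) : O)}).colon {x} := by
      rintro _ ⟨y, hy, rfl⟩
      rw [SetLike.mem_coe, Submodule.mem_colon_singleton, smul_eq_mul, mul_comm,
        Ideal.mem_span_singleton]
      obtain ⟨t, _, k, -, -, hk, ht⟩ := h.exists_coords (x * h.conj y)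
      obtain ⟨n₁, h₁, -⟩ := h.exists_norm x
      obtain ⟨n₂, h₂, -⟩ := h.exists_norm y
      obtain ⟨t', rfl⟩ := (mem t).1 (by
        rw [← ht, map_mul, conj_conj]
        exact add_mem (hmul x y hx hy) (by rw [mul_comm (h.conj x)]; exact hmul y x hy hx))
      obtain ⟨m₁, hm₁⟩ := (mem n₁).1 (by simpa [h₁] using hmul x x hx hx)
      obtain ⟨m₂, hm₂⟩ := (mem n₂).1 (by simpa [h₂] using hmul y y hy hy)
      refine h.dvd_of_trace_norm hd hg0 ht (m := m₁ * m₂) ?_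
      rw [map_mul, conj_conj]
      have e₁ := congrArg (Int.cast : ℤ → O) hm₁
      have e₂ := congrArg (Int.cast : ℤ → O) hm₂
      push_cast at e₁ e₂ ⊢
      have e : x * h.conj y * (h.conj x * y) = (x * h.conj x) * (y * h.conj y) := by ring
      rw [e, h₁, h₂]
      rw [e₁, e₂]
      ring
    have := Ideal.span_le.2 this hy
    rwa [Submodule.mem_colon_singleton, smul_eq_mul, mul_comm] at this
  · rw [Ideal.span_singleton_le_iff_mem]
    have := (mem g.natAbs).2 dvd_rfl
    rwa [Int.cast_natCast] at this

end IsImagQuad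

/-! ### Squares of order two in the class group and conics -/

open scoped nonZeroDivisors

theorem even_card_range_sq_iff {C : Type*} [CommGroup C] [Finite C] :
    Even (Nat.card (powMonoidHom 2 : C →* C).range) ↔ ∃ x : C, x ^ 2 ≠ 1 ∧ (x ^ 2) ^ 2 = 1 := by
  constructor
  · intro hE
    have : Fact (Nat.Prime 2) := ⟨Nat.prime_two⟩
    obtain ⟨⟨_, x, rfl⟩, hy⟩ := exists_prime_orderOf_dvd_card' 2 (even_iff_two_dvd.1 hE)
    have h := orderOf_eq_prime_iff.1 hy
    refine ⟨x, fun hx => h.2 (Subtype.ext hx), ?_⟩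
    simpa [Subtype.ext_iff] using h.1
  · rintro ⟨x, h₁, h₂⟩
    let y : (powMonoidHom 2 : C →* C).range := ⟨x ^ 2, x, rfl⟩
    have : orderOf y = 2 := orderOf_eq_prime (Subtype.ext h₂) (fun h => h₁ (congrArg Subtype.val h))
    have h := orderOf_dvd_natCard y
    rw [this] at h
    exact even_iff_two_dvd.2 h

namespace IsImagQuad

variable {d : ℕ} {O : Type*} [CommRing O] [IsDedekindDomain O] {φ : O →+* ℂ} (h : IsImagQuad d φ)

include h

theorem natCast_ne_zero {n : ℕ} (hn : n ≠ 0) : (n : O) ≠ 0 := by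
  have := h.charZero
  exact_mod_cast hn

theorem eq_of_span_natCast_eq {m n : ℕ} (e : Ideal.span {(m : O)} = Ideal.span {(n : O)}) :
    m = n := by
  rw [Ideal.span_singleton_eq_span_singleton] at e
  exact Nat.dvd_antisymm (h.natCast_dvd e.dvd) (h.natCast_dvd e.symm.dvd)

/-- The ideal classes that are squares of order two come from solutions of a conic. -/
theorem exists_conic_of_sq (hd : Squarefree d) {x : ClassGroup O} (h₁ : x ^ 2 ≠ 1)
    (h₂ : (x ^ 2) ^ 2 = 1) : ∃ (m : ℕ) (M : Ideal O), Squarefree m ∧ M ^ 2 = Ideal.span {(m : O)} ∧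
      ¬ M.IsPrincipal ∧ ∃ x y z : ℤ, z ≠ 0 ∧ x ^ 2 + d * y ^ 2 = m * z ^ 2 := by
  obtain ⟨⟨I, hI⟩, rfl⟩ := ClassGroup.mk0_surjective x
  have hI0 : I ≠ ⊥ := nonZeroDivisors.ne_zero hI
  obtain ⟨k, hk, hIk⟩ := h.exists_mul_map_conj hd hI0
  rw [← map_pow, ne_eq, SubmonoidClass.mk_pow, ClassGroup.mk0_eq_one_iff] at h₁
  rw [← map_pow, ← map_pow, SubmonoidClass.mk_pow, SubmonoidClass.mk_pow,
    ClassGroup.mk0_eq_one_iff] at h₂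
  obtain ⟨α, hα⟩ := h₂.principal
  rw [Ideal.submodule_span_eq] at hα
  obtain ⟨n, hn, -⟩ := h.exists_norm α
  have hn' : n = (k ^ 2) ^ 2 := by
    apply h.eq_of_span_natCast_eq
    rw [← hn, ← Ideal.span_singleton_mul_span_singleton, ← hα]
    have : Ideal.span {h.conj α} = (((I.map h.conj) ^ 2) ^ 2) := by
      rw [← Ideal.map_pow, ← Ideal.map_pow, hα, Ideal.map_span, Set.image_singleton]
    rw [this, ← mul_pow, ← mul_pow, hIk, Ideal.span_singleton_pow, Ideal.span_singleton_pow]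
    push_cast
    rfl
  -- Hilbert 90 made explicit: `α` has norm k⁴, so β = α + k² satisfies αβ̄ = k²β, and J = I²(β̄)
  -- has J² = (k²ββ̄). If α = -k², then I² itself serves.
  obtain ⟨J, β, hJ, hβ, hJβ⟩ : ∃ (J : Ideal O) (β : O), ¬ J.IsPrincipal ∧ β ≠ 0 ∧
      J ^ 2 = Ideal.span {(k : O) ^ 2 * (β * h.conj β)} := by
    by_cases h0 : α + (k : O) ^ 2 = 0
    · refine ⟨I ^ 2, 1, h₁, one_ne_zero, ?_⟩
      rw [hα, map_one, mul_one, mul_one, eq_neg_of_add_eq_zero_left h0, Ideal.span_singleton_neg]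
    · refine ⟨I ^ 2 * Ideal.span {h.conj (α + (k : O) ^ 2)}, α + (k : O) ^ 2, ?_, h0, ?_⟩
      · have hc : h.conj (α + (k : O) ^ 2) ≠ 0 := fun e => h0 (by
          have := congrArg h.conj e
          rwa [conj_conj, map_zero] at this)
        rintro ⟨γ, hγ⟩
        rw [Ideal.submodule_span_eq] at hγ
        have hdvd : γ ∈ I ^ 2 * Ideal.span {h.conj (α + (k : O) ^ 2)} := by
          rw [hγ]
          exact Ideal.mem_span_singleton_self γ
        obtain ⟨δ, -, rfl⟩ := Ideal.mem_mul_span_singleton.1 hdvd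
        rw [← Ideal.span_singleton_mul_span_singleton] at hγ
        have := mul_right_cancel₀ (by simpa using hc) hγ
        exact h₁ ⟨δ, this⟩
      · rw [mul_pow, hα, Ideal.span_singleton_pow, Ideal.span_singleton_mul_span_singleton]
        congr 2
        have e : α * h.conj α = ((k : O) ^ 2) ^ 2 := by rw [hn, hn']; push_cast; rfl
        rw [map_add, map_pow, map_natCast]
        linear_combination (h.conj α + (k : O) ^ 2) * e
  obtain ⟨a, b, c, -, hab, hc, -⟩ := h.exists_coords β
  obtain ⟨c', hc', hc0⟩ := h.exists_norm β
  have := h.charZero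
  have hcc : c = c' := by exact_mod_cast hc.symm.trans hc'
  have hc'0 : c' ≠ 0 := fun e => hβ (hc0 e)
  obtain ⟨m, e, he, hm⟩ := Nat.sq_mul_squarefree (k ^ 2 * c')
  have he0 : e ≠ 0 := by
    rintro rfl
    simp [hk, hc'0] at he
  have hJm : J ^ 2 = Ideal.span {(e : O)} ^ 2 * Ideal.span {(m : O)} := by
    rw [hJβ, hc', Ideal.span_singleton_pow, Ideal.span_singleton_mul_span_singleton]
    congr 2
    exact_mod_cast he.symm
  have hdvd : Ideal.span {(e : O)} ∣ J :=
    (UniqueFactorizationMonoid.pow_dvd_pow_iff_dvd two_ne_zero).1 ⟨_, hJm⟩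
  obtain ⟨M, rfl⟩ := hdvd
  have he0' : Ideal.span {(e : O)} ≠ 0 := by simpa using h.natCast_ne_zero he0
  -- Four times the norm of `β` is a² + db², and k² times that norm is e²m.
  refine ⟨m, M, hm, ?_, ?_, k * a, k * b, 2 * e, ?_, ?_⟩
  · rw [mul_pow] at hJm
    exact mul_left_cancel₀ (pow_ne_zero 2 he0') hJm
  · rintro ⟨γ, rfl⟩
    exact hJ ⟨e * γ, by simp [Ideal.span_singleton_mul_span_singleton]⟩
  · simpa using he0
  · have he' : ((e : ℤ) ^ 2 * m) = k ^ 2 * c := by rw [hcc]; exact_mod_cast he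
    linear_combination (k : ℤ) ^ 2 * hab - 4 * he'

/-- A solution gives β of norm mz². The ideal B = zM + (β) satisfies βB̄ = zMB, so the class of M is
the square of the inverse class of B. -/
theorem exists_sq_of_conic (hd : Squarefree d) {m : ℕ} {M : Ideal O} (hm : m ≠ 0)
    (hM : M ^ 2 = Ideal.span {(m : O)}) (hM' : ¬ M.IsPrincipal) {x y z : ℤ} (hz : z ≠ 0)
    (he : x ^ 2 + d * y ^ 2 = m * z ^ 2) :
    ∃ c : ClassGroup O, c ^ 2 ≠ 1 ∧ (c ^ 2) ^ 2 = 1 := by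
  have := h.charZero
  obtain ⟨β, -, hβ, -⟩ := h.exists_of_coords (a := 2 * x) (b := 2 * y) (n := m * z ^ 2)
    (by linear_combination 4 * he)
  have hm0 : (m : O) ≠ 0 := h.natCast_ne_zero hm
  have hz0 : (z : O) ≠ 0 := by exact_mod_cast hz
  have hM0 : M ≠ 0 := by
    rintro rfl
    exact hM' bot_isPrincipal
  have hβ0 : β ≠ 0 := by
    rintro rfl
    push_cast at hβ
    rw [zero_mul] at hβ
    exact mul_ne_zero hm0 (pow_ne_zero 2 hz0) hβ.symm
  have hMc : M.map h.conj = M := by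
    have e : (M.map h.conj) ^ 2 = M ^ 2 := by
      rw [← Ideal.map_pow, hM, Ideal.map_span, Set.image_singleton, map_natCast]
    refine le_antisymm ?_ ?_
    · exact Ideal.dvd_iff_le.1 ((UniqueFactorizationMonoid.pow_dvd_pow_iff_dvd two_ne_zero).1
        (dvd_of_eq e.symm))
    · exact Ideal.dvd_iff_le.1 ((UniqueFactorizationMonoid.pow_dvd_pow_iff_dvd two_ne_zero).1
        (dvd_of_eq e))
  let B : Ideal O := M * Ideal.span {(z : O)} + Ideal.span {β}
  have hB0 : B ≠ ⊥ := by
    intro hB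
    have : β ∈ B := Ideal.mem_sup_right (Ideal.mem_span_singleton_self β)
    rw [hB] at this
    exact hβ0 (by simpa using this)
  have hBc : B.map h.conj = M * Ideal.span {(z : O)} + Ideal.span {h.conj β} := by
    change Ideal.map h.conj (_ ⊔ _) = _
    rw [Ideal.map_sup, Ideal.map_mul, hMc, Ideal.map_span, Ideal.map_span, Set.image_singleton,
      Set.image_singleton, conj_intCast]
    rfl
  have key : Ideal.span {β} * B.map h.conj = Ideal.span {(z : O)} * (M * B) := by
    have e : Ideal.span {β} * Ideal.span {h.conj β} = M ^ 2 * Ideal.span {(z : O)} ^ 2 := by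
      rw [hM, Ideal.span_singleton_pow, Ideal.span_singleton_mul_span_singleton,
        Ideal.span_singleton_mul_span_singleton, hβ]
      push_cast
      rfl
    rw [hBc, mul_add, e]
    ring
  obtain ⟨k, hk, hBk⟩ := h.exists_mul_map_conj hd hB0
  have hBc0 : B.map h.conj ≠ ⊥ := by
    intro e
    rw [e, Ideal.mul_bot, eq_comm, Ideal.span_singleton_eq_bot] at hBk
    exact h.natCast_ne_zero hk hBk
  let b : (Ideal O)⁰ := ⟨B, mem_nonZeroDivisors_of_ne_zero hB0⟩
  let b' : (Ideal O)⁰ := ⟨B.map h.conj, mem_nonZeroDivisors_of_ne_zero hBc0⟩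
  let m' : (Ideal O)⁰ := ⟨M, mem_nonZeroDivisors_of_ne_zero hM0⟩
  have h₁ : ClassGroup.mk0 b' = ClassGroup.mk0 m' * ClassGroup.mk0 b := by
    rw [← map_mul, ClassGroup.mk0_eq_mk0_iff]
    exact ⟨β, z, hβ0, hz0, key⟩
  have h₂ : ClassGroup.mk0 b' = (ClassGroup.mk0 b)⁻¹ := by
    rw [ClassGroup.mk0_eq_mk0_inv_iff]
    exact ⟨k, h.natCast_ne_zero hk, by rw [mul_comm]; exact hBk⟩
  have h₃ : ((ClassGroup.mk0 b)⁻¹) ^ 2 = ClassGroup.mk0 m' := by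
    rw [sq]
    nth_rewrite 1 [← h₂]
    rw [h₁, mul_inv_cancel_right]
  refine ⟨(ClassGroup.mk0 b)⁻¹, ?_, ?_⟩
  · rw [h₃, ne_eq, ClassGroup.mk0_eq_one_iff]
    exact hM'
  · rw [h₃, ← map_pow, SubmonoidClass.mk_pow, ClassGroup.mk0_eq_one_iff]
    exact ⟨m, hM⟩

theorem even_card_iff_conic [Finite (ClassGroup O)] (hd : Squarefree d) :
    Even (Nat.card (powMonoidHom 2 : ClassGroup O →* ClassGroup O).range) ↔
      ∃ (m : ℕ) (M : Ideal O), Squarefree m ∧ M ^ 2 = Ideal.span {(m : O)} ∧ ¬ M.IsPrincipal ∧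
        ∃ x y z : ℤ, z ≠ 0 ∧ x ^ 2 + d * y ^ 2 = m * z ^ 2 := by
  rw [even_card_range_sq_iff]
  constructor
  · rintro ⟨x, h₁, h₂⟩
    exact h.exists_conic_of_sq hd h₁ h₂
  · rintro ⟨m, M, hm, hM, hM', x, y, z, hz, he⟩
    exact h.exists_sq_of_conic hd hm.ne_zero hM hM' hz he

end IsImagQuad

/-! ### Ideals whose square is generated by an integer -/

theorem dvd_of_squarefree_of_primes {m d : ℕ} (hm : Squarefree m) (hd : d ≠ 0)
    (hp : ∀ p, p.Prime → p ∣ m → p ∣ d) : m ∣ d := by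
  rw [← Nat.prod_primeFactors_of_squarefree hm]
  refine (Finset.prod_dvd_prod_of_subset _ d.primeFactors _ fun p hpm => ?_).trans
    (Nat.prod_primeFactors_dvd d)
  have := Nat.mem_primeFactors.1 hpm
  exact Nat.mem_primeFactors.2 ⟨this.1, hp p this.1 this.2.1, hd⟩

theorem dvd_of_squarefree_of_dvd_sq {m : ℕ} (hm : Squarefree m) {a : ℤ} (h : (m : ℤ) ∣ a ^ 2) :
    (m : ℤ) ∣ a :=
  ((Int.squarefree_natCast.2 hm).dvd_pow_iff_dvd two_ne_zero).1 h

namespace IsImagQuad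

variable {d : ℕ} {O : Type*} [CommRing O] {φ : O →+* ℂ} (h : IsImagQuad d φ)

include h

theorem exists_root : ∃ δ : O, δ * δ = -(d : O) ∧ h.conj δ = -δ := by
  obtain ⟨δ, h₁, h₂, h₃⟩ := h.exists_of_coords (a := 0) (b := 2) (n := d) (by ring)
  have h₃' : h.conj δ = -δ := by
    rw [Int.cast_zero] at h₃
    exact eq_neg_of_add_eq_zero_right h₃
  refine ⟨δ, ?_, h₃'⟩
  rw [h₃'] at h₂
  push_cast at h₂
  linear_combination -h₂

/-- The ideal (m, √-d) works: its square contains m² and -d, whose gcd is m because m and d/m are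
coprime. -/
theorem exists_ideal_of_dvd (hd : Squarefree d) {m : ℕ} (hm : m ∣ d) :
    ∃ M : Ideal O, M ^ 2 = Ideal.span {(m : O)} := by
  obtain ⟨δ, hδ, -⟩ := h.exists_root
  obtain ⟨m', rfl⟩ := hm
  have hc := Nat.isCoprime_iff_coprime.2 (Nat.coprime_of_squarefree_mul hd)
  obtain ⟨u, v, huv⟩ := hc
  have huv' := congrArg (Int.cast : ℤ → O) huv
  push_cast at huv' hδ
  refine ⟨Ideal.span {(m : O), δ}, le_antisymm ?_ ?_⟩
  · rw [sq, Ideal.mul_le]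
    intro x hx y hy
    obtain ⟨a, b, rfl⟩ := Ideal.mem_span_pair.1 hx
    obtain ⟨a', b', rfl⟩ := Ideal.mem_span_pair.1 hy
    rw [Ideal.mem_span_singleton]
    exact ⟨a * a' * m + a * b' * δ + b * a' * δ - b * b' * m', by linear_combination b * b' * hδ⟩
  · rw [Ideal.span_singleton_le_iff_mem, sq]
    have h₁ : (m : O) ∈ Ideal.span {(m : O), δ} := Ideal.subset_span (by simp)
    have h₂ : δ ∈ Ideal.span {(m : O), δ} := Ideal.subset_span (by simp)
    have : (m : O) = u * (m * m) + -v * (δ * δ) := by linear_combination v * hδ - m * huv'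
    have key := add_mem (Ideal.mul_mem_left _ (u : O) (Ideal.mul_mem_mul h₁ h₁))
      (Ideal.mul_mem_left _ (-v : O) (Ideal.mul_mem_mul h₂ h₂))
    rw [← this] at key
    exact key

theorem exists_ideal_two (hd : d % 4 = 1) : ∃ M : Ideal O, M ^ 2 = Ideal.span {(2 : O)} := by
  obtain ⟨δ, hδ, -⟩ := h.exists_root
  obtain ⟨f, rfl⟩ : ∃ f, d = 4 * f + 1 := ⟨d / 4, by omega⟩
  push_cast at hδ
  refine ⟨Ideal.span {(2 : O), 1 + δ}, le_antisymm ?_ ?_⟩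
  · rw [sq, Ideal.mul_le]
    intro x hx y hy
    obtain ⟨a, b, rfl⟩ := Ideal.mem_span_pair.1 hx
    obtain ⟨a', b', rfl⟩ := Ideal.mem_span_pair.1 hy
    rw [Ideal.mem_span_singleton]
    exact ⟨a * a' * 2 + (a * b' + b * a') * (1 + δ) + b * b' * (δ - 2 * f), by
      linear_combination b * b' * hδ⟩
  · rw [Ideal.span_singleton_le_iff_mem, sq]
    have h₁ : (2 : O) ∈ Ideal.span {(2 : O), 1 + δ} := Ideal.subset_span (by simp)
    have h₂ : 1 + δ ∈ Ideal.span {(2 : O), 1 + δ} := Ideal.subset_span (by simp)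
    have : (2 : O) = -f * (2 * 2) + (2 * (1 + δ)) + -1 * ((1 + δ) * (1 + δ)) := by
      linear_combination hδ
    have key := add_mem (add_mem (Ideal.mul_mem_left _ (-f : O) (Ideal.mul_mem_mul h₁ h₁))
      (Ideal.mul_mem_mul h₁ h₂)) (Ideal.mul_mem_left _ (-1 : O) (Ideal.mul_mem_mul h₂ h₂))
    rw [← this] at key
    exact key

/-- `pO` is a radical ideal if `p` is unramified. -/
theorem natCast_dvd_of_dvd_sq (hd : Squarefree d) {p : ℕ} (hp : p.Prime) (hpd : ¬ p ∣ d)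
    (h2 : p = 2 → d % 4 ≠ 1) {α : O} (hα : (p : O) ∣ α ^ 2) : (p : O) ∣ α := by
  obtain ⟨t, b, n, -, hn, hN, hT⟩ := h.exists_coords α
  have hp' : Prime (p : ℤ) := Nat.prime_iff_prime_int.1 hp
  have hpn : (p : ℤ) ∣ n := by
    have : (p : ℤ) ∣ n ^ 2 := by
      apply h.intCast_dvd
      push_cast
      rw [← hN, mul_pow]
      exact hα.mul_right _
    exact hp'.dvd_of_dvd_pow this
  -- From α² - tα + n = 0. If `p` does not divide the trace `t`, then `t` is invertible modulo `p`.
  have htα : (p : O) ∣ t * α := by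
    have e : (t : O) * α = α ^ 2 + n := by rw [← hT, ← hN]; ring
    rw [e]
    refine dvd_add hα ?_
    have := (Int.castRingHom O).map_dvd hpn
    simpa using this
  by_cases hpt : (p : ℤ) ∣ t
  · obtain ⟨t', rfl⟩ := hpt
    have hp2 : (p : ℤ) ^ 2 ∣ n := by
      rcases hp.eq_two_or_odd' with rfl | hodd
      · have hd2 := h2 rfl
        have hd3 : (d : ℤ) % 4 = 3 := by omega
        obtain ⟨n', rfl⟩ := hpn
        push_cast at hn ⊢
        obtain ⟨b', rfl⟩ : (2 : ℤ) ∣ b := by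
          have : (2 : ℤ) ∣ d * b ^ 2 := ⟨4 * n' - 2 * t' ^ 2, by linear_combination hn⟩
          rcases Int.prime_two.dvd_or_dvd this with h | h
          · omega
          · exact Int.prime_two.dvd_of_dvd_pow h
        have e : t' ^ 2 + d * b' ^ 2 = 2 * n' := by linarith
        obtain ⟨f, hf⟩ : ∃ f : ℤ, (d : ℤ) = 4 * f + 3 := ⟨d / 4, by omega⟩
        rw [hf] at e
        have e₂ : 2 * n' = 4 * (f * b' ^ 2) + t' ^ 2 + 3 * b' ^ 2 := by linarith
        rcases Int.even_or_odd' t' with ⟨x, rfl | rfl⟩ <;>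
          rcases Int.even_or_odd' b' with ⟨y, rfl | rfl⟩ <;> ring_nf at e₂ ⊢ <;> omega
      · have hpb : (p : ℤ) ∣ b := by
          have : (p : ℤ) ∣ d * b ^ 2 := by
            have : (d : ℤ) * b ^ 2 = 4 * n - p * (p * t' ^ 2) := by linear_combination hn
            rw [this]
            exact dvd_sub (hpn.mul_left _) (dvd_mul_right _ _)
          rcases hp'.dvd_or_dvd this with h | h
          · exact absurd (by exact_mod_cast h) hpd
          · exact hp'.dvd_of_dvd_pow h
        obtain ⟨b', rfl⟩ := hpb
        have hc : IsCoprime ((p : ℤ) ^ 2) (4 : ℤ) := by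
          have : Nat.Coprime (p ^ 2) 4 := by
            have := (Nat.coprime_two_right.2 hodd).pow 2 2
            simpa using this
          exact_mod_cast Nat.isCoprime_iff_coprime.2 this
        exact hc.dvd_of_dvd_mul_left ⟨t' ^ 2 + d * b' ^ 2, by linear_combination -hn⟩
    obtain ⟨m, rfl⟩ := hp2
    exact h.dvd_of_trace_norm hd hp.ne_zero hT hN
  · obtain ⟨u, v, huv⟩ := (hp'.coprime_iff_not_dvd).2 hpt
    have huv' := congrArg (Int.cast : ℤ → O) huv
    push_cast at huv'
    have e : α = p * (u * α) + v * (t * α) := by linear_combination -α * huv'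
    rw [e]
    exact dvd_add (dvd_mul_right _ _) (htα.mul_left _)

variable [IsDedekindDomain O]

theorem prime_dvd_of_ideal_sq (hd : Squarefree d) {m : ℕ} (hm : Squarefree m) {M : Ideal O}
    (hM : M ^ 2 = Ideal.span {(m : O)}) {p : ℕ} (hp : p.Prime) (hpm : p ∣ m) :
    p ∣ d ∨ (p = 2 ∧ d % 4 = 1) := by
  by_contra! hc
  have hle : M ≤ Ideal.span {(p : O)} := by
    intro α hα
    rw [Ideal.mem_span_singleton]
    refine h.natCast_dvd_of_dvd_sq hd hp hc.1 hc.2 ?_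
    have : α ^ 2 ∈ M ^ 2 := Ideal.pow_mem_pow hα 2
    rw [hM, Ideal.mem_span_singleton] at this
    refine dvd_trans ?_ this
    exact_mod_cast (Nat.cast_dvd_cast hpm : ((p : ℕ) : O) ∣ m)
  have := pow_dvd_pow_of_dvd (Ideal.dvd_iff_le.2 hle) 2
  rw [hM, Ideal.span_singleton_pow, Ideal.dvd_iff_le,
    Ideal.span_singleton_le_span_singleton] at this
  have := h.natCast_dvd (m := p ^ 2) (n := m) (by exact_mod_cast this)
  rw [sq] at this
  exact hp.one_lt.ne' (Nat.isUnit_iff.1 (hm p this))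

/-- A generator has norm m and trace ma', so m²a'² + db² = 4m. If a' = 0 this forces m = d;
otherwise m ≤ 4, and the few cases are checked. The exclusion of d = 1 is needed because of (1 + i)²
= 2i. -/
theorem eq_one_or_eq_of_isPrincipal (hd : Squarefree d) (hd1 : d ≠ 1) {m : ℕ} (hm : Squarefree m)
    {M : Ideal O} (hM : M ^ 2 = Ideal.span {(m : O)}) (hP : M.IsPrincipal) : m = 1 ∨ m = d := by
  obtain ⟨γ, rfl⟩ := hP
  rw [Ideal.submodule_span_eq, Ideal.span_singleton_pow] at hM
  obtain ⟨n, hn, -⟩ := h.exists_norm γ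
  obtain ⟨a, b, c, -, hab, hc, ha⟩ := h.exists_coords γ
  have := h.charZero
  have hnm : n = m := by
    have e : Ideal.span {((n ^ 2 : ℕ) : O)} = Ideal.span {((m ^ 2 : ℕ) : O)} := by
      have e₁ := congrArg (Ideal.map h.conj) hM
      rw [Ideal.map_span, Ideal.map_span, Set.image_singleton, Set.image_singleton, map_pow,
        map_natCast] at e₁
      push_cast
      rw [← hn, mul_pow, ← Ideal.span_singleton_mul_span_singleton, e₁, hM,
        Ideal.span_singleton_mul_span_singleton, sq]
    exact Nat.pow_left_injective two_ne_zero (h.eq_of_span_natCast_eq e)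
  have hcm : c = m := by rw [← hnm]; exact_mod_cast hc.symm.trans hn
  rw [hcm] at hc hab
  have hm0 : m ≠ 0 := hm.ne_zero
  have hma : (m : ℤ) ∣ a := by
    apply dvd_of_squarefree_of_dvd_sq hm
    have h₁ : (m : O) ∣ a * γ := by
      have e : (a : O) * γ = γ ^ 2 + m := by
        rw [← ha]
        push_cast at hc
        rw [← hc]
        ring
      rw [e]
      refine dvd_add ?_ dvd_rfl
      rw [← Ideal.mem_span_singleton, ← hM]
      exact Ideal.mem_span_singleton_self _
    have h₂ : (m : O) ∣ a * h.conj γ := by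
      have := map_dvd h.conj h₁
      rwa [map_mul, conj_intCast, map_natCast] at this
    have h₃ : ((m * m : ℤ) : O) ∣ (a ^ 2 * m : ℤ) := by
      have := mul_dvd_mul h₁ h₂
      push_cast at hc ⊢
      convert this using 1
      rw [← hc]
      ring
    have := h.intCast_dvd h₃
    exact Int.dvd_of_mul_dvd_mul_right (by exact_mod_cast hm0) this
  obtain ⟨a', rfl⟩ := hma
  have hmz : (m : ℤ) ≠ 0 := by exact_mod_cast hm0
  have hmpos : (0 : ℤ) < m := by positivity
  by_cases ha0 : a' = 0
  · right
    subst ha0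
    have e : (d : ℤ) * b ^ 2 = 4 * m := by linear_combination hab
    obtain ⟨b', rfl⟩ := dvd_of_sq_dvd_squarefree_mul hd (n := 2) (b := b) ⟨m, by rw [e]; ring⟩
    have e' : (d : ℤ) * b' ^ 2 = m := by linarith
    have hb : (m : ℤ) = d * (b'.natAbs : ℤ) ^ 2 := by rw [Int.natCast_natAbs, sq_abs, e']
    have hb' : m = d * b'.natAbs ^ 2 := by exact_mod_cast hb
    have := Nat.isUnit_iff.1 (hm b'.natAbs ⟨d, by rw [hb']; ring⟩)
    rw [hb', this]
    simp
  · have ha1 : 1 ≤ a' ^ 2 := by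
      have : 0 < a' ^ 2 := by positivity
      linarith
    have hle : (m : ℤ) * a' ^ 2 ≤ 4 := by
      have : (m : ℤ) * (m * a' ^ 2) ≤ m * 4 := by nlinarith [mul_nonneg (Nat.cast_nonneg (α := ℤ) d) (sq_nonneg b)]
      exact le_of_mul_le_mul_left this hmpos
    have hm4 : m ≤ 4 := by
      have : (m : ℤ) ≤ 4 := by nlinarith
      exact_mod_cast this
    have hd0 := hd.ne_zero
    have hd4 : d ≠ 4 := by rintro rfl; exact absurd hd (by decide)
    interval_cases m
    · simp at hmz
    · exact Or.inl rfl
    · exfalso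
      have ha2 : a' ^ 2 = 1 := by
        have : a' ^ 2 ≤ 2 := by push_cast at hle; linarith
        have h₁ : a' ≤ 1 := by nlinarith
        have h₂ : -1 ≤ a' := by nlinarith
        interval_cases a' <;> simp_all
      have e : (d : ℤ) * b ^ 2 = 4 := by push_cast at hab; linear_combination hab - 4 * ha2
      have hdd : d ∣ 4 := by exact_mod_cast Dvd.intro _ e
      have hd2 : d = 2 := by
        have := Nat.le_of_dvd (by norm_num) hdd
        interval_cases d <;> simp_all
      subst hd2
      have : b ^ 2 = 2 := by push_cast at e; linarith
      have h₁ : b ≤ 1 := by nlinarith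
      have h₂ : -1 ≤ b := by nlinarith
      interval_cases b <;> simp_all
    · right
      have ha2 : a' ^ 2 = 1 := by
        have : a' ^ 2 ≤ 1 := by push_cast at hle; linarith
        linarith
      have e : (d : ℤ) * b ^ 2 = 3 := by push_cast at hab; linear_combination hab - 9 * ha2
      have hdd : d ∣ 3 := by exact_mod_cast Dvd.intro _ e
      rcases (Nat.dvd_prime Nat.prime_three).1 hdd with h | h
      · exact absurd h hd1
      · exact h.symm
    · exact absurd hm (by decide)

theorem isPrincipal_of_eq_one_or_eq {m : ℕ} (hm : m = 1 ∨ m = d) {M : Ideal O}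
    (hM : M ^ 2 = Ideal.span {(m : O)}) : M.IsPrincipal := by
  obtain ⟨δ, hδ, -⟩ := h.exists_root
  have key (γ : O) (e : Ideal.span {γ} ^ 2 = Ideal.span {(m : O)}) : M.IsPrincipal := by
    have e' : M ^ 2 = Ideal.span {γ} ^ 2 := hM.trans e.symm
    refine ⟨γ, le_antisymm ?_ ?_⟩
    · exact Ideal.dvd_iff_le.1 ((UniqueFactorizationMonoid.pow_dvd_pow_iff_dvd two_ne_zero).1
        (dvd_of_eq e'.symm))
    · exact Ideal.dvd_iff_le.1 ((UniqueFactorizationMonoid.pow_dvd_pow_iff_dvd two_ne_zero).1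
        (dvd_of_eq e'))
  rcases hm with rfl | rfl
  · exact key 1 (by simp)
  · exact key δ (by rw [Ideal.span_singleton_pow, sq, hδ, Ideal.span_singleton_neg])

theorem even_card_iff [Finite (ClassGroup O)] (hd : Squarefree d) (hd1 : d ≠ 1) :
    Even (Nat.card (powMonoidHom 2 : ClassGroup O →* ClassGroup O).range) ↔
      ∃ m : ℕ, Squarefree m ∧ m ≠ 1 ∧ m ≠ d ∧ (m ∣ d ∨ d % 4 = 1 ∧ ∃ m', m = 2 * m' ∧ m' ∣ d) ∧
        ∃ x y z : ℤ, z ≠ 0 ∧ x ^ 2 + d * y ^ 2 = m * z ^ 2 := by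
  rw [h.even_card_iff_conic hd]
  constructor
  · rintro ⟨m, M, hm, hM, hM', hc⟩
    refine ⟨m, hm, fun e => hM' (h.isPrincipal_of_eq_one_or_eq (Or.inl e) hM),
      fun e => hM' (h.isPrincipal_of_eq_one_or_eq (Or.inr e) hM), ?_, hc⟩
    have hp (p) (hp : p.Prime) (hpm : p ∣ m) := h.prime_dvd_of_ideal_sq hd hm hM hp hpm
    by_cases h2 : d % 4 = 1 ∧ 2 ∣ m
    · obtain ⟨h4, m', rfl⟩ := h2
      refine Or.inr ⟨h4, m', rfl, dvd_of_squarefree_of_primes (hm.of_mul_right) hd.ne_zero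
        fun p hpp hpm => (hp p hpp (hpm.mul_left 2)).resolve_right ?_⟩
      rintro ⟨rfl, -⟩
      exact absurd (hm 2 (mul_dvd_mul_left 2 hpm)) (by decide)
    · refine Or.inl (dvd_of_squarefree_of_primes hm hd.ne_zero fun p hpp hpm =>
        (hp p hpp hpm).resolve_right ?_)
      rintro ⟨rfl, h4⟩
      exact h2 ⟨h4, hpm⟩
  · rintro ⟨m, hm, hm1, hmd, hm', hc⟩
    obtain ⟨M, hM⟩ : ∃ M : Ideal O, M ^ 2 = Ideal.span {(m : O)} := by
      rcases hm' with hm' | ⟨h4, m', rfl, hm'⟩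
      · exact h.exists_ideal_of_dvd hd hm'
      · obtain ⟨M, hM⟩ := h.exists_ideal_of_dvd hd hm'
        obtain ⟨P, hP⟩ := h.exists_ideal_two h4
        refine ⟨P * M, ?_⟩
        rw [mul_pow, hM, hP, Ideal.span_singleton_mul_span_singleton]
        push_cast
        rfl
    refine ⟨m, M, hm, hM, fun hP => ?_, hc⟩
    rcases h.eq_one_or_eq_of_isPrincipal hd hd1 hm hM hP with e | e
    · exact hm1 e
    · exact hmd e

end IsImagQuad

/-! ### The ring of integers of ℚ(√-d) -/

theorem isIntegral_rootNeg (d : ℕ) : IsIntegral ℤ (rootNeg d) := by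
  refine ⟨Polynomial.X ^ 2 + Polynomial.C (d : ℤ), Polynomial.monic_X_pow_add_C _ two_ne_zero, ?_⟩
  rw [← Polynomial.aeval_def]
  simp [sq, rootNeg_mul_self]

theorem isAlgebraic_rootNeg (d : ℕ) : IsIntegral ℚ (rootNeg d) :=
  (isIntegral_rootNeg d).tower_top

instance (d : ℕ) : FiniteDimensional ℚ (imagQuadField d) :=
  IntermediateField.adjoin.finiteDimensional (isAlgebraic_rootNeg d)

instance (d : ℕ) : NumberField (imagQuadField d) where

theorem mem_imagQuadField (d : ℕ) (x : ℂ) :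
    x ∈ imagQuadField d ↔ ∃ p q : ℚ, x = p + q * rootNeg d := by
  constructor
  · intro hx
    have hx' : x ∈ Algebra.adjoin ℚ {rootNeg d} := by
      rw [← IntermediateField.adjoin_simple_toSubalgebra_of_isAlgebraic
        (isAlgebraic_rootNeg d).isAlgebraic]
      exact hx
    clear hx
    induction hx' using Algebra.adjoin_induction with
    | mem x hx => exact ⟨0, 1, by simpa using hx⟩
    | algebraMap r => exact ⟨r, 0, by simp⟩
    | add x y _ _ hx hy =>
      obtain ⟨p, q, rfl⟩ := hx
      obtain ⟨p', q', rfl⟩ := hy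
      exact ⟨p + p', q + q', by push_cast; ring⟩
    | mul x y _ _ hx hy =>
      obtain ⟨p, q, rfl⟩ := hx
      obtain ⟨p', q', rfl⟩ := hy
      exact ⟨p * p' - d * q * q', p * q' + q * p', by
        push_cast
        linear_combination q * q' * rootNeg_mul_self d⟩
  · rintro ⟨p, q, rfl⟩
    exact add_mem (SubfieldClass.ratCast_mem _ p) (mul_mem (SubfieldClass.ratCast_mem _ q)
      (IntermediateField.mem_adjoin_simple_self ℚ _))

theorem exists_int_of_isIntegral {q : ℚ} (h : IsIntegral ℤ (q : ℂ)) : ∃ a : ℤ, q = a := by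
  have h' : IsIntegral ℤ q := by
    rw [← isIntegral_algebraMap_iff (algebraMap ℚ ℂ).injective]
    simpa using h
  obtain ⟨a, ha⟩ := IsIntegrallyClosed.isIntegral_iff.1 h'
  exact ⟨a, by simpa using ha.symm⟩

theorem isIntegral_conj {x : ℂ} (h : IsIntegral ℤ x) : IsIntegral ℤ (starRingEnd ℂ x) := by
  exact h.map (starRingEnd ℂ).toIntAlgHom

/-- The embedding of the ring of integers of `ℚ(√-d)` into `ℂ`. -/
def integersEmb (d : ℕ) : 𝓞 (imagQuadField d) →+* ℂ :=
  (algebraMap (imagQuadField d) ℂ).comp (algebraMap (𝓞 (imagQuadField d)) (imagQuadField d))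

theorem exists_integersEmb_iff (d : ℕ) (x : ℂ) :
    (∃ α, integersEmb d α = x) ↔ x ∈ imagQuadField d ∧ IsIntegral ℤ x := by
  constructor
  · rintro ⟨α, rfl⟩
    exact ⟨(α : imagQuadField d).2, (NumberField.RingOfIntegers.isIntegral_coe α).map
      (algebraMap (imagQuadField d) ℂ).toIntAlgHom⟩
  · rintro ⟨hx, hi⟩
    have : IsIntegral ℤ (⟨x, hx⟩ : imagQuadField d) := by
      rw [← isIntegral_algebraMap_iff (algebraMap (imagQuadField d) ℂ).injective]
      exact hi
    exact ⟨⟨⟨x, hx⟩, this⟩, rfl⟩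

theorem isImagQuad_integersEmb {d : ℕ} (hd : Squarefree d) : IsImagQuad d (integersEmb d) where
  inj := (algebraMap (imagQuadField d) ℂ).injective.comp NumberField.RingOfIntegers.coe_injective
  mem_iff x := by
    rw [exists_integersEmb_iff]
    constructor
    · rintro ⟨hx, hi⟩
      obtain ⟨p, q, rfl⟩ := (mem_imagQuadField d x).1 hx
      have hc := isIntegral_conj hi
      have ec : (starRingEnd ℂ) (p + q * rootNeg d) = p - q * rootNeg d := by
        rw [map_add, map_mul, conj_rootNeg, map_ratCast, map_ratCast]
        ring
      rw [ec] at hc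
      obtain ⟨a, ha⟩ := exists_int_of_isIntegral (q := 2 * p) (by
        have e := hi.add hc
        rw [add_add_sub_cancel, ← two_mul] at e
        exact_mod_cast e)
      obtain ⟨n, hn⟩ := exists_int_of_isIntegral (q := p ^ 2 + d * q ^ 2) (by
        have e := hi.mul hc
        have e' : (p + q * rootNeg d) * (p - q * rootNeg d) = ((p ^ 2 + d * q ^ 2 : ℚ) : ℂ) := by
          push_cast
          linear_combination -(q : ℂ) ^ 2 * rootNeg_mul_self d
        rwa [e'] at e)
      -- Trace and norm are integers, so d(2q)² is an integer, and a squarefree `d` cannot cancel a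
      -- denominator squared.
      have hden : ((2 * q).den : ℤ) ∣ (2 * q).num := by
        apply dvd_of_sq_dvd_squarefree_mul hd
        refine ⟨4 * n - a ^ 2, ?_⟩
        have h₁ : (d : ℚ) * (2 * q) ^ 2 = 4 * n - a ^ 2 := by
          rw [← hn, ← ha]
          ring
        have h₂ : (2 * q) * (2 * q).den = (2 * q).num := Rat.mul_den_eq_num _
        have : (d : ℚ) * (2 * q).num ^ 2 = (2 * q).den ^ 2 * (4 * n - a ^ 2) := by
          rw [← h₂, ← h₁]
          ring
        exact_mod_cast this
      obtain ⟨b, hb⟩ := hden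
      have hb' : 2 * q = b := by
        rw [← Rat.num_div_den (2 * q), hb]
        have : ((2 * q).den : ℚ) ≠ 0 := by exact_mod_cast (2 * q).den_nz
        push_cast
        field_simp
      refine ⟨a, b, ?_, n, ?_⟩
      · have h₁ : (2 * p : ℂ) = a := by exact_mod_cast congrArg (Rat.cast : ℚ → ℂ) ha
        have h₂ : (2 * q : ℂ) = b := by exact_mod_cast congrArg (Rat.cast : ℚ → ℂ) hb'
        linear_combination h₁ + rootNeg d * h₂
      · have : (a : ℚ) ^ 2 + d * b ^ 2 = 4 * n := by
          rw [← hn, ← ha, ← hb']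
          ring
        exact_mod_cast this
    · rintro ⟨a, b, hx, n, hn⟩
      have hn' : (a : ℂ) ^ 2 + d * b ^ 2 = 4 * n := by exact_mod_cast hn
      constructor
      · rw [mem_imagQuadField]
        refine ⟨a / 2, b / 2, ?_⟩
        push_cast
        linear_combination hx / 2
      · refine ⟨Polynomial.X ^ 2 + (Polynomial.C (-a) * Polynomial.X + Polynomial.C n), ?_, ?_⟩
        · monicity!
        · rw [← Polynomial.aeval_def]
          simp only [map_add, map_mul, map_pow, Polynomial.aeval_X, Polynomial.aeval_C]
          simp only [algebraMap_int_eq, eq_intCast, Int.cast_neg]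
          linear_combination (2 * x - a + b * rootNeg d) / 4 * hx - hn' / 4
            + b ^ 2 / 4 * rootNeg_mul_self d

theorem g_eq_zero_iff {d : ℕ} (hd : Squarefree d) (hd1 : d ≠ 1) :
    g d = 0 ↔
      ∃ m : ℕ, Squarefree m ∧ m ≠ 1 ∧ m ≠ d ∧ (m ∣ d ∨ d % 4 = 1 ∧ ∃ m', m = 2 * m' ∧ m' ∣ d) ∧
        ∃ x y z : ℤ, z ≠ 0 ∧ x ^ 2 + d * y ^ 2 = m * z ^ 2 := by
  rw [g, ZMod.natCast_eq_zero_iff_even]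
  exact (isImagQuad_integersEmb hd).even_card_iff hd hd1

/-! ### Legendre's theorem on conics -/

theorem exists_small_mem_ker {G : Type*} [AddCommGroup G] [Finite G] (f : ℤ × ℤ × ℤ →+ G)
    {A B C : ℕ} (hG : Nat.card G ^ 2 ≤ A * B * C) :
    ∃ x y z : ℤ, (x, y, z) ≠ 0 ∧ f (x, y, z) = 0 ∧ x ^ 2 ≤ A ∧ y ^ 2 ≤ B ∧ z ^ 2 ≤ C := by
  have := Fintype.ofFinite G
  let box : Finset (ℤ × ℤ × ℤ) := Finset.Icc 0 (A.sqrt : ℤ) ×ˢ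
    (Finset.Icc 0 (B.sqrt : ℤ) ×ˢ Finset.Icc 0 (C.sqrt : ℤ))
  have hcard : box.card = (A.sqrt + 1) * ((B.sqrt + 1) * (C.sqrt + 1)) := by
    simp only [box, Finset.card_product, Int.card_Icc, sub_zero]
    norm_cast
  have hlt : (Finset.univ : Finset G).card < box.card := by
    rw [Finset.card_univ, ← Nat.card_eq_fintype_card, hcard]
    refine lt_of_pow_lt_pow_left₀ 2 (Nat.zero_le _) (hG.trans_lt ?_)
    rw [mul_pow, mul_pow, mul_assoc]
    gcongr
    · exact Nat.lt_succ_sqrt' A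
    · exact Nat.lt_succ_sqrt' B
    · exact Nat.lt_succ_sqrt' C
  obtain ⟨u, hu, v, hv, huv, hf⟩ := Finset.exists_ne_map_eq_of_card_lt_of_maps_to hlt
    (f := f) (fun _ _ => Finset.mem_univ _)
  have key {D : ℕ} {s t : ℤ} (hs : s ∈ Finset.Icc 0 (D.sqrt : ℤ))
      (ht : t ∈ Finset.Icc 0 (D.sqrt : ℤ)) : (s - t) ^ 2 ≤ D := by
    rw [Finset.mem_Icc] at hs ht
    have h₁ : (s - t) ^ 2 ≤ (D.sqrt : ℤ) ^ 2 := sq_le_sq' (by linarith) (by linarith)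
    exact h₁.trans (by exact_mod_cast Nat.sqrt_le' D)
  obtain ⟨u₁, u₂, u₃⟩ := u
  obtain ⟨v₁, v₂, v₃⟩ := v
  simp only [box, Finset.mem_product] at hu hv
  refine ⟨u₁ - v₁, u₂ - v₂, u₃ - v₃, ?_, ?_, key hu.1 hv.1, key hu.2.1 hv.2.1, key hu.2.2 hv.2.2⟩
  · intro h
    exact huv (sub_eq_zero.1 h)
  · change f ((u₁, u₂, u₃) - (v₁, v₂, v₃)) = 0
    rw [map_sub, hf, sub_self]

theorem not_isSquare_of_squarefree {n : ℕ} (h : Squarefree n) (h1 : n ≠ 1) : ¬ IsSquare n := by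
  rintro ⟨k, rfl⟩
  have := Nat.isUnit_iff.1 (h k dvd_rfl)
  simp [this] at h1

theorem exists_conic_of_isSquare {a b c : ℕ} (hs : Squarefree (c * (a * b)))
    (hc : c ∣ a + b) (hab : a * b ≠ 1) (hcb : c * b ≠ 1)
    (hα : IsSquare ((c * a : ℕ) : ZMod b)) (hβ : IsSquare ((c * b : ℕ) : ZMod a)) :
    ∃ x y z : ℤ, z ≠ 0 ∧ a * x ^ 2 + b * y ^ 2 = c * z ^ 2 := by
  have hc0 : c ≠ 0 := left_ne_zero_of_mul hs.ne_zero
  have ha0 : a ≠ 0 := left_ne_zero_of_mul (right_ne_zero_of_mul hs.ne_zero)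
  have hb0 : b ≠ 0 := right_ne_zero_of_mul (right_ne_zero_of_mul hs.ne_zero)
  have hcopab : a.Coprime b := Nat.coprime_of_squarefree_mul hs.of_mul_right
  have hcopc : c.Coprime (a * b) := Nat.coprime_of_squarefree_mul hs
  have hcopca : c.Coprime a := hcopc.coprime_mul_right_right
  have hcopcb : c.Coprime b := hcopc.coprime_mul_left_right
  have : NeZero a := ⟨ha0⟩
  have : NeZero b := ⟨hb0⟩
  have : NeZero c := ⟨hc0⟩
  obtain ⟨α, hα⟩ := hα
  obtain ⟨β, hβ⟩ := hβ
  -- On the kernel the form ax² + by² - cz² is divisible by a, b and c; modulo c the congruence x ≡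
  -- y suffices because c divides a + b. The bounds below multiply to (abc)², the square of the
  -- order of the target.
  let f : ℤ × ℤ × ℤ →+ ZMod b × ZMod a × ZMod c :=
    { toFun := fun v => (c * v.2.2 - α * v.1, c * v.2.2 - β * v.2.1, (v.1 : ZMod c) - v.2.1)
      map_zero' := by simp
      map_add' := fun u v => by
        ext <;> simp <;> ring }
  obtain ⟨x, y, z, h0, hf, hx, hy, hz⟩ := exists_small_mem_ker f (A := c * b) (B := c * a)
    (C := a * b) (by
      simp only [Nat.card_prod, Nat.card_zmod]
      exact le_of_eq (by ring))
  push_cast at hx hy hz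
  have hf' : (c * z - α * x : ZMod b) = 0 ∧ (c * z - β * y : ZMod a) = 0 ∧ (x - y : ZMod c) = 0 := by
    simpa [f] using hf
  obtain ⟨h₁, h₂, h₃⟩ := hf'
  push_cast at hα hβ
  have hdb : (b : ℤ) ∣ a * x ^ 2 + b * y ^ 2 - c * z ^ 2 := by
    have e : (b : ℤ) ∣ c * (a * x ^ 2 + b * y ^ 2 - c * z ^ 2) := by
      rw [← ZMod.intCast_zmod_eq_zero_iff_dvd]
      push_cast
      rw [ZMod.natCast_self]
      linear_combination x ^ 2 * hα - (c * z + α * x) * h₁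
    exact (Nat.isCoprime_iff_coprime.2 hcopcb.symm).dvd_of_dvd_mul_left e
  have hda : (a : ℤ) ∣ a * x ^ 2 + b * y ^ 2 - c * z ^ 2 := by
    have e : (a : ℤ) ∣ c * (a * x ^ 2 + b * y ^ 2 - c * z ^ 2) := by
      rw [← ZMod.intCast_zmod_eq_zero_iff_dvd]
      push_cast
      rw [ZMod.natCast_self]
      linear_combination y ^ 2 * hβ - (c * z + β * y) * h₂
    exact (Nat.isCoprime_iff_coprime.2 hcopca.symm).dvd_of_dvd_mul_left e
  have hdc : (c : ℤ) ∣ a * x ^ 2 + b * y ^ 2 - c * z ^ 2 := by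
    have hc' : ((a + b : ℕ) : ZMod c) = 0 := (ZMod.natCast_eq_zero_iff _ _).2 hc
    rw [← ZMod.intCast_zmod_eq_zero_iff_dvd]
    push_cast at hc' ⊢
    rw [ZMod.natCast_self]
    linear_combination y ^ 2 * hc' + a * (x + y) * h₃
  have hd : ((c * (a * b) : ℕ) : ℤ) ∣ a * x ^ 2 + b * y ^ 2 - c * z ^ 2 := by
    push_cast
    refine IsCoprime.mul_dvd ?_ hdc ((Nat.isCoprime_iff_coprime.2 hcopab).mul_dvd hda hdb)
    exact_mod_cast Nat.isCoprime_iff_coprime.2 hcopc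
  obtain ⟨k, hk⟩ := hd
  push_cast at hk
  have ha : (0 : ℤ) < a := by positivity
  have hb : (0 : ℤ) < b := by positivity
  have hcp : (0 : ℤ) < c := by positivity
  -- The strict bounds leave only the values 0 and abc for the form.
  have ns {n : ℕ} (hn : Squarefree n) (hn1 : n ≠ 1) {t : ℤ} (ht : t ^ 2 ≤ n) : t ^ 2 < n := by
    refine lt_of_le_of_ne ht fun e => not_isSquare_of_squarefree hn hn1 ⟨t.natAbs, ?_⟩
    zify
    rw [← e, ← sq, sq_abs]
  have hz' : z ^ 2 < a * b := by
    exact_mod_cast ns hs.of_mul_right hab (by exact_mod_cast hz)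
  have hx' : x ^ 2 < c * b := by
    refine mod_cast ns (n := c * b) (hs.squarefree_of_dvd ⟨a, by ring⟩) hcb (by exact_mod_cast hx)
  have hN : (0 : ℤ) < c * (a * b) := by positivity
  have hk1 : k < 2 := by
    have : (c : ℤ) * (a * b) * k < c * (a * b) * 2 := by
      rw [← hk]
      nlinarith [mul_lt_mul_of_pos_left hx' ha, mul_le_mul_of_nonneg_left hy hb.le,
        mul_nonneg hcp.le (sq_nonneg z)]
    exact lt_of_mul_lt_mul_left this hN.le
  have hk0 : -1 < k := by
    have : (c : ℤ) * (a * b) * (-1) < c * (a * b) * k := by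
      rw [← hk]
      nlinarith [mul_lt_mul_of_pos_left hz' hcp, mul_nonneg ha.le (sq_nonneg x),
        mul_nonneg hb.le (sq_nonneg y)]
    exact lt_of_mul_lt_mul_left this hN.le
  obtain rfl | rfl : k = 0 ∨ k = 1 := by omega
  · refine ⟨x, y, z, ?_, by linarith⟩
    rintro rfl
    have hx0 : x = 0 := by
      have : (a : ℤ) * x ^ 2 = 0 := by nlinarith [mul_nonneg ha.le (sq_nonneg x), mul_nonneg hb.le (sq_nonneg y)]
      simpa [ha0] using this
    have hy0 : y = 0 := by
      have : (b : ℤ) * y ^ 2 = 0 := by nlinarith [mul_nonneg ha.le (sq_nonneg x), mul_nonneg hb.le (sq_nonneg y)]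
      simpa [hb0] using this
    exact h0 (by simp [hx0, hy0])
  -- If the form equals abc, then ax² + by² = c(z² + ab). Multiply by z² + ab, a norm for the form
  -- X² + abY², and compose.
  · refine ⟨x * z + b * y, y * z - a * x, z ^ 2 + a * b, by positivity, ?_⟩
    linear_combination (z ^ 2 + a * b) * hk

/-- If p divides x, then it divides z and y too, and the solution can be divided by p. Otherwise ca
is the square of cz/x modulo p. -/
theorem isSquare_of_conic {a b c p : ℕ} [Fact p.Prime] (hb : Squarefree b) (hpb : p ∣ b)
    (hca : ¬ p ∣ c) {x y z : ℤ} (hz : z ≠ 0)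
    (h : a * x ^ 2 + b * y ^ 2 = c * z ^ 2) : IsSquare ((c * a : ℕ) : ZMod p) := by
  have hp : p.Prime := Fact.out
  have hp' : Prime (p : ℤ) := Nat.prime_iff_prime_int.1 hp
  induction hn : z.natAbs using Nat.strong_induction_on generalizing x y z with
  | _ n ih =>
  subst hn
  by_cases hx : (p : ℤ) ∣ x
  · have hpz : (p : ℤ) ∣ z := by
      have : (p : ℤ) ∣ c * z ^ 2 := by
        rw [← h]
        refine dvd_add ((hx.trans (dvd_pow_self x two_ne_zero)).mul_left _) (Dvd.dvd.mul_right ?_ _)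
        exact_mod_cast hpb
      rcases hp'.dvd_or_dvd this with h | h
      · exact absurd (by exact_mod_cast h) hca
      · exact hp'.dvd_of_dvd_pow h
    obtain ⟨x, rfl⟩ := hx
    obtain ⟨z, rfl⟩ := hpz
    obtain ⟨y, rfl⟩ : (p : ℤ) ∣ y :=
      dvd_of_sq_dvd_squarefree_mul hb ⟨c * z ^ 2 - a * x ^ 2, by linear_combination h⟩
    have hp0 : (p : ℤ) ≠ 0 := hp'.ne_zero
    have hz0 : z ≠ 0 := right_ne_zero_of_mul hz
    refine ih z.natAbs ?_ hz0 (x := x) (y := y) ?_ rfl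
    · rw [Int.natAbs_mul, Int.natAbs_natCast]
      exact lt_mul_left (Int.natAbs_pos.2 hz0) hp.one_lt
    · apply mul_left_cancel₀ (pow_ne_zero 2 hp0)
      linear_combination h
  · have hx0 : (x : ZMod p) ≠ 0 := by rwa [Ne, ZMod.intCast_zmod_eq_zero_iff_dvd]
    refine ⟨c * z / x, ?_⟩
    have hb0 : (b : ZMod p) = 0 := (ZMod.natCast_eq_zero_iff _ _).2 hpb
    have h' := congrArg (Int.cast : ℤ → ZMod p) h
    push_cast at h' ⊢
    field_simp
    linear_combination c * h' - c * y ^ 2 * hb0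

theorem isSquare_zmod_of_squarefree {b : ℕ} (hb : Squarefree b) (n : ℕ)
    (h : ∀ p, p.Prime → p ∣ b → IsSquare (n : ZMod p)) : IsSquare (n : ZMod b) := by
  induction b using Nat.recOnPosPrimePosCoprime with
  | prime_pow p k hp hk =>
    have hk1 : k = 1 := by
      have := (Nat.squarefree_pow_iff hp.ne_one hk.ne').1 hb
      exact this.2
    subst hk1
    rw [pow_one] at h ⊢
    exact h p hp dvd_rfl
  | zero => exact absurd hb not_squarefree_zero
  | one => exact ⟨0, Subsingleton.elim _ _⟩
  | coprime a b ha hb' hab iha ihb =>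
    obtain ⟨s, hs⟩ := iha hb.of_mul_left fun p hp hpa => h p hp (hpa.mul_right b)
    obtain ⟨t, ht⟩ := ihb hb.of_mul_right fun p hp hpa => h p hp (hpa.mul_left a)
    let e := ZMod.chineseRemainder hab
    refine ⟨e.symm (s, t), e.injective ?_⟩
    rw [map_mul, e.apply_symm_apply, map_natCast]
    ext
    · simpa using hs
    · simpa using ht

theorem isSquare_natCast_zmod_two (n : ℕ) : IsSquare (n : ZMod 2) := by
  generalize (n : ZMod 2) = u
  exact ⟨u, by revert u; decide⟩

/-- Legendre's theorem for the conics `a x² + b y² = c z²` with `c ∈ {1, 2}`. -/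
theorem exists_conic_iff {a b c : ℕ} (hc : c = 1 ∨ c = 2) (hs : Squarefree (c * (a * b))) :
    (∃ x y z : ℤ, z ≠ 0 ∧ a * x ^ 2 + b * y ^ 2 = c * z ^ 2) ↔
      (∀ p : ℕ, p.Prime → p ≠ 2 → p ∣ b → IsSquare ((c * a : ℕ) : ZMod p)) ∧
      (∀ p : ℕ, p.Prime → p ≠ 2 → p ∣ a → IsSquare ((c * b : ℕ) : ZMod p)) := by
  have hpc (p : ℕ) (hp : p.Prime) (hp2 : p ≠ 2) : ¬ p ∣ c := by
    rcases hc with rfl | rfl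
    · exact hp.one_lt.ne' ∘ Nat.dvd_one.1
    · exact fun h => hp2 ((Nat.prime_dvd_prime_iff_eq hp Nat.prime_two).1 h)
  constructor
  · rintro ⟨x, y, z, hz, h⟩
    constructor
    · intro p hp hp2 hpb
      have : Fact p.Prime := ⟨hp⟩
      exact isSquare_of_conic hs.of_mul_right.of_mul_right hpb (hpc p hp hp2) hz h
    · intro p hp hp2 hpa
      have : Fact p.Prime := ⟨hp⟩
      refine isSquare_of_conic hs.of_mul_right.of_mul_left hpa (hpc p hp hp2) hz (x := y) (y := x) ?_
      rw [← h, add_comm]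
  · rintro ⟨h₁, h₂⟩
    have h₁' : IsSquare ((c * a : ℕ) : ZMod b) := by
      refine isSquare_zmod_of_squarefree hs.of_mul_right.of_mul_right _ fun p hp hpb => ?_
      rcases eq_or_ne p 2 with rfl | hp2
      · exact isSquare_natCast_zmod_two _
      · exact h₁ p hp hp2 hpb
    have h₂' : IsSquare ((c * b : ℕ) : ZMod a) := by
      refine isSquare_zmod_of_squarefree hs.of_mul_right.of_mul_left _ fun p hp hpb => ?_
      rcases eq_or_ne p 2 with rfl | hp2
      · exact isSquare_natCast_zmod_two _
      · exact h₂ p hp hp2 hpb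
    rcases hc with rfl | rfl
    · by_cases ha : a = 1
      · exact ⟨1, 0, 1, one_ne_zero, by simp [ha]⟩
      by_cases hb : b = 1
      · exact ⟨0, 1, 1, one_ne_zero, by simp [hb]⟩
      refine exists_conic_of_isSquare hs (one_dvd _) ?_ ?_ h₁' h₂'
      · exact fun e => ha (Nat.eq_one_of_mul_eq_one_right e)
      · rwa [one_mul]
    · by_cases hab : a * b = 1
      · exact ⟨1, 1, 1, one_ne_zero, by
          rw [Nat.eq_one_of_mul_eq_one_right hab, Nat.eq_one_of_mul_eq_one_left hab]; norm_num⟩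
      have hodd : Odd (a * b) := Nat.coprime_two_left.1 (Nat.coprime_of_squarefree_mul hs)
      rw [Nat.odd_mul] at hodd
      exact exists_conic_of_isSquare hs (hodd.1.add_odd hodd.2).two_dvd hab (by omega) h₁' h₂'

theorem conic_iff_conic {a b c : ℕ} (ha : Squarefree a) :
    (∃ x y z : ℤ, z ≠ 0 ∧ x ^ 2 + (a * b : ℕ) * y ^ 2 = (c * a : ℕ) * z ^ 2) ↔
      ∃ x y z : ℤ, z ≠ 0 ∧ a * x ^ 2 + b * y ^ 2 = c * z ^ 2 := by
  have ha0 : (a : ℤ) ≠ 0 := by exact_mod_cast ha.ne_zero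
  constructor
  · rintro ⟨x, y, z, hz, h⟩
    push_cast at h
    obtain ⟨x, rfl⟩ := dvd_of_squarefree_of_dvd_sq ha (a := x)
      ⟨c * z ^ 2 - b * y ^ 2, by linear_combination h⟩
    exact ⟨x, y, z, hz, mul_left_cancel₀ ha0 (by linear_combination h)⟩
  · rintro ⟨x, y, z, hz, h⟩
    refine ⟨a * x, y, z, hz, ?_⟩
    push_cast
    linear_combination (a : ℤ) * h

end TYZ

end

noncomputable section

namespace TYZ

open Matrix Finset

local notation "F₂" => ZMod 2

theorem zmod2_eq_of_iff {x y : F₂} (h : x = 0 ↔ y = 0) : x = y := by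
  revert x y
  decide

/-! ### Additive Legendre symbols -/

section AddLegendre

variable {q : ℕ} [Fact q.Prime]

theorem addLegendre_mul {m n : ℤ} (hm : (m : ZMod q) ≠ 0) (hn : (n : ZMod q) ≠ 0) :
    addLegendre q (m * n) = addLegendre q m + addLegendre q n := by
  rw [addLegendre, addLegendre, addLegendre, legendreSym.mul]
  rcases legendreSym.eq_one_or_neg_one q hm with h₁ | h₁ <;>
    rcases legendreSym.eq_one_or_neg_one q hn with h₂ | h₂ <;> rw [h₁, h₂] <;> decide

theorem addLegendre_one : addLegendre q 1 = 0 := by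
  rw [addLegendre, legendreSym.at_one]
  decide

theorem addLegendre_eq_zero_iff {m : ℤ} (hm : (m : ZMod q) ≠ 0) :
    addLegendre q m = 0 ↔ IsSquare (m : ZMod q) := by
  rw [← legendreSym.eq_one_iff q hm, addLegendre]
  rcases legendreSym.eq_one_or_neg_one q hm with h | h <;> rw [h] <;> decide

theorem addLegendre_mod_eight (hq : q ≠ 2) :
    (addLegendre q (-1) = 0 ∧ addLegendre q 2 = 0 ∧ q % 8 = 1) ∨
    (addLegendre q (-1) = 1 ∧ addLegendre q 2 = 1 ∧ q % 8 = 3) ∨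
    (addLegendre q (-1) = 0 ∧ addLegendre q 2 = 1 ∧ q % 8 = 5) ∨
    (addLegendre q (-1) = 1 ∧ addLegendre q 2 = 0 ∧ q % 8 = 7) := by
  rw [addLegendre, addLegendre, legendreSym.at_neg_one hq, legendreSym.at_two hq]
  have hodd := (Fact.out : q.Prime).eq_two_or_odd.resolve_left hq
  have h : q % 8 = 1 ∨ q % 8 = 3 ∨ q % 8 = 5 ∨ q % 8 = 7 := by omega
  have h4 : ((q : ℕ) : ZMod 4) = ((q % 8 : ℕ) : ZMod 4) := by
    rw [ZMod.natCast_eq_natCast_iff, Nat.ModEq]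
    omega
  have h8 : ((q : ℕ) : ZMod 8) = ((q % 8 : ℕ) : ZMod 8) := by
    rw [ZMod.natCast_mod]
  rw [h4, h8]
  rcases h with h | h | h | h <;> rw [h] <;> decide

theorem addLegendre_reciprocity {p : ℕ} [Fact p.Prime] (hp : p ≠ 2) (hq : q ≠ 2) (hpq : p ≠ q) :
    addLegendre p q + addLegendre q p = addLegendre p (-1) * addLegendre q (-1) := by
  have hp0 : ((q : ℤ) : ZMod p) ≠ 0 := mod_cast ZMod.prime_ne_zero p q hpq
  have hq0 : ((p : ℤ) : ZMod q) ≠ 0 := mod_cast ZMod.prime_ne_zero q p hpq.symm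
  have one {p q : ℕ} [Fact p.Prime] [Fact q.Prime] (hp : p % 8 = 1 ∨ p % 8 = 5) (hq : q ≠ 2) :
      addLegendre p q + addLegendre q p = 0 := by
    rw [addLegendre, addLegendre,
      legendreSym.quadratic_reciprocity_one_mod_four (by omega : p % 4 = 1) hq]
    exact zmod2_add_self _
  have three (hp : p % 8 = 3 ∨ p % 8 = 7) (hq : q % 8 = 3 ∨ q % 8 = 7) :
      addLegendre p q + addLegendre q p = 1 := by
    rw [addLegendre, addLegendre, legendreSym.quadratic_reciprocity_three_mod_four
      (by omega : p % 4 = 3) (by omega : q % 4 = 3)]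
    rcases legendreSym.eq_one_or_neg_one p hp0 with h | h <;> rw [h] <;> decide
  rcases addLegendre_mod_eight hp with ⟨h, -, hp8⟩ | ⟨h, -, hp8⟩ | ⟨h, -, hp8⟩ | ⟨h, -, hp8⟩ <;>
    rcases addLegendre_mod_eight hq with ⟨h', -, hq8⟩ | ⟨h', -, hq8⟩ | ⟨h', -, hq8⟩ | ⟨h', -, hq8⟩ <;>
    rw [h, h'] <;>
    first
    | rw [zero_mul, one (by omega) hq]
    | rw [mul_zero, add_comm, one (by omega) hp]
    | rw [one_mul, three (by omega) (by omega)]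

end AddLegendre

/-! ### Kernels of Laplacians over 𝔽₂ -/

section Kernel

variable {V : Type} [Fintype V] [DecidableEq V]

theorem net_mulVec_res (T : Finset V) (a : V → V → F₂) (s : V → F₂) {U : Finset V} (hU : U ⊆ T)
    {i : V} (hi : i ∈ T) : (net T a s *ᵥ res U 1) i =
      if i ∈ U then s i + ∑ j ∈ T \ U, a i j else ∑ j ∈ U, a i j := by
  rw [mulVec, dotProduct, ← sum_subset (subset_univ U) (fun x _ hx => by simp [res, hx])]
  split_ifs with h
  · have e : T.erase i = (T \ U) ∪ U.erase i := by
      ext x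
      simp only [mem_erase, mem_union, mem_sdiff]
      constructor
      · rintro ⟨h₁, h₂⟩
        by_cases hx : x ∈ U <;> simp_all
      · rintro (⟨h₁, h₂⟩ | ⟨h₁, h₂⟩)
        · exact ⟨fun e => h₂ (e ▸ h), h₁⟩
        · exact ⟨h₁, hU h₂⟩
    have hd : Disjoint (T \ U) (U.erase i) :=
      disjoint_sdiff_self_left.mono_right (erase_subset i U)
    rw [← add_sum_erase _ _ h, sum_congr rfl (s₂ := U.erase i) (g := fun x => a i x)]
    · simp only [net, of_apply, hi, if_true, res, h, Pi.one_apply, mul_one]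
      rw [e, sum_union hd, add_assoc, add_assoc, zmod2_add_self, add_zero]
    · intro x hx
      rw [mem_erase] at hx
      simp [net, hi, hU hx.2, res, hx.2, Ne.symm hx.1]
  · refine sum_congr rfl fun x hx => ?_
    have : i ≠ x := fun e => h (e ▸ hx)
    simp [net, hi, hU hx, res, hx, this]

theorem net_mulVec_of_notMem {T : Finset V} (a : V → V → F₂) (s v : V → F₂) {i : V} (hi : i ∉ T) :
    (net T a s *ᵥ v) i = v i := by
  rw [mulVec, dotProduct, sum_eq_single i]
  · simp [net, hi]
  · intro j _ hj
    simp [net, hi, Ne.symm hj]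
  · simp

theorem eq_res_of_forall_notMem {T : Finset V} {v : V → F₂} (hv : ∀ i ∉ T, v i = 0) :
    v = res (T.filter fun i => v i = 1) 1 := by
  ext i
  by_cases hi : i ∈ T
  · rcases zmod2_eq_zero_or_one (v i) with h | h <;> simp [res, hi, h]
  · simp [res, hi, hv i hi]

theorem res_sdiff {T U : Finset V} (hU : U ⊆ T) (f : V → F₂) :
    res (T \ U) f = res T f + res U f := by
  ext i
  by_cases h : i ∈ U
  · simp [res, h, hU h, zmod2_add_self]
  · simp [res, h]

theorem det_net_eq_zero_iff (T : Finset V) (a : V → V → F₂) (s : V → F₂) :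
    (net T a s).det = 0 ↔ ∃ U ⊆ T, U.Nonempty ∧ ∀ i ∈ T, (net T a s *ᵥ res U 1) i = 0 := by
  rw [← exists_mulVec_eq_zero_iff]
  constructor
  · rintro ⟨v, hv, h⟩
    have hv' := eq_res_of_forall_notMem (T := T) (v := v) fun i hi => by
      rw [← net_mulVec_of_notMem a s v hi, h, Pi.zero_apply]
    refine ⟨T.filter fun i => v i = 1, filter_subset _ _, ?_, fun i _ => ?_⟩
    · rw [nonempty_iff_ne_empty]
      intro e
      rw [e] at hv'
      exact hv (hv'.trans (by ext; simp [res]))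
    · rw [← hv', h, Pi.zero_apply]
  · rintro ⟨U, hU, ⟨i, hi⟩, h⟩
    refine ⟨res U 1, fun e => ?_, ?_⟩
    · have := congrFun e i
      simp [res, hi] at this
    · ext j
      by_cases hj : j ∈ T
      · exact h j hj
      · rw [net_mulVec_of_notMem a s _ hj]
        have hjU : j ∉ U := fun e => hj (hU e)
        simp [res, hjU]

theorem bdMat_mulVec (T : Finset V) (a : V → V → F₂) (u v : V → F₂) (q : V) (t : F₂) (hq : q ∈ T) :
    fromBlocks (net T a 0) (replicateCol Unit (res T u))
      (replicateRow Unit (res T (Pi.single q 1))) 0 *ᵥ Sum.elim v (fun _ => t) =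
    Sum.elim (net T a 0 *ᵥ v + t • res T u) (fun _ => v q) := by
  rw [fromBlocks_mulVec]
  ext (i | i)
  · simp [mulVec, dotProduct, mul_comm]
  · simp [mulVec, dotProduct, res_single T hq, Pi.single_apply]

theorem tau_eq_zero_iff {T : Finset V} (hT : T.Nonempty) (a : V → V → F₂) (u : V → F₂) :
    tau T a u = 0 ↔ ∃ U ⊆ T, ∃ t : F₂, ¬ (t = 0 ∧ (U = ∅ ∨ U = T)) ∧
      ∀ i ∈ T, (net T a 0 *ᵥ res U 1) i + t * u i = 0 := by
  obtain ⟨q, hq⟩ := hT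
  rw [← bd_single T a u hq, bd, ← exists_mulVec_eq_zero_iff]
  constructor
  · rintro ⟨w, hw, h⟩
    obtain ⟨v, t, rfl⟩ : ∃ (v : V → F₂) (t : F₂), w = Sum.elim v (fun _ => t) :=
      ⟨w ∘ Sum.inl, w (Sum.inr ()), by ext (i | i) <;> rfl⟩
    rw [bdMat_mulVec _ _ _ _ _ _ hq] at h
    have h₁ (i : V) : (net T a 0 *ᵥ v) i + t * res T u i = 0 := congrFun h (Sum.inl i)
    have h₂ : v q = 0 := congrFun h (Sum.inr ())
    have hv' := eq_res_of_forall_notMem (T := T) (v := v) fun i hi => by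
      rw [← net_mulVec_of_notMem a 0 v hi, ← h₁ i]
      simp [res, hi]
    refine ⟨T.filter fun i => v i = 1, filter_subset _ _, t, ?_, fun i hi => ?_⟩
    · rintro ⟨rfl, e | e⟩
      · rw [e] at hv'
        refine hw ?_
        rw [hv']
        ext (i | i) <;> simp [res]
      · rw [← e] at hq
        simp [h₂] at hq
    · rw [← hv', ← h₁ i]
      simp [res, hi]
  · rintro ⟨U, hU, t, ht, h⟩
    -- The border forces the coordinate at `q` to vanish; the complement of `U` gives the same
    -- image, since the Laplacian kills the indicator of `T`.
    wlog hqU : q ∉ U generalizing U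
    · rw [not_not] at hqU
      refine this (T \ U) sdiff_subset ?_ ?_ ?_
      · rintro ⟨h0, e | e⟩
        · exact ht ⟨h0, Or.inr (subset_antisymm hU (sdiff_eq_empty_iff_subset.1 e))⟩
        · rw [← e] at hq
          exact (mem_sdiff.1 hq).2 hqU
      · intro i hi
        rw [res_sdiff hU, mulVec_add, net_zero_mulVec, zero_add]
        exact h i hi
      · simp [hqU]
    refine ⟨Sum.elim (res U 1) fun _ => t, ?_, ?_⟩
    · intro e
      have ht0 : t = 0 := congrFun e (Sum.inr ())
      refine ht ⟨ht0, Or.inl (eq_empty_of_forall_notMem fun i hi => ?_)⟩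
      have := congrFun e (Sum.inl i)
      simp [res, hi] at this
    · rw [bdMat_mulVec _ _ _ _ _ _ hq]
      ext (i | i)
      · by_cases hi : i ∈ T
        · simpa [res, hi] using h i hi
        · have hiU : i ∉ U := fun e => hi (hU e)
          simp [net_mulVec_of_notMem a 0 _ hi, res, hi, hiU]
      · simp [res, hqU]

/-- By reciprocity the sum of column k is y_k times the sum of the other y_i, that is y_k(1 + y_k) =
0. So the indicator of `T` is also in the left kernel. -/
theorem sum_net_apply {T : Finset V} {a : V → V → F₂} {y : V → F₂}
    (recip : ∀ i j, i ≠ j → a i j + a j i = y i * y j) (hy : ∑ i ∈ T, y i = 1) (k : V) :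
    ∑ i ∈ T, net T a 0 i k = 0 := by
  by_cases hk : k ∈ T
  · rw [← add_sum_erase _ _ hk, sum_congr rfl (s₂ := T.erase k) (g := fun i => a i k)]
    · simp only [net, of_apply, hk, if_true, Pi.zero_apply, zero_add]
      rw [← sum_add_distrib, sum_congr rfl fun i hi => recip k i (Ne.symm (mem_erase.1 hi).1),
        ← mul_sum]
      have := add_sum_erase T y hk
      rw [hy] at this
      revert this
      generalize y k = s
      generalize ∑ i ∈ T.erase k, y i = t
      revert s t
      decide
    · intro i hi
      rw [mem_erase] at hi
      simp [net, hi.2, hk, hi.1]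
  · exact sum_eq_zero fun i hi => by simp [net, hi, hk]

theorem sum_net_mulVec {T : Finset V} {a : V → V → F₂} {y : V → F₂}
    (recip : ∀ i j, i ≠ j → a i j + a j i = y i * y j) (hy : ∑ i ∈ T, y i = 1) (v : V → F₂) :
    ∑ i ∈ T, (net T a 0 *ᵥ v) i = 0 := by
  simp only [mulVec, dotProduct]
  rw [sum_comm]
  refine sum_eq_zero fun k _ => ?_
  rw [← sum_mul, sum_net_apply recip hy, zero_mul]

theorem tau_eq_zero_of_sum_eq_zero {T : Finset V} {a : V → V → F₂} {y : V → F₂}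
    (recip : ∀ i j, i ≠ j → a i j + a j i = y i * y j) (hy : ∑ i ∈ T, y i = 1) {u : V → F₂}
    (hu : ∑ i ∈ T, u i = 0) : tau T a u = 0 := by
  obtain ⟨q, hq, -⟩ := exists_ne_zero_of_sum_ne_zero (by rw [hy]; exact one_ne_zero)
  have h (f : V → F₂) : ∑ i, res T 1 i * f i = ∑ i ∈ T, f i := by
    rw [← sum_subset (subset_univ T) (fun x _ hx => by simp [res, hx])]
    exact sum_congr rfl fun i hi => by simp [res, hi]
  rw [← bd_single T a u hq, bd, ← exists_vecMul_eq_zero_iff]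
  refine ⟨Sum.elim (res T 1) 0, fun e => ?_, ?_⟩
  · have := congrFun e (Sum.inl q)
    simp [res, hq] at this
  · rw [vecMul_fromBlocks]
    ext (k | k)
    · simp only [Sum.elim_comp_inl, Sum.elim_comp_inr, zero_vecMul, add_zero, Sum.elim_inl,
        Pi.zero_apply]
      exact (h _).trans (sum_net_apply recip hy k)
    · simp only [Sum.elim_comp_inl, Sum.elim_comp_inr, zero_vecMul, add_zero, Sum.elim_inr,
        Pi.zero_apply]
      refine (h _).trans ((sum_congr rfl fun i hi => ?_).trans hu)
      simp [res, hi]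

/-- Summing the kernel equations over `T` kills the Laplacian part and leaves t = 0. -/
theorem tau_eq_zero_iff_of_sum_eq_one {T : Finset V} {a : V → V → F₂} {y : V → F₂}
    (recip : ∀ i j, i ≠ j → a i j + a j i = y i * y j) (hy : ∑ i ∈ T, y i = 1) {u : V → F₂}
    (hu : ∑ i ∈ T, u i = 1) : tau T a u = 0 ↔ ∃ U ⊆ T, ¬ (U = ∅ ∨ U = T) ∧
      ∀ i ∈ T, (net T a 0 *ᵥ res U 1) i = 0 := by
  have hT : T.Nonempty := by
    rw [nonempty_iff_ne_empty]
    rintro rfl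
    simp at hu
  rw [tau_eq_zero_iff hT]
  constructor
  · rintro ⟨U, hU, t, ht, h⟩
    have ht0 : t = 0 := by
      have := sum_eq_zero h
      rwa [sum_add_distrib, ← mul_sum, hu, sum_net_mulVec recip hy, zero_add, mul_one] at this
    subst ht0
    exact ⟨U, hU, fun e => ht ⟨rfl, e⟩, fun i hi => by simpa using h i hi⟩
  · rintro ⟨U, hU, hU', h⟩
    exact ⟨U, hU, 0, fun e => hU' e.2, fun i hi => by simpa using h i hi⟩

end Kernel

/-! ### Rédei matrices and the class number parities -/

section PartProd

variable {r : ℕ} (p : Fin r → ℕ) [∀ i, Fact (p i).Prime]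

/-- The product of the primes `p i` with `i ∈ T`. -/
def partProd (T : Finset (Fin r)) : ℕ := ∏ i ∈ T, p i

/-- The weights of the Laplacian matrix `matA p`. -/
def weight (i j : Fin r) : F₂ := addLegendre (p i) (p j)

theorem partProd_union {S T : Finset (Fin r)} (h : Disjoint S T) :
    partProd p (S ∪ T) = partProd p S * partProd p T := prod_union h

theorem partProd_mul_sdiff {U T : Finset (Fin r)} (h : U ⊆ T) :
    partProd p U * partProd p (T \ U) = partProd p T := by
  rw [← partProd_union p disjoint_sdiff, union_sdiff_of_subset h]

theorem partProd_pos (T : Finset (Fin r)) : 0 < partProd p T :=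
  prod_pos fun i _ => (Fact.out : (p i).Prime).pos

theorem partProd_mod_eight (hp2 : ∀ i, p i ≠ 2) (T : Finset (Fin r)) :
    (∑ i ∈ T, vecY p i = 0 ∧ ∑ i ∈ T, vecZ p i = 0 ∧ partProd p T % 8 = 1) ∨
    (∑ i ∈ T, vecY p i = 1 ∧ ∑ i ∈ T, vecZ p i = 1 ∧ partProd p T % 8 = 3) ∨
    (∑ i ∈ T, vecY p i = 0 ∧ ∑ i ∈ T, vecZ p i = 1 ∧ partProd p T % 8 = 5) ∨
    (∑ i ∈ T, vecY p i = 1 ∧ ∑ i ∈ T, vecZ p i = 0 ∧ partProd p T % 8 = 7) := by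
  induction T using Finset.induction with
  | empty => simp [partProd]
  | insert i T hi ih =>
    simp only [partProd, sum_insert hi, prod_insert hi] at ih ⊢
    rw [Nat.mul_mod]
    have h1 : (1 : F₂) + 1 = 0 := rfl
    rcases addLegendre_mod_eight (hp2 i) with h | h | h | h <;>
      rcases ih with h' | h' | h' | h' <;>
      simp [vecY, vecZ, h, h'.2.2] at h' ⊢ <;> simp [h', h1]

variable (hp2 : ∀ i, p i ≠ 2) (hinj : Function.Injective p)

include hp2 in
theorem odd_partProd (T : Finset (Fin r)) : partProd p T % 2 = 1 := by
  rcases partProd_mod_eight p hp2 T with h | h | h | h <;> omega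

include hinj

theorem dvd_partProd_iff (i : Fin r) (T : Finset (Fin r)) : p i ∣ partProd p T ↔ i ∈ T := by
  rw [partProd, Prime.dvd_finsetProd_iff (Fact.out : (p i).Prime).prime]
  constructor
  · rintro ⟨j, hj, h⟩
    rw [Nat.prime_dvd_prime_iff_eq Fact.out Fact.out] at h
    rwa [hinj h]
  · exact fun h => ⟨i, h, dvd_rfl⟩

theorem partProd_injective : Function.Injective (partProd p) := by
  intro S T h
  ext i
  rw [← dvd_partProd_iff p hinj, h, dvd_partProd_iff p hinj]

theorem squarefree_partProd (T : Finset (Fin r)) : Squarefree (partProd p T) := by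
  refine Finset.squarefree_prod_of_pairwise_isCoprime ?_ fun i _ =>
    (Fact.out : (p i).Prime).prime.squarefree
  intro i _ j _ hij
  rw [Function.onFun, ← Nat.coprime_iff_isRelPrime]
  exact (Nat.coprime_primes Fact.out Fact.out).2 (hinj.ne hij)

omit hinj in
theorem dvd_partProd {m : ℕ} {T : Finset (Fin r)} : m ∣ partProd p T ↔ ∃ U ⊆ T, m = partProd p U := by
  constructor
  · intro h
    induction T using Finset.induction generalizing m with
    | empty => exact ⟨∅, subset_rfl, by simpa [partProd] using h⟩
    | insert i T hi ih =>
      rw [partProd, prod_insert hi, Nat.dvd_mul] at h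
      obtain ⟨k, l, hk, hl, rfl⟩ := h
      obtain ⟨U, hU, rfl⟩ := ih hl
      rcases (Nat.dvd_prime Fact.out).1 hk with rfl | rfl
      · exact ⟨U, hU.trans (subset_insert i T), one_mul _⟩
      · exact ⟨insert i U, insert_subset_insert i hU, by
          rw [partProd, partProd, prod_insert fun e => hi (hU e)]⟩
  · rintro ⟨U, hU, rfl⟩
    exact prod_dvd_prod_of_subset U T p hU

theorem natCast_partProd_ne_zero {i : Fin r} {T : Finset (Fin r)} (hi : i ∉ T) :
    ((partProd p T : ℤ) : ZMod (p i)) ≠ 0 := by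
  rw [Int.cast_natCast, Ne, ZMod.natCast_eq_zero_iff, dvd_partProd_iff p hinj]
  exact hi

theorem addLegendre_partProd {i : Fin r} {T : Finset (Fin r)} (hi : i ∉ T) :
    addLegendre (p i) (partProd p T) = ∑ j ∈ T, weight p i j := by
  induction T using Finset.induction with
  | empty => simp [partProd, addLegendre_one]
  | insert j T hj ih =>
    rw [mem_insert, not_or] at hi
    have h := natCast_partProd_ne_zero p hinj hi.2
    have hj' : ((p j : ℤ) : ZMod (p i)) ≠ 0 := by
      have := natCast_partProd_ne_zero p hinj (i := i) (T := {j}) (by simpa using hi.1)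
      simpa [partProd] using this
    rw [sum_insert hj, ← ih hi.2, weight, ← addLegendre_mul hj' h, partProd, prod_insert hj,
      Nat.cast_mul, ← partProd]

include hp2

theorem two_ne_zero_zmod (i : Fin r) : ((2 : ℤ) : ZMod (p i)) ≠ 0 := by
  have h : ¬ p i ∣ 2 := fun h => hp2 i ((Nat.prime_dvd_prime_iff_eq Fact.out Nat.prime_two).1 h)
  rw [← ZMod.natCast_eq_zero_iff] at h
  exact_mod_cast h

theorem isSquare_mul_partProd_iff {c : ℕ} (hc : c = 1 ∨ c = 2) {i : Fin r} {T : Finset (Fin r)}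
    (hi : i ∉ T) : IsSquare ((c * partProd p T : ℕ) : ZMod (p i)) ↔
      ∑ j ∈ T, weight p i j + (if c = 2 then vecZ p i else 0) = 0 := by
  have h := natCast_partProd_ne_zero p hinj hi
  have h2 := two_ne_zero_zmod p hp2 hinj i
  rw [← addLegendre_partProd p hinj hi]
  rcases hc with rfl | rfl
  · rw [if_neg (by norm_num), add_zero, addLegendre_eq_zero_iff h]
    simp
  · rw [if_pos rfl, add_comm, vecZ, ← addLegendre_mul h2 h,
      addLegendre_eq_zero_iff (by push_cast at h h2 ⊢; exact mul_ne_zero h2 h)]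
    simp

/-- The residue condition of Legendre's theorem at each prime of `T` is one coordinate of the
Laplacian applied to the indicator of `U`. A factor c = 2 adds z at all primes of `T`, a factor k =
2 only at those of `U`. -/
theorem conic_partProd_iff {c k : ℕ} (hck : c = 1 ∧ k = 1 ∨ c = 2 ∧ k = 1 ∨ c = 1 ∧ k = 2)
    {U T : Finset (Fin r)} (hU : U ⊆ T) :
    (∃ x y z : ℤ, z ≠ 0 ∧
      partProd p U * x ^ 2 + (k * partProd p (T \ U) : ℕ) * y ^ 2 = c * z ^ 2) ↔
    ∀ i ∈ T, (net T (weight p) (if k = 2 then vecZ p else 0) *ᵥ res U 1) i +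
      (if c = 2 then 1 else 0) * vecZ p i = 0 := by
  have hc : c = 1 ∨ c = 2 := by tauto
  have hs : Squarefree (c * (partProd p U * (k * partProd p (T \ U)))) := by
    have e : c * (partProd p U * (k * partProd p (T \ U))) = c * k * partProd p T := by
      rw [← partProd_mul_sdiff p hU]
      ring
    rw [e]
    have h1 := squarefree_partProd p hinj T
    have h2 : Squarefree (2 * partProd p T) := by
      rw [Nat.squarefree_mul (Nat.coprime_two_left.2 (Nat.odd_iff.2 (odd_partProd p hp2 T)))]
      exact ⟨Nat.prime_two.prime.squarefree, h1⟩
    rcases hck with ⟨rfl, rfl⟩ | ⟨rfl, rfl⟩ | ⟨rfl, rfl⟩ <;> simpa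
  have hpr (q : ℕ) (hq : q.Prime) (S : Finset (Fin r)) (hqS : q ∣ partProd p S) :
      ∃ i ∈ S, p i = q := by
    rw [partProd, hq.prime.dvd_finsetProd_iff] at hqS
    obtain ⟨i, hi, h⟩ := hqS
    exact ⟨i, hi, ((Nat.prime_dvd_prime_iff_eq hq Fact.out).1 h).symm⟩
  rw [exists_conic_iff hc hs]
  have hck' : c * k = 1 ∨ c * k = 2 := by
    rcases hck with ⟨rfl, rfl⟩ | ⟨rfl, rfl⟩ | ⟨rfl, rfl⟩ <;> simp
  have e1 {i : Fin r} (hi : i ∈ T \ U) : IsSquare ((c * partProd p U : ℕ) : ZMod (p i)) ↔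
      (net T (weight p) (if k = 2 then vecZ p else 0) *ᵥ res U 1) i +
        (if c = 2 then 1 else 0) * vecZ p i = 0 := by
    rw [mem_sdiff] at hi
    rw [isSquare_mul_partProd_iff p hp2 hinj hc hi.2, net_mulVec_res T _ _ hU hi.1, if_neg hi.2,
      ite_mul, one_mul, zero_mul]
  have e2 {i : Fin r} (hi : i ∈ U) : IsSquare ((c * (k * partProd p (T \ U)) : ℕ) : ZMod (p i)) ↔
      (net T (weight p) (if k = 2 then vecZ p else 0) *ᵥ res U 1) i +
        (if c = 2 then 1 else 0) * vecZ p i = 0 := by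
    rw [← mul_assoc, isSquare_mul_partProd_iff p hp2 hinj hck' (by simp [hi]),
      net_mulVec_res T _ _ hU (hU hi), if_pos hi]
    rcases hck with ⟨rfl, rfl⟩ | ⟨rfl, rfl⟩ | ⟨rfl, rfl⟩ <;> simp [add_comm]
  constructor
  · rintro ⟨h₁, h₂⟩ i hi
    by_cases hiU : i ∈ U
    · exact (e2 hiU).1 (h₂ (p i) Fact.out (hp2 i) ((dvd_partProd_iff p hinj i U).2 hiU))
    · have : i ∈ T \ U := mem_sdiff.2 ⟨hi, hiU⟩
      exact (e1 this).1 (h₁ (p i) Fact.out (hp2 i)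
        (((dvd_partProd_iff p hinj i _).2 this).mul_left k))
  · intro h
    constructor
    · intro q hq hq2 hqd
      have hqk : ¬ q ∣ k := fun e => by
        have : k = 1 ∨ k = 2 := by tauto
        rcases this with rfl | rfl
        · exact hq.one_lt.ne' (Nat.dvd_one.1 e)
        · exact hq2 ((Nat.prime_dvd_prime_iff_eq hq Nat.prime_two).1 e)
      obtain ⟨i, hi, rfl⟩ := hpr q hq _ ((hq.dvd_mul.1 hqd).resolve_left hqk)
      exact (e1 hi).2 (h i (mem_sdiff.1 hi).1)
    · intro q hq hq2 hqd
      obtain ⟨i, hi, rfl⟩ := hpr q hq _ hqd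
      exact (e2 hi).2 (h i (hU hi))

theorem partProd_eq_one_iff {T : Finset (Fin r)} : partProd p T = 1 ↔ T = ∅ := by
  rw [← (partProd_injective p hinj).eq_iff]
  simp [partProd]

/-- `x² + d y² = m z²` has a nontrivial solution, for odd `d`. -/
theorem conic_odd_iff {T U : Finset (Fin r)} (hU : U ⊆ T) (t : F₂) :
    (∃ x y z : ℤ, z ≠ 0 ∧
      x ^ 2 + partProd p T * y ^ 2 = ((if t = 1 then 2 else 1) * partProd p U : ℕ) * z ^ 2) ↔
    ∀ i ∈ T, (net T (weight p) 0 *ᵥ res U 1) i + t * vecZ p i = 0 := by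
  rw [← partProd_mul_sdiff p hU, conic_iff_conic (squarefree_partProd p hinj U)]
  have h := conic_partProd_iff p hp2 hinj (c := if t = 1 then 2 else 1) (k := 1)
    (by split_ifs <;> simp) hU
  rw [one_mul] at h
  rw [h]
  rcases zmod2_eq_zero_or_one t with rfl | rfl <;> simp

theorem g_partProd_of_three {T : Finset (Fin r)} (hT : ∑ i ∈ T, vecY p i = 1) :
    g (partProd p T) = 0 ↔ ∃ U ⊆ T, ¬ (U = ∅ ∨ U = T) ∧
      ∀ i ∈ T, (net T (weight p) 0 *ᵥ res U 1) i = 0 := by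
  have h4 : partProd p T % 4 = 3 := by
    rcases partProd_mod_eight p hp2 T with h | h | h | h
    · simp [h.1] at hT
    · omega
    · simp [h.1] at hT
    · omega
  rw [g_eq_zero_iff (squarefree_partProd p hinj T) (by omega)]
  constructor
  · rintro ⟨m, -, hm1, hmd, hm | ⟨h, -⟩, hc⟩
    · obtain ⟨U, hU, rfl⟩ := (dvd_partProd p).1 hm
      refine ⟨U, hU, ?_, ?_⟩
      · rintro (rfl | rfl)
        · exact hm1 ((partProd_eq_one_iff p hp2 hinj).2 rfl)
        · exact hmd rfl
      · have := (conic_odd_iff p hp2 hinj hU 0).1 (by simpa using hc)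
        simpa using this
    · omega
  · rintro ⟨U, hU, hU', h⟩
    refine ⟨partProd p U, squarefree_partProd p hinj U, fun e => hU' (Or.inl ?_),
      fun e => hU' (Or.inr (partProd_injective p hinj e)), Or.inl ((dvd_partProd p).2 ⟨U, hU, rfl⟩), ?_⟩
    · exact (partProd_eq_one_iff p hp2 hinj).1 e
    · have := (conic_odd_iff p hp2 hinj hU 0).2 (by simpa using h)
      simpa using this

/-- Here 2 ramifies, so m may also be twice a divisor; this is the case t = 1, which is never
trivial. -/
theorem g_partProd_of_one {T : Finset (Fin r)} (hne : T.Nonempty) (hT : ∑ i ∈ T, vecY p i = 0) :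
    g (partProd p T) = 0 ↔ ∃ U ⊆ T, ∃ t : F₂, ¬ (t = 0 ∧ (U = ∅ ∨ U = T)) ∧
      ∀ i ∈ T, (net T (weight p) 0 *ᵥ res U 1) i + t * vecZ p i = 0 := by
  have h4 : partProd p T % 4 = 1 := by
    rcases partProd_mod_eight p hp2 T with h | h | h | h
    · omega
    · simp [h.1] at hT
    · omega
    · simp [h.1] at hT
  have hT1 : partProd p T ≠ 1 := fun e => hne.ne_empty ((partProd_eq_one_iff p hp2 hinj).1 e)
  have hodd := odd_partProd p hp2
  rw [g_eq_zero_iff (squarefree_partProd p hinj T) hT1]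
  constructor
  · rintro ⟨m, -, hm1, hmd, hm | ⟨-, m', rfl, hm⟩, hc⟩
    · obtain ⟨U, hU, rfl⟩ := (dvd_partProd p).1 hm
      refine ⟨U, hU, 0, ?_, ?_⟩
      · rintro ⟨-, rfl | rfl⟩
        · exact hm1 ((partProd_eq_one_iff p hp2 hinj).2 rfl)
        · exact hmd rfl
      · exact (conic_odd_iff p hp2 hinj hU 0).1 (by simpa using hc)
    · obtain ⟨U, hU, rfl⟩ := (dvd_partProd p).1 hm
      exact ⟨U, hU, 1, by simp, (conic_odd_iff p hp2 hinj hU 1).1 (by simpa using hc)⟩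
  · rintro ⟨U, hU, t, hU', h⟩
    have hc := (conic_odd_iff p hp2 hinj hU t).2 h
    have hdvd : partProd p U ∣ partProd p T := (dvd_partProd p).2 ⟨U, hU, rfl⟩
    rcases zmod2_eq_zero_or_one t with rfl | rfl
    · refine ⟨partProd p U, squarefree_partProd p hinj U, fun e => hU' ⟨rfl, Or.inl ?_⟩,
        fun e => hU' ⟨rfl, Or.inr (partProd_injective p hinj e)⟩, Or.inl hdvd, ?_⟩
      · exact (partProd_eq_one_iff p hp2 hinj).1 e
      · simpa using hc
    · refine ⟨2 * partProd p U, ?_, by omega, by have := hodd T; omega,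
        Or.inr ⟨h4, partProd p U, rfl, hdvd⟩, by simpa using hc⟩
      rw [Nat.squarefree_mul (Nat.coprime_two_left.2 (Nat.odd_iff.2 (hodd U)))]
      exact ⟨Nat.prime_two.prime.squarefree, squarefree_partProd p hinj U⟩

/-- The divisors m and d/m impose the same conic up to exchanging x and y, so only the odd one of
the two is recorded, as `U`. The empty `U` stands for the excluded m = 1 and m = d. -/
theorem g_two_mul_partProd (T : Finset (Fin r)) :
    g (2 * partProd p T) = 0 ↔ ∃ U ⊆ T, U.Nonempty ∧
      ∀ i ∈ T, (net T (weight p) (vecZ p) *ᵥ res U 1) i = 0 := by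
  have hodd := odd_partProd p hp2
  have hsq : Squarefree (2 * partProd p T) := by
    rw [Nat.squarefree_mul (Nat.coprime_two_left.2 (Nat.odd_iff.2 (hodd T)))]
    exact ⟨Nat.prime_two.prime.squarefree, squarefree_partProd p hinj T⟩
  have hcon {U : Finset (Fin r)} (hU : U ⊆ T) := conic_partProd_iff p hp2 hinj (c := 1) (k := 2)
    (by simp) hU
  simp only [if_true, OfNat.one_ne_ofNat, if_false, zero_mul, add_zero] at hcon
  rw [g_eq_zero_iff hsq (by omega)]
  constructor
  · rintro ⟨m, hm0, hm1, hmd, hm | ⟨h4, -⟩, hc⟩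
    · obtain ⟨k, hk⟩ := hm
      rw [hk] at hc
      nth_rewrite 2 [← one_mul m] at hc
      rw [conic_iff_conic hm0] at hc
      by_cases h2 : 2 ∣ m
      · obtain ⟨m, rfl⟩ := h2
        have hk' : partProd p T = m * k := by
          rw [mul_assoc] at hk
          exact Nat.eq_of_mul_eq_mul_left two_pos hk
        obtain ⟨U, hU, rfl⟩ := (dvd_partProd p).1 (Dvd.intro_left m hk'.symm)
        have hm : m = partProd p (T \ U) := by
          rw [← partProd_mul_sdiff p hU, mul_comm] at hk'
          exact (Nat.eq_of_mul_eq_mul_right (partProd_pos p U) hk').symm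
        subst hm
        refine ⟨U, hU, ?_, (hcon hU).1 ?_⟩
        · rw [nonempty_iff_ne_empty]
          rintro rfl
          exact hmd (by rw [sdiff_empty])
        · obtain ⟨x, y, z, hz, h⟩ := hc
          exact ⟨y, x, z, hz, by rw [← h, add_comm]⟩
      · have hk2 : 2 ∣ k := (Nat.prime_two.dvd_mul.1 (Dvd.intro _ hk)).resolve_left h2
        obtain ⟨k, rfl⟩ := hk2
        have hk' : partProd p T = m * k := by
          rw [mul_left_comm] at hk
          exact Nat.eq_of_mul_eq_mul_left two_pos hk
        obtain ⟨U, hU, rfl⟩ := (dvd_partProd p).1 (Dvd.intro k hk'.symm)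
        have hm : k = partProd p (T \ U) := by
          rw [← partProd_mul_sdiff p hU] at hk'
          exact (Nat.eq_of_mul_eq_mul_left (partProd_pos p U) hk').symm
        subst hm
        refine ⟨U, hU, ?_, (hcon hU).1 hc⟩
        rw [nonempty_iff_ne_empty]
        exact fun e => hm1 ((partProd_eq_one_iff p hp2 hinj).2 e)
    · omega
  · rintro ⟨U, hU, hne, h⟩
    have hT : 2 * partProd p T = partProd p U * (2 * partProd p (T \ U)) := by
      rw [← partProd_mul_sdiff p hU]
      ring
    refine ⟨partProd p U, squarefree_partProd p hinj U,
      fun e => hne.ne_empty ((partProd_eq_one_iff p hp2 hinj).1 e),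
      by have := hodd U; omega, Or.inl ⟨_, hT⟩, ?_⟩
    rw [hT]
    nth_rewrite 2 [← one_mul (partProd p U)]
    rw [conic_iff_conic (squarefree_partProd p hinj U)]
    exact (hcon hU).2 h

omit hinj hp2 in
variable {p} in
/-- The Rédei data of the odd primes `p`. -/
def redeiData (hp2 : ∀ i, p i ≠ 2) (hinj : Function.Injective p) : RedeiData (Fin r) where
  a := weight p
  y := vecY p
  z := vecZ p
  gf T := g (partProd p T)
  ge T := g (2 * partProd p T)
  recip i j hij := addLegendre_reciprocity (hp2 i) (hp2 j) (hinj.ne hij)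
  tau_odd T hT u := by
    have recip (i j) (hij : i ≠ j) : weight p i j + weight p j i = vecY p i * vecY p j :=
      addLegendre_reciprocity (hp2 i) (hp2 j) (hinj.ne hij)
    rcases zmod2_eq_zero_or_one (∑ i ∈ T, u i) with h | h
    · rw [h, mul_zero, tau_eq_zero_of_sum_eq_zero recip hT h]
    · rw [h, mul_one]
      apply zmod2_eq_of_iff
      rw [tau_eq_zero_iff_of_sum_eq_one recip hT h, g_partProd_of_three p hp2 hinj hT]
  tau_even T hne hT := by
    apply zmod2_eq_of_iff
    rw [tau_eq_zero_iff hne, g_partProd_of_one p hp2 hinj hne hT]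
  ge_eq T := by
    apply zmod2_eq_of_iff
    rw [det_net_eq_zero_iff, g_two_mul_partProd p hp2 hinj]

end PartProd

/-! ### The function ℒ and the divisor sums as convolutions -/

theorem scriptL_one : scriptL 1 = 1 := by
  rw [scriptL, if_pos rfl]

theorem scriptL_eq_zero {n : ℕ} (h1 : n ≠ 1) (h : ¬ (n ≡ 1 [MOD 8] ∧ Squarefree n)) :
    scriptL n = 0 := by
  rw [scriptL, if_neg h1, dif_neg h]

theorem scriptL_eq_sum {n : ℕ} (h1 : n ≠ 1) (h : n ≡ 1 [MOD 8] ∧ Squarefree n) :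
    scriptL n = ∑ d ∈ n.divisors with n.minFac ∣ d ∧ d ≡ 1 [MOD 8], g d * scriptL (n / d) := by
  rw [scriptL, if_neg h1, dif_pos h]
  exact sum_attach (n.divisors.filter fun d => n.minFac ∣ d ∧ d ≡ 1 [MOD 8])
    fun d => g d * scriptL (n / d)

theorem sumTwo_eq {n : ℕ} (hn : n ≠ 0) (P Q : ℕ → Prop) [DecidablePred P] [DecidablePred Q] :
    sumTwo n P Q = ∑ d ∈ n.divisors with P d, g d * sumOne (n / d) Q := by
  simp only [sumTwo, sumOne, mul_sum]
  rw [sum_sigma']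
  refine sum_bij' (fun x _ => ⟨x.1, x.2⟩) (fun x _ => (x.1, x.2)) ?_ ?_ ?_ ?_ ?_
  · rintro ⟨d, e⟩ h
    simp only [mem_filter, mem_product, Nat.mem_divisors, mem_sigma] at h ⊢
    have h0 : n / d ≠ 0 := (Nat.div_pos (Nat.le_of_dvd (Nat.pos_of_ne_zero hn) h.1.1.1)
      (Nat.pos_of_dvd_of_pos h.1.1.1 (Nat.pos_of_ne_zero hn))).ne'
    exact ⟨⟨h.1.1, h.2.2.1⟩, ⟨Nat.dvd_div_of_mul_dvd h.2.1, h0⟩, h.2.2.2⟩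
  · rintro ⟨d, e⟩ h
    simp only [mem_filter, mem_product, Nat.mem_divisors, mem_sigma] at h ⊢
    have h1 := Nat.mul_dvd_of_dvd_div h.1.1.1 h.2.1.1
    exact ⟨⟨h.1.1, (Dvd.intro_left d rfl).trans h1, hn⟩, h1, h.1.2, h.2.2⟩
  · intros; rfl
  · intros; rfl
  · rintro ⟨d, e⟩ h
    simp only [Nat.div_div_eq_div_mul, mul_assoc]

section Sums

variable {r : ℕ} {p : Fin r → ℕ} [∀ i, Fact (p i).Prime]
  (hp2 : ∀ i, p i ≠ 2) (hinj : Function.Injective p)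

theorem partProd_div {U T : Finset (Fin r)} (h : U ⊆ T) :
    partProd p T / partProd p U = partProd p (T \ U) := by
  rw [← partProd_mul_sdiff p h, Nat.mul_div_cancel_left _ (partProd_pos p U)]

include hinj in
theorem sum_divisors_partProd (T : Finset (Fin r)) (P : ℕ → Prop) [DecidablePred P] (f : ℕ → F₂) :
    ∑ d ∈ (partProd p T).divisors with P d, f d =
      ∑ U ∈ T.powerset, if P (partProd p U) then f (partProd p U) else 0 := by
  have : (partProd p T).divisors = T.powerset.image (partProd p) := by
    ext m
    simp only [Nat.mem_divisors, dvd_partProd, (partProd_pos p T).ne', mem_image, mem_powerset,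
      ne_eq, not_false_eq_true, and_true, eq_comm]
  rw [sum_filter, this, sum_image (partProd_injective p hinj).injOn]

include hinj in
theorem sum_divisors_two_mul_partProd (T : Finset (Fin r)) (P : ℕ → Prop) [DecidablePred P]
    (hP : ∀ d, P d → 2 ∣ d) (f : ℕ → F₂) :
    ∑ d ∈ (2 * partProd p T).divisors with P d, f d =
      ∑ U ∈ T.powerset, if P (2 * partProd p U) then f (2 * partProd p U) else 0 := by
  rw [← sum_divisors_partProd hinj T (fun d => P (2 * d)) fun d => f (2 * d)]
  refine (sum_bij (fun d _ => 2 * d) ?_ ?_ ?_ ?_).symm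
  · intro d hd
    simp only [mem_filter, Nat.mem_divisors] at hd ⊢
    exact ⟨⟨mul_dvd_mul_left 2 hd.1.1, mul_ne_zero two_ne_zero hd.1.2⟩, hd.2⟩
  · intro d _ e _ h
    exact Nat.eq_of_mul_eq_mul_left two_pos h
  · intro d hd
    simp only [mem_filter, Nat.mem_divisors] at hd
    obtain ⟨e, rfl⟩ := hP d hd.2
    refine ⟨e, ?_, rfl⟩
    simp only [mem_filter, Nat.mem_divisors]
    exact ⟨⟨Nat.dvd_of_mul_dvd_mul_left two_pos hd.1.1, (partProd_pos p T).ne'⟩, hd.2⟩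
  · intros; rfl

/-- The odd residue class modulo 8 that is given by the weights `α` and `β`. -/
def residue (α β : F₂) : ℕ := if α = 0 then (if β = 0 then 1 else 5) else if β = 0 then 7 else 3

include hp2 in
theorem partProd_modEq_iff (T : Finset (Fin r)) (α β : F₂) :
    partProd p T ≡ residue α β [MOD 8] ↔ ∑ i ∈ T, vecY p i = α ∧ ∑ i ∈ T, vecZ p i = β := by
  rw [Nat.ModEq]
  rcases partProd_mod_eight p hp2 T with h | h | h | h <;> rw [h.1, h.2.1, h.2.2] <;>
    revert α β <;> decide

theorem G_redeiData {T : Finset (Fin r)} (hT : T.Nonempty) (α β : F₂) :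
    (redeiData hp2 hinj).G α β T =
      if partProd p T ≡ residue α β [MOD 8] then g (partProd p T) else 0 := by
  rw [RedeiData.G, if_congr (partProd_modEq_iff hp2 T α β) rfl rfl]
  simp only [hT, true_and]
  rfl

theorem E1_eq_zero {T : Finset (Fin r)} (hT : ¬ partProd p T ≡ 1 [MOD 8]) :
    (redeiData hp2 hinj).E1 T = 0 := by
  have h := (partProd_modEq_iff hp2 T 0 0).not.1 hT
  rw [not_and_or] at h
  rcases h with h | h
  · exact (redeiData hp2 hinj).even_E1_y.apply ((zmod2_eq_zero_or_one _).resolve_left h)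
  · exact (redeiData hp2 hinj).even_E1_z.apply ((zmod2_eq_zero_or_one _).resolve_left h)

theorem E1_recursion {T : Finset (Fin r)} {q : Fin r} (hq : q ∈ T)
    (hL : ∀ U ⊆ T, q ∈ U → scriptL (partProd p (T \ U)) = (redeiData hp2 hinj).E1 (T \ U)) :
    (redeiData hp2 hinj).E1 T = ∑ d ∈ (partProd p T).divisors with p q ∣ d ∧ d ≡ 1 [MOD 8],
      g d * scriptL (partProd p T / d) := by
  rw [(redeiData hp2 hinj).isExp_E1.recursion hq, sum_divisors_partProd hinj, sum_filter]
  refine sum_congr rfl fun U hU => ?_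
  rw [mem_powerset] at hU
  by_cases hqU : q ∈ U
  · rw [if_pos hqU, G_redeiData hp2 hinj ⟨q, hqU⟩, partProd_div hU, hL U hU hqU, ite_mul, zero_mul]
    simp only [dvd_partProd_iff p hinj, hqU, true_and]
    rfl
  · rw [if_neg hqU, if_neg]
    rw [dvd_partProd_iff p hinj]
    exact fun h => hqU h.1

/-- The recursion for ℒ at the smallest prime is the exponential recursion at its index, which holds
at every index. Off the class 1 mod 8 both sides vanish, since `E1` is even for both weights. -/
theorem scriptL_partProd (T : Finset (Fin r)) :
    scriptL (partProd p T) = (redeiData hp2 hinj).E1 T := by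
  induction T using Finset.strongInduction with
  | H T ih =>
  rcases T.eq_empty_or_nonempty with rfl | hne
  · rw [((SetFun.isExp_iff).1 (redeiData hp2 hinj).isExp_E1).1]
    exact scriptL_one
  have h1 : partProd p T ≠ 1 := fun e => hne.ne_empty ((partProd_eq_one_iff p hp2 hinj).1 e)
  by_cases h8 : partProd p T ≡ 1 [MOD 8]
  · rw [scriptL_eq_sum h1 ⟨h8, squarefree_partProd p hinj T⟩]
    have hmin := Nat.minFac_prime h1
    obtain ⟨q, hq, hqm⟩ : ∃ q ∈ T, (partProd p T).minFac = p q := by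
      obtain ⟨q, hq, h⟩ := (hmin.prime.dvd_finsetProd_iff p).1 (Nat.minFac_dvd (partProd p T))
      exact ⟨q, hq, (Nat.prime_dvd_prime_iff_eq hmin Fact.out).1 h⟩
    rw [hqm, E1_recursion hp2 hinj hq fun U hU hqU => ih _ (sdiff_ssubset hU ⟨q, hqU⟩)]
  · rw [scriptL_eq_zero h1 fun h => h8 h.1, E1_eq_zero hp2 hinj h8]

/-- The class 1 is excluded because there the divisor 1 would contribute to the left side, while `G`
vanishes on the empty set. -/
theorem sumOne_partProd (T : Finset (Fin r)) {α β : F₂} (h : ¬ (α = 0 ∧ β = 0)) :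
    sumOne (partProd p T) (fun d => d ≡ residue α β [MOD 8]) =
      ((redeiData hp2 hinj).G α β * (redeiData hp2 hinj).E1) T := by
  rw [sumOne, sum_divisors_partProd hinj, SetFun.mul_apply]
  refine sum_congr rfl fun U hU => ?_
  rw [partProd_div (mem_powerset.1 hU), scriptL_partProd hp2 hinj]
  rcases U.eq_empty_or_nonempty with rfl | hne
  · rw [if_neg]
    · simp [RedeiData.G]
    · rw [partProd_modEq_iff hp2]
      rintro ⟨rfl, rfl⟩
      exact h ⟨rfl, rfl⟩
  · rw [G_redeiData hp2 hinj hne, ite_mul, zero_mul]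

theorem sumTwo_partProd (T : Finset (Fin r)) {α β α' β' : F₂} (h : ¬ (α = 0 ∧ β = 0))
    (h' : ¬ (α' = 0 ∧ β' = 0)) :
    sumTwo (partProd p T) (fun d => d ≡ residue α β [MOD 8]) (fun d => d ≡ residue α' β' [MOD 8]) =
      ((redeiData hp2 hinj).G α β * (redeiData hp2 hinj).G α' β' * (redeiData hp2 hinj).E1) T := by
  rw [sumTwo_eq (partProd_pos p T).ne', sum_divisors_partProd hinj, mul_assoc, SetFun.mul_apply]
  refine sum_congr rfl fun U hU => ?_
  rw [partProd_div (mem_powerset.1 hU), sumOne_partProd hp2 hinj _ h']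
  rcases U.eq_empty_or_nonempty with rfl | hne
  · rw [if_neg]
    · simp [RedeiData.G]
    · rw [partProd_modEq_iff hp2]
      rintro ⟨rfl, rfl⟩
      exact h ⟨rfl, rfl⟩
  · rw [G_redeiData hp2 hinj hne, ite_mul, zero_mul]

theorem two_mul_partProd_div {U T : Finset (Fin r)} (h : U ⊆ T) :
    2 * partProd p T / (2 * partProd p U) = partProd p (T \ U) := by
  rw [Nat.mul_div_mul_left _ _ two_pos, partProd_div h]

include hp2 in
theorem two_mul_partProd_modEq_iff {U T : Finset (Fin r)} (h : U ⊆ T) :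
    2 * partProd p U ≡ 2 * partProd p T [MOD 16] ↔ partProd p (T \ U) ≡ 1 [MOD 8] := by
  rw [← partProd_mul_sdiff p h]
  simp only [Nat.ModEq]
  have e : 2 * partProd p U % 16 = 2 * (partProd p U % 8) := by omega
  have e' : 2 * (partProd p U * partProd p (T \ U)) % 16 =
      2 * (partProd p U * partProd p (T \ U) % 8) := by omega
  rw [e, e', Nat.mul_mod (partProd p U)]
  rcases partProd_mod_eight p hp2 U with h | h | h | h <;>
    rcases partProd_mod_eight p hp2 (T \ U) with h' | h' | h' | h' <;>
    rw [h.2.2, h'.2.2] <;> decide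

include hp2 in
theorem two_mul_partProd_modEq_seven_iff {U T : Finset (Fin r)} (h : U ⊆ T) :
    2 * partProd p U ≡ 7 * (2 * partProd p T) [MOD 16] ↔ partProd p (T \ U) ≡ 7 [MOD 8] := by
  rw [← partProd_mul_sdiff p h]
  simp only [Nat.ModEq]
  have e : 2 * partProd p U % 16 = 2 * (partProd p U % 8) := by omega
  have e' : 7 * (2 * (partProd p U * partProd p (T \ U))) % 16 =
      2 * (7 * (partProd p U * partProd p (T \ U) % 8) % 8) := by omega
  rw [e, e', Nat.mul_mod (partProd p U)]
  rcases partProd_mod_eight p hp2 U with h | h | h | h <;>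
    rcases partProd_mod_eight p hp2 (T \ U) with h' | h' | h' | h' <;>
    rw [h.2.2, h'.2.2] <;> decide

theorem even_of_modEq_two_mul {d k : ℕ} (h : d ≡ 2 * k [MOD 16]) : 2 ∣ d := by
  rw [Nat.ModEq] at h
  omega

/-- The congruence modulo 16 says that the cofactor is 1 mod 8. The function `E1` is supported
there, so the condition can be dropped. -/
theorem sumOne_two_mul_partProd (T : Finset (Fin r)) :
    sumOne (2 * partProd p T) (fun d => d ≡ 2 * partProd p T [MOD 16]) =
      ((redeiData hp2 hinj).ge * (redeiData hp2 hinj).E1 : SetFun (Fin r)) T := by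
  rw [sumOne, sum_divisors_two_mul_partProd hinj _ _ fun d hd => even_of_modEq_two_mul hd,
    SetFun.mul_apply]
  refine sum_congr rfl fun U hU => ?_
  rw [mem_powerset] at hU
  rw [two_mul_partProd_div hU, scriptL_partProd hp2 hinj]
  split_ifs with h
  · rfl
  · rw [two_mul_partProd_modEq_iff hp2 hU] at h
    rw [E1_eq_zero hp2 hinj h, mul_zero]

theorem sumTwo_two_mul_partProd (T : Finset (Fin r)) :
    sumTwo (2 * partProd p T) (fun d => d ≡ 7 * (2 * partProd p T) [MOD 16])
      (fun d => d ≡ 7 [MOD 8]) = ((redeiData hp2 hinj).ge *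
        ((redeiData hp2 hinj).G 1 0 * (redeiData hp2 hinj).E1) : SetFun (Fin r)) T := by
  rw [sumTwo_eq (by have := partProd_pos p T; omega),
    sum_divisors_two_mul_partProd hinj _ _ fun d hd =>
      even_of_modEq_two_mul (k := 7 * partProd p T) (by rwa [mul_left_comm] at hd), SetFun.mul_apply]
  refine sum_congr rfl fun U hU => ?_
  rw [mem_powerset] at hU
  have h7 := sumOne_partProd hp2 hinj (T \ U) (α := 1) (β := 0) (by decide)
  rw [two_mul_partProd_div hU]
  split_ifs with h
  · rw [← h7]
    rfl
  · rw [two_mul_partProd_modEq_seven_iff hp2 hU] at h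
    have h' := (partProd_modEq_iff hp2 (T \ U) 1 0).not.1 h
    rw [not_and_or] at h'
    have hz : ((redeiData hp2 hinj).G 1 0 * (redeiData hp2 hinj).E1) (T \ U) = 0 := by
      rcases h' with h' | h'
      · exact (((redeiData hp2 hinj).odd_G_y 0).mul_even (redeiData hp2 hinj).even_E1_y).apply
          ((zmod2_eq_zero_or_one _).resolve_right h')
      · exact (((redeiData hp2 hinj).even_G_z 1).mul (redeiData hp2 hinj).even_E1_z).apply
          ((zmod2_eq_zero_or_one _).resolve_left h')
    rw [hz, mul_zero]

theorem matA_eq : matA p = (redeiData hp2 hinj).A := by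
  ext i j
  rcases eq_or_ne i j with rfl | h
  · simp [matA, RedeiData.A, net, redeiData, weight]
  · simp [matA, RedeiData.A, net, redeiData, weight, h]

end Sums

end TYZ

end

/-! ### The theorem -/

theorem mainTheorem5 (n : ℕ) (hn : Squarefree n) (r : ℕ) (p : Fin r → ℕ)
    [∀ i, Fact (p i).Prime] (hp : ∏ i, p i = ordCompl[2] n) :
    (n ≡ 1 [MOD 8] → ∀ q : ℕ, q.Prime → q ∣ n →
      TYZ.scriptL n =
        ∑ d ∈ n.divisors with q ∣ d ∧ d ≡ 1 [MOD 8], TYZ.g d * TYZ.scriptL (n / d)) ∧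
    (n ≡ 1 [MOD 8] → TYZ.L1 n = (TYZ.M1 (TYZ.matA p) (TYZ.vecZ p)).det) ∧
    (n ≡ 2 [MOD 8] → TYZ.L2 n = (TYZ.M2 (TYZ.matA p) (TYZ.vecY p) (TYZ.vecZ p)).det) ∧
    (n ≡ 3 [MOD 8] → TYZ.L3 n = (TYZ.M3 (TYZ.matA p) (TYZ.vecY p) (TYZ.vecZ p)).det) ∧
    (n ≡ 5 [MOD 8] → TYZ.L5a n = (TYZ.M5a (TYZ.matA p) (TYZ.vecY p) (TYZ.vecZ p)).det) ∧
    (n ≡ 5 [MOD 8] → TYZ.L5b n = (TYZ.M5b (TYZ.matA p) (TYZ.vecY p) (TYZ.vecZ p)).det) ∧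
    (n ≡ 6 [MOD 8] → TYZ.L6 n = (TYZ.M6 (TYZ.matA p) (TYZ.vecY p) (TYZ.vecZ p)).det) ∧
    (n ≡ 7 [MOD 8] → TYZ.L7a n = (TYZ.M7a (TYZ.matA p) (TYZ.vecY p) (TYZ.vecZ p)).det) ∧
    (n ≡ 7 [MOD 8] → TYZ.L7b n = (TYZ.M7b (TYZ.matA p) (TYZ.vecY p) (TYZ.vecZ p)).det) := by
  have hdvd (i : Fin r) : p i ∣ ordCompl[2] n := by
    rw [← hp]
    exact Finset.dvd_prod_of_mem p (Finset.mem_univ i)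
  have hp2 (i : Fin r) : p i ≠ 2 := by
    intro e
    have h := hdvd i
    rw [e] at h
    exact Nat.not_dvd_ordCompl Nat.prime_two hn.ne_zero h
  have hinj : Function.Injective p := by
    intro i j h
    by_contra hij
    have h₁ : p i * p i ∣ ∏ i, p i := by
      rw [← Finset.mul_prod_erase _ _ (Finset.mem_univ i)]
      refine mul_dvd_mul_left _ ?_
      nth_rewrite 1 [h]
      exact Finset.dvd_prod_of_mem p (Finset.mem_erase.2 ⟨Ne.symm hij, Finset.mem_univ j⟩)
    rw [hp] at h₁
    have h₂ := Nat.isUnit_iff.1 (hn _ (h₁.trans (Nat.ordCompl_dvd n 2)))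
    exact (Fact.out : (p i).Prime).one_lt.ne' h₂
  have hodd : n % 2 = 1 → n = TYZ.partProd p Finset.univ := by
    intro h
    rw [TYZ.partProd, hp, Nat.factorization_eq_zero_of_not_dvd (by omega), pow_zero, Nat.div_one]
  have heven : n % 2 = 0 → n = 2 * TYZ.partProd p Finset.univ := by
    intro h
    have h1 : n.factorization 2 = 1 :=
      le_antisymm (hn.natFactorization_le_one 2)
        (Nat.Prime.factorization_pos_of_dvd Nat.prime_two hn.ne_zero (by omega))
    rw [TYZ.partProd, hp, h1, pow_one]
    omega
  have hA := TYZ.matA_eq (p := p) hp2 hinj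
  have hmod := TYZ.partProd_mod_eight p hp2 Finset.univ
  let R := TYZ.redeiData hp2 hinj
  refine ⟨?_, ?_, ?_, ?_, ?_, ?_, ?_, ?_, ?_⟩ <;> intro h8 <;> rw [Nat.ModEq] at h8
  · obtain rfl := hodd (by omega)
    intro q hq hqn
    obtain ⟨i, hi, h⟩ := (hq.prime.dvd_finsetProd_iff p).1 hqn
    obtain rfl := (Nat.prime_dvd_prime_iff_eq hq Fact.out).1 h
    rw [TYZ.scriptL_partProd hp2 hinj]
    exact TYZ.E1_recursion hp2 hinj hi fun U _ _ => TYZ.scriptL_partProd hp2 hinj _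
  · obtain rfl := hodd (by omega)
    rw [hA, TYZ.L1, TYZ.scriptL_partProd hp2 hinj]
    exact R.det_M1.symm
  · have e := heven (by omega)
    have hy : ∑ i, TYZ.vecY p i = 0 := by
      rcases hmod with h | h | h | h <;> first | exact h.1 | omega
    rw [hA, TYZ.L2]
    refine Eq.trans ?_ (R.det_M2' hy).symm
    rw [e]
    exact TYZ.sumOne_two_mul_partProd hp2 hinj _
  · obtain rfl := hodd (by omega)
    have hy : ∑ i, TYZ.vecY p i = 1 := by
      rcases hmod with h | h | h | h <;> first | exact h.1 | omega
    rw [hA, TYZ.L3]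
    exact (TYZ.sumOne_partProd hp2 hinj _ (α := 1) (β := 1) (by decide)).trans (R.det_M3 hy).symm
  · obtain rfl := hodd (by omega)
    have hyz : ∑ i, TYZ.vecY p i = 0 ∧ ∑ i, TYZ.vecZ p i = 1 := by
      rcases hmod with h | h | h | h <;> first | exact ⟨h.1, h.2.1⟩ | omega
    rw [hA, TYZ.L5a]
    exact (TYZ.sumOne_partProd hp2 hinj _ (α := 0) (β := 1) (by decide)).trans
      (R.det_M5a hyz.1 hyz.2).symm
  · obtain rfl := hodd (by omega)
    have hy : ∑ i, TYZ.vecY p i = 0 := by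
      rcases hmod with h | h | h | h <;> first | exact h.1 | omega
    rw [hA, TYZ.L5b]
    exact (TYZ.sumTwo_partProd hp2 hinj _ (α := 1) (β := 0) (α' := 1) (β' := 1)
      (by decide) (by decide)).trans (R.det_M5b hy).symm
  · have e := heven (by omega)
    have hy : ∑ i, TYZ.vecY p i = 1 := by
      rcases hmod with h | h | h | h <;> first | exact h.1 | omega
    rw [hA, TYZ.L6]
    refine Eq.trans ?_ (R.det_M6 hy).symm
    rw [e, TYZ.sumOne_two_mul_partProd hp2 hinj, TYZ.sumTwo_two_mul_partProd hp2 hinj,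
      mul_left_comm, ← mul_assoc]
  · obtain rfl := hodd (by omega)
    have hyz : ∑ i, TYZ.vecY p i = 1 ∧ ∑ i, TYZ.vecZ p i = 0 := by
      rcases hmod with h | h | h | h <;> first | exact ⟨h.1, h.2.1⟩ | omega
    rw [hA, TYZ.L7a]
    exact (TYZ.sumOne_partProd hp2 hinj _ (α := 1) (β := 0) (by decide)).trans
      (R.det_M7a hyz.1 hyz.2).symm
  · obtain rfl := hodd (by omega)
    have hyz : ∑ i, TYZ.vecY p i = 1 ∧ ∑ i, TYZ.vecZ p i = 0 := by
      rcases hmod with h | h | h | h <;> first | exact ⟨h.1, h.2.1⟩ | omega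
    rw [hA, TYZ.L7b]
    exact (TYZ.sumTwo_partProd hp2 hinj _ (α := 0) (β := 1) (α' := 1) (β' := 1)
      (by decide) (by decide)).trans (R.det_M7b hyz.1 hyz.2).symm
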